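/- Let $1\le\alpha\le 2$, $B=\alpha(\alpha+1)/2$, $\omega(\xi,\mu)=\xi(|\xi|^\alpha+\mu^2)$, and let $U(t)=e^{t\partial_x(D_x^\alpha-\partial_{yy})}$ be the group acting on $L^2(\mathbb{R}^2)$ as the Fourier multiplier by $e^{it\omega(\xi,\mu)}$, where $(\xi,\mu)$ are the Fourier variables of $(x,y)$. For $\delta\in(0,1)$ set $$A_\delta=\{(\xi,\mu)\in\mathbb{R}^2 : (B-\delta)|\xi|^\alpha\le\mu^2\le(B+\delta)|\xi|^\alpha\},$$ and let $P_{A_\delta^c}$ be the Fourier multiplier by the indicator function of $\mathbb{R}^2\setminus A_\delta$. Fix $\chi\in C_0^\infty(\mathbb{R})$ with $0\le\chi\le1$, $\chi=1$ on $[-\frac43,\frac43]$ and $\chi(\xi)=0$ for $|\xi|>\frac53$; put $\varphi(\xi)=\chi(\xi)-\chi(2\xi)$, $\varphi_1=\chi$, $\varphi_N(\xi)=\varphi(\xi/N)$ for $N=2^\ell$, $\ell\ge1$, and let $P_N^x$ be the Fourier multiplier by $\varphi_N(\xi)$. There is an absolute constant $\varepsilon_0>0$ such that the following holds for all $\alpha\in[1,2]$,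 $\delta\in(0,1)$, $\chi$ as above, $\theta\in[0,1)$, $\varepsilon\in(0,\varepsilon_0)$, and $p,q\in[1,\infty]$ with $$\frac1q=\theta\,\frac{1-\varepsilon}2,\qquad \frac1p=\frac{1-\theta}2 .$$ (i) There is a constant $C$, depending only on $\alpha,\delta,\chi,\theta,\varepsilon$, such that for every dyadic $N=2^\ell$ with $\ell\ge1$ and every $\phi\in L^2(\mathbb{R}^2)$, $$\|P_N^xP_{A_\delta^c}U(t)\phi\|_{L^q_t(\mathbb{R};L^p_{xy})}\le C\,N^{\theta(\varepsilon(\alpha+1)-\frac\alpha4)}\|\phi\|_{L^2}.$$ (ii) For the low-frequency block $N=1$ the same estimate holds locally in time: for every $T>0$ there is a constant $C_T$, depending only on $T,\alpha,\delta,\chi,\theta,\varepsilon$, such that for every $\phi\in L^2(\mathbb{R}^2)$, $$\|P_1^xP_{A_\delta^c}U(t)\phi\|_{L^q_t([-T,T];L^p_{xy})}\le C_T\,\|\phi\|_{L^2}.$$ -/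

import Mathlib

open MeasureTheory
open scoped ENNReal ContDiff FourierTransform

noncomputable section

namespace BOZK

/-- The plane `ℝ²` with its Euclidean structure; coordinates are `z 0 = x`, `z 1 = y` on the
space side and `z 0`, `z 1` on the frequency side. -/
abbrev Plane : Type := EuclideanSpace ℝ (Fin 2)

/-- The Hilbert space `L²(ℝ²; ℂ)` (with Lebesgue measure). -/
abbrev L2 : Type := Lp ℂ 2 (volume : Measure Plane)

/-- `m(ξ, μ)` is a bounded Borel symbol. -/
def IsBoundedSymbol (m : ℝ → ℝ → ℂ) : Prop :=
  Measurable (fun z : ℝ × ℝ => m z.1 z.2) ∧ ∃ C : ℝ, ∀ ξ μ : ℝ, ‖m ξ μ‖ ≤ C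

theorem memLp_symbol_mul {m : ℝ → ℝ → ℂ} (hm : IsBoundedSymbol m) (g : L2) :
    MemLp (fun z : Plane => m (2 * Real.pi * z 0) (2 * Real.pi * z 1) * g z) 2 volume := by
  obtain ⟨hmeas, C, hC⟩ := hm
  have hz : Measurable fun z : Plane => ((2 * Real.pi * z 0, 2 * Real.pi * z 1) : ℝ × ℝ) := by
    fun_prop
  refine (Lp.memLp g).of_le_mul (c := C)
    ((hmeas.comp hz).aestronglyMeasurable.mul (Lp.aestronglyMeasurable g)) ?_
  filter_upwards with z
  simp only [norm_mul]
  exact mul_le_mul_of_nonneg_right (hC _ _) (norm_nonneg _)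

/-- The Fourier multiplier on `L²(ℝ²)` with symbol `m(ξ, μ)`, where `(ξ, μ)` are the frequencies
for the convention `φ̂(ξ, μ) = ∫ e^{-i(xξ + yμ)} φ(x, y) dx dy`. Mathlib's `𝓕` uses the character
`e^{-2πi(xξ + yμ)}`, so that its variable `z` corresponds to `(ξ, μ) = 2π z`. -/
def fourierMultiplier (m : ℝ → ℝ → ℂ) (hm : IsBoundedSymbol m) (φ : L2) : L2 :=
  𝓕⁻ ((memLp_symbol_mul hm (𝓕 φ)).toLp)

/-- The dispersion relation `ω(ξ, μ) = ξ (|ξ|^α + μ²)`. -/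
def omega (α ξ μ : ℝ) : ℝ := ξ * (|ξ| ^ α + μ ^ 2)

theorem isBoundedSymbol_exp (α t : ℝ) :
    IsBoundedSymbol fun ξ μ => Complex.exp (Complex.I * (t * omega α ξ μ : ℝ)) := by
  refine ⟨by unfold omega; fun_prop, 1, fun ξ μ => ?_⟩
  simp only [mul_comm Complex.I, Complex.norm_exp_ofReal_mul_I, le_refl]

/-- The free group `U(t) = exp(t ∂ₓ (D_x^α - ∂_{yy}))`, i.e. the Fourier multiplier by
`exp(i t ω(ξ, μ))`. -/
def freeGroup (α t : ℝ) (φ : L2) : L2 :=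
  fourierMultiplier (fun ξ μ => Complex.exp (Complex.I * (t * omega α ξ μ : ℝ)))
    (isBoundedSymbol_exp α t) φ

/-- The base cutoff of the Littlewood-Paley decomposition. -/
structure IsLPCutoff (χ : ℝ → ℝ) : Prop where
  smooth : ContDiff ℝ ∞ χ
  nonneg : ∀ ξ, 0 ≤ χ ξ
  le_one : ∀ ξ, χ ξ ≤ 1
  eq_one : ∀ ξ, |ξ| ≤ 4 / 3 → χ ξ = 1
  eq_zero : ∀ ξ, 5 / 3 < |ξ| → χ ξ = 0

/-- The set `𝔻 = {2^ℓ : ℓ ∈ ℕ}` of dyadic numbers. -/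
def dyadic : Set ℝ := {N | ∃ l : ℕ, N = 2 ^ l}

/-- `φ₁ = χ`, and `φ_N(ξ) = φ(ξ / N)` for `N ≠ 1`, where `φ(ξ) = χ(ξ) - χ(2 ξ)`. -/
def lpBump (χ : ℝ → ℝ) (N ξ : ℝ) : ℝ :=
  if N = 1 then χ ξ else χ (ξ / N) - χ (2 * (ξ / N))

theorem isBoundedSymbol_lpBump {χ : ℝ → ℝ} (hχ : IsLPCutoff χ) (N : ℝ) :
    IsBoundedSymbol fun ξ _ => (lpBump χ N ξ : ℂ) := by
  have hc : Measurable χ := hχ.smooth.continuous.measurable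
  refine ⟨?_, 1, fun ξ _ => ?_⟩
  · unfold lpBump
    split_ifs <;> fun_prop
  · rw [Complex.norm_real, Real.norm_eq_abs, abs_le]
    unfold lpBump
    split_ifs
    · constructor <;> linarith [hχ.nonneg ξ, hχ.le_one ξ]
    · constructor <;> linarith [hχ.nonneg (ξ / N), hχ.le_one (ξ / N),
        hχ.nonneg (2 * (ξ / N)), hχ.le_one (2 * (ξ / N))]

/-- The projection `P_N^x` on `x`-frequencies of size `N`: the multiplier by `φ_N(ξ)`. -/
def projX {χ : ℝ → ℝ} (hχ : IsLPCutoff χ) (N : ℝ) (φ : L2) : L2 :=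
  fourierMultiplier (fun ξ _ => (lpBump χ N ξ : ℂ)) (isBoundedSymbol_lpBump hχ N) φ

theorem isBoundedSymbol_indicator {A : Set (ℝ × ℝ)} (hA : MeasurableSet A) :
    IsBoundedSymbol fun ξ μ => A.indicator (fun _ => (1 : ℂ)) (ξ, μ) := by
  refine ⟨measurable_const.indicator hA, 1, fun ξ μ => ?_⟩
  by_cases h : (ξ, μ) ∈ A <;> simp [h]

/-- The Fourier projection `P_A = 𝓕⁻¹ 1_A 𝓕` on a Borel set `A` of frequencies. -/
def projSet {A : Set (ℝ × ℝ)} (hA : MeasurableSet A) (φ : L2) : L2 :=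
  fourierMultiplier (fun ξ μ => A.indicator (fun _ => (1 : ℂ)) (ξ, μ))
    (isBoundedSymbol_indicator hA) φ

/-- The neighbourhood `A_δ = {(B - δ)|ξ|^α ≤ μ² ≤ (B + δ)|ξ|^α}`, `B = α(α+1)/2`, of the critical
curve `μ² = B |ξ|^α`. -/
def critRegion (α δ : ℝ) : Set (ℝ × ℝ) :=
  {z | (α * (α + 1) / 2 - δ) * |z.1| ^ α ≤ z.2 ^ 2 ∧
    z.2 ^ 2 ≤ (α * (α + 1) / 2 + δ) * |z.1| ^ α}

theorem measurableSet_critRegion (α δ : ℝ) : MeasurableSet (critRegion α δ) := by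
  unfold critRegion
  measurability

/-- The evolution `P_N^x P_{A_δᶜ} U(t) φ`, free and localized at `x`-frequency `N` away from the
critical region. -/
def localizedFlow {χ : ℝ → ℝ} (hχ : IsLPCutoff χ) (α δ N : ℝ) (φ : L2) (t : ℝ) : L2 :=
  projX hχ N (projSet (measurableSet_critRegion α δ).compl (freeGroup α t φ))

/-- The mixed norm `‖u‖_{L^q_t(I; L^p_{xy})}`, with values in `[0, ∞]`. -/
def mixedNorm (q p : ℝ≥0∞) (I : Set ℝ) (u : ℝ → L2) : ℝ≥0∞ :=
  eLpNorm (fun t => eLpNorm (u t) p volume) q (volume.restrict I)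

end BOZK

end

/-! By duality and the TT* method the estimate reduces to a dispersive bound for the kernel of
(P_N^x)² P_{A_δᶜ} U(τ). For ξ > 0 the Hessian determinant of ω is 4(B|ξ|^α − μ²), so A_δ is a
neighbourhood of the degenerate set. Off A_δ stationary phase suggests decay |τ|⁻¹ at |ξ| ~ 1. The
difficulty is that the cutoff to A_δᶜ is sharp, so the edges of the region must be handled as well.

The scaling (ξ, μ, τ) ↦ (Nξ, N^{α/2}μ, N^{−(α+1)}τ) preserves A_δ and the phase and reduces to N =
1, with Jacobian N^{1+α/2}. Truncate to |μ| ≤ R, with bounds uniform in R, and take ξ = u > 0, τ >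
0, y = −2τb with b ≥ 0. The phase is quadratic in μ with critical point b/u, so the μ-integral is
e^{−iτb²/u}(τu)^{−1/2} times a signed sum of Fresnel integrals at the six edges μ = κu^β
(`sectionInt_eq`). This gives one factor τ^{−1/2}. The u-integral gives the second, after each
Fresnel integral is split into its limits at ±∞ and a remainder: - The limits add up to a nonzero
constant only when b/u lies in the noncritical section. There the remaining phase has second
derivative 2τu⁻³(Bu^{α+2} − b²), of modulus at least τδ, and van der Corput applies
(`norm_integral_edgeSum_csign_le`). - For κ > 0 the remainder is e^{is²} times an amplitude of
bounded variation. The factor e^{is²} turns the phase into the original phase along the edge, which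
is uniformly convex (`norm_integral_exp_edgePhase_le`). - For κ < 0 the edge is far from b/u, and
the remainder is pointwise O(τ^{−1/2}) (`norm_integral_edge_le_of_neg`).

Without a lower bound on |ξ|, the μ-integral alone gives decay |τ|^{−1/2}.

Three-lines interpolation with the L² bound turns a kernel bound D(τ) into D(τ)^θ between L^{p'} and
L^p. The time integral is then controlled by a Young–Hölder inequality, which asks D^{θq/2} = D^b to
be integrable with b = 1/(1 − ε). Since 1 < b < 2, min(|τ|⁻¹, |τ|^{−1/2})^b is integrable on the
line: this is what the loss ε buys, and scaling produces the power of N. For the low-frequency block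
only |τ|^{−b/2} is at hand; it is integrable near 0, which accounts for the restriction to bounded
times. -/

namespace BOZK
-- Van der Corput estimates in one variable.
open Set intervalIntegral

/-- First derivative test for oscillatory integrals with a phase of monotone derivative. -/
theorem norm_integral_exp_le_of_deriv {Φ Φ₁ Φ₂ : ℝ → ℝ} {a b η : ℝ} (hab : a ≤ b) (hη : 0 < η)
    (h1 : ∀ x ∈ Icc a b, HasDerivAt Φ (Φ₁ x) x) (h2 : ∀ x ∈ Icc a b, HasDerivAt Φ₁ (Φ₂ x) x)
    (hc : ContinuousOn Φ₂ (Icc a b)) (hpos : ∀ x ∈ Icc a b, 0 ≤ Φ₂ x)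
    (hlow : ∀ x ∈ Icc a b, η ≤ |Φ₁ x|) :
    ‖∫ x in a..b, Complex.exp (Complex.I * Φ x)‖ ≤ 4 / η := by
  have hne : ∀ x ∈ Icc a b, Φ₁ x ≠ 0 := fun x hx h => by
    have := hlow x hx; rw [h, abs_zero] at this; linarith
  have cΦ : ContinuousOn Φ (Icc a b) := fun x hx => (h1 x hx).continuousAt.continuousWithinAt
  have cΦ₁ : ContinuousOn Φ₁ (Icc a b) := fun x hx => (h2 x hx).continuousAt.continuousWithinAt
  have cE : ContinuousOn (fun x => Complex.exp (Complex.I * Φ x)) (Icc a b) := by fun_prop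
  -- Integration by parts: G = −i e^{iΦ}/Φ₁ is the boundary term and r the error, with G′ = e^{iΦ} +
  -- r.
  set G : ℝ → ℂ := fun x => -Complex.I * (Complex.exp (Complex.I * Φ x) * ((Φ₁ x)⁻¹ : ℝ))
  set r : ℝ → ℂ := fun x =>
    Complex.I * (Complex.exp (Complex.I * Φ x) * ((Φ₂ x / Φ₁ x ^ 2 : ℝ) : ℂ))
  have hG : ∀ x ∈ Icc a b, HasDerivAt G (Complex.exp (Complex.I * Φ x) + r x) x := by
    intro x hx
    have e1 : HasDerivAt (fun x => Complex.exp (Complex.I * Φ x))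
        (Complex.exp (Complex.I * Φ x) * (Complex.I * Φ₁ x)) x :=
      (((h1 x hx).ofReal_comp).const_mul Complex.I).cexp
    have e2 : HasDerivAt (fun x => (((Φ₁ x)⁻¹ : ℝ) : ℂ)) ((-Φ₂ x / Φ₁ x ^ 2 : ℝ) : ℂ) x :=
      ((h2 x hx).inv (hne x hx)).ofReal_comp
    have := (e1.mul e2).const_mul (-Complex.I)
    refine this.congr_deriv ?_
    have hn : (Φ₁ x : ℂ) ≠ 0 := by exact_mod_cast hne x hx
    simp only [r]
    push_cast
    have hI : Complex.I * Complex.I = -1 := Complex.I_mul_I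
    field_simp
    linear_combination (-Φ₁ x ^ 2 : ℂ) * Complex.I_sq
  have cq : ContinuousOn (fun x => Φ₂ x / Φ₁ x ^ 2) (Icc a b) :=
    hc.div (cΦ₁.pow 2) fun x hx => pow_ne_zero 2 (hne x hx)
  have cr : ContinuousOn r (Icc a b) := by
    have : ContinuousOn (fun x => ((Φ₂ x / Φ₁ x ^ 2 : ℝ) : ℂ)) (Icc a b) :=
      Complex.continuous_ofReal.comp_continuousOn cq
    exact continuousOn_const.mul (cE.mul this)
  have iE : IntervalIntegrable (fun x => Complex.exp (Complex.I * Φ x)) volume a b :=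
    cE.intervalIntegrable_of_Icc hab
  have ir : IntervalIntegrable r volume a b := cr.intervalIntegrable_of_Icc hab
  have iq := cq.intervalIntegrable_of_Icc (μ := volume) hab
  have hFTC := integral_eq_sub_of_hasDerivAt (fun x hx => hG x (uIcc_of_le hab ▸ hx)) (iE.add ir)
  rw [integral_add iE ir] at hFTC
  -- As Φ₂ ≥ 0, |r| = Φ₂/Φ₁² is the derivative of −1/Φ₁, so ∫|r| is again a boundary term.
  have hFTC2 := integral_eq_sub_of_hasDerivAt (f := fun x => -(Φ₁ x)⁻¹)
    (f' := fun x => Φ₂ x / Φ₁ x ^ 2) (fun x hx => by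
      have := ((h2 x (uIcc_of_le hab ▸ hx)).inv (hne x (uIcc_of_le hab ▸ hx))).neg
      exact this.congr_deriv (by ring)) iq
  have hinv : ∀ x ∈ Icc a b, |(Φ₁ x)⁻¹| ≤ 1 / η := fun x hx => by
    rw [abs_inv, one_div]; exact inv_anti₀ hη (hlow x hx)
  have hGn : ∀ x ∈ Icc a b, ‖G x‖ ≤ 1 / η := fun x hx => by
    have : ‖Complex.exp (Complex.I * Φ x)‖ = 1 := by
      rw [mul_comm]; exact Complex.norm_exp_ofReal_mul_I _
    simp only [G, norm_mul, norm_neg, Complex.norm_I, this, one_mul, Complex.norm_real,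
      Real.norm_eq_abs]
    exact hinv x hx
  have ha : a ∈ Icc a b := ⟨le_rfl, hab⟩
  have hb : b ∈ Icc a b := ⟨hab, le_rfl⟩
  have hr : ‖∫ x in a..b, r x‖ ≤ 2 / η := by
    calc ‖∫ x in a..b, r x‖ ≤ ∫ x in a..b, Φ₂ x / Φ₁ x ^ 2 := by
          refine norm_integral_le_of_norm_le hab (Filter.Eventually.of_forall fun x hx => ?_) iq
          have hx' : x ∈ Icc a b := Ioc_subset_Icc_self hx
          have : ‖Complex.exp (Complex.I * Φ x)‖ = 1 := by
            rw [mul_comm]; exact Complex.norm_exp_ofReal_mul_I _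
          simp only [r, norm_mul, Complex.norm_I, this, one_mul, Complex.norm_real]
          rw [Real.norm_of_nonneg (div_nonneg (hpos x hx') (sq_nonneg _))]
      _ ≤ 2 / η := by
          rw [hFTC2]
          have A := abs_le.1 (hinv a ha)
          have B := abs_le.1 (hinv b hb)
          have : 2 / η = 1 / η + 1 / η := by ring
          linarith [A.1, A.2, B.1, B.2]
  have key : ∫ x in a..b, Complex.exp (Complex.I * Φ x) = G b - G a - ∫ x in a..b, r x := by
    rw [← hFTC]; ring
  rw [key]
  calc _ ≤ ‖G b‖ + ‖G a‖ + ‖∫ x in a..b, r x‖ :=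
        (norm_sub_le _ _).trans (add_le_add_left (norm_sub_le _ _) _)
    _ ≤ 1 / η + 1 / η + 2 / η := by gcongr <;> [exact hGn b hb; exact hGn a ha]
    _ = 4 / η := by ring

/-- Van der Corput's second derivative test. -/
theorem norm_integral_exp_le_of_deriv2 {Φ Φ₁ Φ₂ : ℝ → ℝ} {a b l : ℝ} (hab : a ≤ b) (hl : 0 < l)
    (h1 : ∀ x ∈ Icc a b, HasDerivAt Φ (Φ₁ x) x) (h2 : ∀ x ∈ Icc a b, HasDerivAt Φ₁ (Φ₂ x) x)
    (hc : ContinuousOn Φ₂ (Icc a b)) (hpos : ∀ x ∈ Icc a b, l ≤ Φ₂ x) :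
    ‖∫ x in a..b, Complex.exp (Complex.I * Φ x)‖ ≤ 18 / √l := by
  have cΦ : ContinuousOn Φ (Icc a b) := fun x hx => (h1 x hx).continuousAt.continuousWithinAt
  have cΦ₁ : ContinuousOn Φ₁ (Icc a b) := fun x hx => (h2 x hx).continuousAt.continuousWithinAt
  have cE : ContinuousOn (fun x => Complex.exp (Complex.I * Φ x)) (Icc a b) := by fun_prop
  -- The minimizer z of |Φ₁| plays the role of the critical point, whether or not Φ₁ vanishes there:
  -- |Φ₁ x − Φ₁ z| ≤ 2|Φ₁ x| for every x.
  obtain ⟨z, hz, hzmin⟩ := isCompact_Icc.exists_isMinOn (nonempty_Icc.2 hab) cΦ₁.abs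
  have hmono : ∀ x ∈ Icc a b, ∀ y ∈ Icc a b, x ≤ y → l * (y - x) ≤ Φ₁ y - Φ₁ x := by
    refine (convex_Icc a b).mul_sub_le_image_sub_of_le_deriv cΦ₁ ?_ ?_
    · intro x hx; exact (h2 x (interior_subset hx)).differentiableAt.differentiableWithinAt
    · intro x hx; rw [(h2 x (interior_subset hx)).deriv]; exact hpos x (interior_subset hx)
  have hlow : ∀ x ∈ Icc a b, l * |x - z| ≤ 2 * |Φ₁ x| := by
    intro x hx
    have hm : |Φ₁ z| ≤ |Φ₁ x| := hzmin hx
    have h3 : |Φ₁ x - Φ₁ z| ≤ |Φ₁ x| + |Φ₁ z| := abs_sub _ _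
    rcases le_total x z with h | h
    · have := hmono x hx z hz h
      rw [abs_sub_comm, abs_of_nonneg (by linarith : 0 ≤ z - x)]
      have := neg_abs_le (Φ₁ x - Φ₁ z); linarith
    · have := hmono z hz x hx h
      rw [abs_of_nonneg (by linarith : 0 ≤ x - z)]
      have := le_abs_self (Φ₁ x - Φ₁ z); linarith
  have hs : 0 < √l := Real.sqrt_pos.2 hl
  have hss : √l * √l = l := Real.mul_self_sqrt hl.le
  -- The window of radius 1/√l about z costs at most its length 2/√l. Outside it |Φ₁| ≥ √l/2, so
  -- each side costs 8/√l; the total is 18/√l.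
  set d := 1 / √l with hd
  have hd0 : 0 < d := by positivity
  set c₁ := max a (z - d) with hc₁
  set c₂ := min b (z + d) with hc₂
  have ac₁ : a ≤ c₁ := le_max_left _ _
  have c₁z : c₁ ≤ z := max_le hz.1 (by linarith)
  have zc₂ : z ≤ c₂ := le_min hz.2 (by linarith)
  have c₂b : c₂ ≤ b := min_le_left _ _
  have int : ∀ u v, a ≤ u → u ≤ v → v ≤ b →
      IntervalIntegrable (fun x => Complex.exp (Complex.I * Φ x)) volume u v := fun u v hu huv hv =>
    (cE.mono (Icc_subset_Icc hu hv)).intervalIntegrable_of_Icc huv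
  have hld : l * d = √l := by rw [hd, mul_one_div, div_eq_iff hs.ne', hss]
  have part : ∀ u v, a ≤ u → u ≤ v → v ≤ b → (u < v → ∀ x ∈ Icc u v, d ≤ |x - z|) →
      ‖∫ x in u..v, Complex.exp (Complex.I * Φ x)‖ ≤ 8 / √l := by
    intro u v hu huv hv hfar
    rcases huv.eq_or_lt with rfl | hlt
    · simp only [integral_same, norm_zero]; positivity
    have sub : Icc u v ⊆ Icc a b := Icc_subset_Icc hu hv
    have := norm_integral_exp_le_of_deriv huv (half_pos hs) (fun x hx => h1 x (sub hx))
      (fun x hx => h2 x (sub hx)) (hc.mono sub) (fun x hx => hl.le.trans (hpos x (sub hx)))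
      (fun x hx => by
        have h5 := hlow x (sub hx)
        have h6 := mul_le_mul_of_nonneg_left (hfar hlt x hx) hl.le
        linarith)
    exact this.trans (le_of_eq (by field_simp; norm_num))
  have p1 := part a c₁ le_rfl ac₁ (c₁z.trans hz.2) (fun hlt x hx => by
    have : c₁ = z - d := by
      rcases max_choice a (z - d) with h | h
      · rw [hc₁, h] at hlt; exact absurd hlt (lt_irrefl _)
      · exact h
    rw [abs_sub_comm]; refine le_trans ?_ (le_abs_self _); linarith [hx.2])
  have p3 := part c₂ b (hz.1.trans zc₂) c₂b le_rfl (fun hlt x hx => by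
    have : c₂ = z + d := by
      rcases min_choice b (z + d) with h | h
      · rw [hc₂, h] at hlt; exact absurd hlt (lt_irrefl _)
      · exact h
    refine le_trans ?_ (le_abs_self _); linarith [hx.1])
  have p2 : ‖∫ x in c₁..c₂, Complex.exp (Complex.I * Φ x)‖ ≤ 2 / √l := by
    refine (intervalIntegral.norm_integral_le_of_norm_le_const (C := 1) fun x _ => ?_).trans ?_
    · rw [mul_comm]; exact (Complex.norm_exp_ofReal_mul_I _).le
    · rw [one_mul, abs_of_nonneg (by linarith)]
      have : 2 / √l = d + d := by rw [hd]; ring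
      have := le_max_right a (z - d); have := min_le_right b (z + d)
      linarith
  rw [← integral_add_adjacent_intervals (int a c₁ le_rfl ac₁ (c₁z.trans hz.2))
      (int c₁ b ac₁ (c₁z.trans hz.2) le_rfl),
    ← integral_add_adjacent_intervals (int c₁ c₂ ac₁ (c₁z.trans zc₂) c₂b)
      (int c₂ b (hz.1.trans zc₂) c₂b le_rfl)]
  calc _ ≤ _ := norm_add_le _ _
    _ ≤ _ := add_le_add_right (norm_add_le _ _) _
    _ ≤ 8 / √l + (2 / √l + 8 / √l) := by gcongr
    _ = 18 / √l := by ring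

theorem norm_integral_exp_le_of_deriv2_neg {Φ Φ₁ Φ₂ : ℝ → ℝ} {a b l : ℝ} (hab : a ≤ b) (hl : 0 < l)
    (h1 : ∀ x ∈ Icc a b, HasDerivAt Φ (Φ₁ x) x) (h2 : ∀ x ∈ Icc a b, HasDerivAt Φ₁ (Φ₂ x) x)
    (hc : ContinuousOn Φ₂ (Icc a b)) (hneg : ∀ x ∈ Icc a b, Φ₂ x ≤ -l) :
    ‖∫ x in a..b, Complex.exp (Complex.I * Φ x)‖ ≤ 18 / √l := by
  have := norm_integral_exp_le_of_deriv2 (Φ := fun x => -Φ x) hab hl (fun x hx => (h1 x hx).neg)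
    (fun x hx => (h2 x hx).neg) hc.neg (fun x hx => by linarith [hneg x hx])
  rw [← Complex.norm_conj, ← intervalIntegral_conj] at this
  have e : ∀ x, (starRingEnd ℂ) (Complex.exp (Complex.I * (-Φ x : ℝ))) =
      Complex.exp (Complex.I * Φ x) := fun x => by
    rw [← Complex.exp_conj]
    simp
  simpa only [e] using this

/-- An oscillatory integral with an amplitude is controlled by the total variation. -/
theorem norm_integral_mul_le_of_primitive {f g g' : ℝ → ℂ} {a b M : ℝ} (hab : a ≤ b)
    (hf : ContinuousOn f (Icc a b)) (hM : ∀ c ∈ Icc a b, ‖∫ x in a..c, f x‖ ≤ M)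
    (hg : ∀ x ∈ Icc a b, HasDerivAt g (g' x) x) (hg' : ContinuousOn g' (Icc a b)) :
    ‖∫ x in a..b, g x * f x‖ ≤ M * (‖g b‖ + ∫ x in a..b, ‖g' x‖) := by
  set P : ℝ → ℂ := fun c => ∫ x in a..c, f x
  have hM0 : 0 ≤ M := (norm_nonneg _).trans (hM a ⟨le_rfl, hab⟩)
  have cP : ContinuousOn P (Icc a b) := by
    have := continuousOn_primitive_interval (f := f) (μ := volume) (a := a) (b := b)
      ((uIcc_of_le hab).symm ▸ hf.integrableOn_Icc)
    rwa [uIcc_of_le hab] at this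
  have hP : ∀ x ∈ Ioo (min a b) (max a b), HasDerivAt P (f x) x := by
    intro x hx
    rw [min_eq_left hab, max_eq_right hab] at hx
    have hmem : Icc a b ∈ nhds x := Icc_mem_nhds hx.1 hx.2
    refine integral_hasDerivAt_right
      ((hf.mono (Icc_subset_Icc_right hx.2.le)).intervalIntegrable_of_Icc hx.1.le) ?_
      (hf.continuousAt hmem)
    exact ⟨Icc a b, hmem, hf.aestronglyMeasurable measurableSet_Icc⟩
  have hg0 : ContinuousOn g (Icc a b) := fun x hx => (hg x hx).continuousAt.continuousWithinAt
  have := integral_mul_deriv_eq_deriv_mul_of_hasDerivAt (u := g) (v := P) (u' := g') (v' := f)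
    (a := a) (b := b) (by rwa [uIcc_of_le hab]) (by rwa [uIcc_of_le hab])
    (fun x hx => hg x (by
      rw [min_eq_left hab, max_eq_right hab] at hx; exact Ioo_subset_Icc_self hx)) hP
    (hg'.intervalIntegrable_of_Icc hab) (hf.intervalIntegrable_of_Icc hab)
  rw [this]
  have hPa : P a = 0 := by simp [P]
  rw [hPa, mul_zero, sub_zero, mul_add]
  refine (norm_sub_le _ _).trans (add_le_add ?_ ?_)
  · rw [norm_mul, mul_comm]
    exact mul_le_mul_of_nonneg_right (hM b ⟨hab, le_rfl⟩) (norm_nonneg _)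
  · rw [← intervalIntegral.integral_const_mul]
    refine norm_integral_le_of_norm_le hab (Filter.Eventually.of_forall fun x hx => ?_)
      ((hg'.norm.intervalIntegrable_of_Icc hab).const_mul _)
    rw [norm_mul, mul_comm]
    exact mul_le_mul_of_nonneg_right (hM x (Ioc_subset_Icc_self hx)) (norm_nonneg _)

end BOZK

/-! ### The Fresnel integral: limits at infinity and a slowly varying tail amplitude. -/

namespace BOZK
open Set intervalIntegral

/-- The rotation factor `√2 (1 - i)` with square `-4 i`. -/
noncomputable def rotFactor : ℂ := √2 * (1 - Complex.I)

theorem rotFactor_re : rotFactor.re = √2 := by simp [rotFactor]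

theorem sqrt_two_sq_complex : (√2 : ℂ) ^ 2 = 2 := by
  exact_mod_cast Real.sq_sqrt (by norm_num : (0 : ℝ) ≤ 2)

theorem rotFactor_sq : rotFactor ^ 2 = -4 * Complex.I := by
  rw [rotFactor, mul_pow, sqrt_two_sq_complex]
  linear_combination (2 : ℂ) * Complex.I_sq

theorem norm_rotFactor : ‖rotFactor‖ = 2 := by
  have h : ‖rotFactor‖ ^ 2 = 2 ^ 2 := by
    rw [← norm_pow, rotFactor_sq]; norm_num
  exact (pow_left_inj₀ (norm_nonneg _) (by norm_num) two_ne_zero).1 h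

theorem rotFactor_ne_zero : rotFactor ≠ 0 := by
  rw [← norm_ne_zero_iff, norm_rotFactor]; norm_num

/-- The integrand of the rotated Fresnel tail. -/
noncomputable def tailKernel (s r : ℝ) : ℂ := Complex.exp (-r ^ 2 - rotFactor * s * r)

theorem norm_tailKernel (s r : ℝ) : ‖tailKernel s r‖ = Real.exp (-r ^ 2 - √2 * s * r) := by
  rw [tailKernel, Complex.norm_exp]
  congr 1
  have : (rotFactor * s * r).re = √2 * s * r := by
    rw [mul_assoc, ← Complex.ofReal_mul, Complex.re_mul_ofReal, rotFactor_re]; ring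
  rw [Complex.sub_re, this, Complex.neg_re, ← Complex.ofReal_pow, Complex.ofReal_re]

theorem continuous_tailKernel (s : ℝ) : Continuous (tailKernel s) := by
  unfold tailKernel; fun_prop

theorem norm_tailKernel_le {s r : ℝ} (hs : 0 ≤ s) (hr : 0 ≤ r) :
    ‖tailKernel s r‖ ≤ Real.exp (-1 * r ^ 2) := by
  rw [norm_tailKernel, Real.exp_le_exp]
  have := mul_nonneg (mul_nonneg (Real.sqrt_nonneg 2) hs) hr
  linarith

theorem integrable_tailKernel {s : ℝ} (hs : 0 ≤ s) :
    Integrable (tailKernel s) (volume.restrict (Ioi 0)) := by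
  refine Integrable.mono' (integrable_exp_neg_mul_sq one_pos).integrableOn
    (continuous_tailKernel s).aestronglyMeasurable ?_
  filter_upwards [ae_restrict_mem measurableSet_Ioi] with r hr
  exact norm_tailKernel_le hs (le_of_lt hr)

theorem integrable_mul_tailKernel {s : ℝ} (hs : 0 ≤ s) :
    Integrable (fun r : ℝ => (r : ℂ) * tailKernel s r) (volume.restrict (Ioi 0)) := by
  refine Integrable.mono' (integrable_mul_exp_neg_mul_sq one_pos).integrableOn
    (by have := continuous_tailKernel s; fun_prop) ?_
  filter_upwards [ae_restrict_mem measurableSet_Ioi] with r hr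
  rw [norm_mul, Complex.norm_real, Real.norm_of_nonneg (le_of_lt hr)]
  exact mul_le_mul_of_nonneg_left (norm_tailKernel_le hs (le_of_lt hr)) (le_of_lt hr)

/-- The rotated Fresnel tail `∫₀^∞ exp(-r² - √2 (1 - i) s r) dr`. -/
noncomputable def fresnelTail (s : ℝ) : ℂ := ∫ r in Ioi (0 : ℝ), tailKernel s r

theorem hasDerivAt_fresnelTail {s : ℝ} (hs : 0 ≤ s) :
    HasDerivAt fresnelTail (∫ r in Ioi (0 : ℝ), -(rotFactor * r) * tailKernel s r) s := by
  refine (hasDerivAt_integral_of_dominated_loc_of_deriv_le (μ := volume.restrict (Ioi 0))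
    (F := tailKernel) (bound := fun r => 2 * Real.exp 1 * (r * Real.exp (-(1 / 2) * r ^ 2)))
    (F' := fun s r => -(rotFactor * r) * tailKernel s r) (s := Metric.ball s 1)
    (Metric.ball_mem_nhds s one_pos) ?_ (integrable_tailKernel hs) ?_ ?_ ?_ ?_).2
  · exact Filter.Eventually.of_forall fun x => (continuous_tailKernel x).aestronglyMeasurable
  · have := continuous_tailKernel s
    exact Continuous.aestronglyMeasurable (by fun_prop)
  · filter_upwards [ae_restrict_mem measurableSet_Ioi] with r hr x hx
    have hr : 0 < r := hr
    have hx : -1 ≤ x := by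
      rw [Metric.mem_ball, Real.dist_eq, abs_lt] at hx; linarith [hx.1]
    rw [norm_mul, norm_neg, norm_mul, norm_rotFactor, Complex.norm_real,
      Real.norm_of_nonneg hr.le, norm_tailKernel]
    -- In the unit ball about s the parameter x may drop to −1; then −r² + √2 r ≤ 1 − r²/2, because
    -- (r − √2)² ≥ 0.
    have : Real.exp (-r ^ 2 - √2 * x * r) ≤ Real.exp 1 * Real.exp (-(1 / 2) * r ^ 2) := by
      rw [← Real.exp_add, Real.exp_le_exp]
      have h2 : √2 ^ 2 = 2 := Real.sq_sqrt (by norm_num)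
      have h3 : 0 ≤ √2 * r * (x + 1) := by
        have := Real.sqrt_nonneg 2
        have : 0 ≤ x + 1 := by linarith
        positivity
      nlinarith [sq_nonneg (r - √2)]
    calc _ ≤ 2 * r * (Real.exp 1 * Real.exp (-(1 / 2) * r ^ 2)) := by gcongr
      _ = _ := by ring
  · exact ((integrable_mul_exp_neg_mul_sq (by norm_num : (0 : ℝ) < 1 / 2)).integrableOn).const_mul _
  · refine Filter.Eventually.of_forall fun r x _ => ?_
    have h : HasDerivAt (fun x : ℝ => (-r ^ 2 - rotFactor * x * r : ℂ)) (-(rotFactor * r)) x := by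
      have := (((hasDerivAt_id x).ofReal_comp.const_mul rotFactor).mul_const (r : ℂ)).const_sub
        (-(r : ℂ) ^ 2)
      simpa using this
    have := h.cexp
    rw [mul_comm] at this
    exact this

/-- The r-derivative of the kernel integrates to −1 over the half-line. This identity is what makes
a = `fresnelAmp` solve a′ = −1 − 2isa. -/
theorem integral_tailKernel_by_parts {s : ℝ} (hs : 0 ≤ s) :
    2 * (∫ r in Ioi (0 : ℝ), (r : ℂ) * tailKernel s r) + rotFactor * s * fresnelTail s = 1 := by
  have h1 := integrable_tailKernel hs
  have h2 := integrable_mul_tailKernel hs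
  have hd : ∀ r ∈ Ioi (0 : ℝ), HasDerivAt (tailKernel s)
      (-(2 * ((r : ℂ) * tailKernel s r) + rotFactor * s * tailKernel s r)) r := by
    intro r _
    have h : HasDerivAt (fun r : ℝ => (-r ^ 2 - rotFactor * s * r : ℂ))
        (-(2 * r) - rotFactor * s) r := by
      have a := ((hasDerivAt_id r).ofReal_comp.pow 2).neg
      have b := (hasDerivAt_id r).ofReal_comp.const_mul (rotFactor * s)
      exact (a.sub b).congr_deriv (by simp)
    refine h.cexp.congr_deriv ?_
    rw [tailKernel]; ring
  have hlim : Filter.Tendsto (tailKernel s) Filter.atTop (nhds 0) := by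
    rw [tendsto_zero_iff_norm_tendsto_zero]
    refine squeeze_zero' (Filter.Eventually.of_forall fun _ => norm_nonneg _)
      ((Filter.eventually_ge_atTop 1).mono fun r hr => ?_)
      (Real.tendsto_exp_neg_atTop_nhds_zero)
    refine (norm_tailKernel_le hs (by linarith)).trans ?_
    rw [Real.exp_le_exp]; nlinarith
  have := integral_Ioi_of_hasDerivAt_of_tendsto (a := 0)
    (continuous_tailKernel s).continuousWithinAt hd
    (((h2.const_mul 2).add (h1.const_mul (rotFactor * s))).neg) hlim
  rw [MeasureTheory.integral_neg, MeasureTheory.integral_add (h2.const_mul 2)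
    (h1.const_mul _), MeasureTheory.integral_const_mul, MeasureTheory.integral_const_mul] at this
  have h0 : tailKernel s 0 = 1 := by simp [tailKernel]
  rw [h0] at this
  rw [fresnelTail]
  linear_combination -this

/-- Dropping the exponential e^{−√2 s r} leaves ∫ r e^{−r²} = 1/2; dropping the Gaussian leaves ∫ r
e^{−√2 s r} = 1/(2s²). The resulting decay makes the derivative of `fresnelAmp` integrable, hence
its variation finite. -/
theorem norm_integral_mul_tailKernel_le {s : ℝ} (hs : 0 ≤ s) :
    (1 + s ^ 2) * ‖∫ r in Ioi (0 : ℝ), (r : ℂ) * tailKernel s r‖ ≤ 1 := by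
  have hI : ∫ r in Ioi (0 : ℝ), r * Real.exp (-1 * r ^ 2) = 1 / 2 := by
    have := integral_rpow_mul_exp_neg_mul_rpow (p := 2) (q := 1) (b := 1) two_pos (by norm_num)
      one_pos
    norm_num at this
    rw [← this]
    simp
  have hi_int := (integrable_mul_exp_neg_mul_sq (one_pos (α := ℝ))).integrableOn (s := Ioi 0)
  have A : ‖∫ r in Ioi (0 : ℝ), (r : ℂ) * tailKernel s r‖ ≤ 1 / 2 := by
    rw [← hI]
    refine norm_integral_le_of_norm_le hi_int ?_
    filter_upwards [ae_restrict_mem measurableSet_Ioi] with r hr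
    rw [norm_mul, Complex.norm_real, Real.norm_of_nonneg (le_of_lt hr)]
    exact mul_le_mul_of_nonneg_left (norm_tailKernel_le hs (le_of_lt hr)) (le_of_lt hr)
  have B : s ^ 2 * ‖∫ r in Ioi (0 : ℝ), (r : ℂ) * tailKernel s r‖ ≤ 1 / 2 := by
    rcases hs.eq_or_lt with rfl | hs'
    · norm_num
    have hb : 0 < √2 * s := by positivity
    have hJ : ∫ r in Ioi (0 : ℝ), r * Real.exp (-(√2 * s * r)) = 1 / (2 * s ^ 2) := by
      have := Real.integral_rpow_mul_exp_neg_mul_Ioi (a := 2) (r := √2 * s) two_pos hb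
      norm_num at this
      rw [this, mul_pow, inv_pow, inv_pow, Real.sq_sqrt (by norm_num)]
      ring
    -- A non-integrable function has integral 0 by convention, whereas the value just computed is
    -- positive.
    have hJi : IntegrableOn (fun r : ℝ => r * Real.exp (-(√2 * s * r))) (Ioi 0) := by
      by_contra h
      have := integral_undef h
      rw [hJ] at this
      have : 0 < 1 / (2 * s ^ 2) := by positivity
      linarith
    have : ‖∫ r in Ioi (0 : ℝ), (r : ℂ) * tailKernel s r‖ ≤ 1 / (2 * s ^ 2) := by
      rw [← hJ]
      refine norm_integral_le_of_norm_le hJi ?_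
      filter_upwards [ae_restrict_mem measurableSet_Ioi] with r hr
      have hr : 0 < r := hr
      rw [norm_mul, Complex.norm_real, Real.norm_of_nonneg hr.le, norm_tailKernel]
      refine mul_le_mul_of_nonneg_left (Real.exp_le_exp.2 ?_) hr.le
      nlinarith [sq_nonneg r]
    calc _ ≤ s ^ 2 * (1 / (2 * s ^ 2)) := by gcongr
      _ = 1 / 2 := by field_simp
  linarith

/-- The Fresnel integral `∫₀^s exp(i u²) du`. -/
noncomputable def fresnel (s : ℝ) : ℂ := ∫ u in (0 : ℝ)..s, Complex.exp (Complex.I * (u ^ 2 : ℝ))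

/-- The slowly varying amplitude of the tail of the Fresnel integral. -/
noncomputable def fresnelAmp (s : ℝ) : ℂ := 2 / rotFactor * fresnelTail s

/-- The derivative of `fresnelAmp`. -/
noncomputable def fresnelAmpDeriv (s : ℝ) : ℂ := -1 - 2 * Complex.I * s * fresnelAmp s

theorem fresnelAmpDeriv_eq {s : ℝ} (hs : 0 ≤ s) :
    fresnelAmpDeriv s = -2 * ∫ r in Ioi (0 : ℝ), (r : ℂ) * tailKernel s r := by
  have h := integral_tailKernel_by_parts hs
  rw [fresnelAmpDeriv, fresnelAmp]
  have hc := rotFactor_ne_zero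
  have h2 : 2 * Complex.I * s * (2 / rotFactor * fresnelTail s) =
      -(rotFactor * s * fresnelTail s) := by
    field_simp
    linear_combination ((s : ℂ) * fresnelTail s) * rotFactor_sq
  rw [h2]
  linear_combination h

theorem hasDerivAt_fresnelAmp {s : ℝ} (hs : 0 ≤ s) :
    HasDerivAt fresnelAmp (fresnelAmpDeriv s) s := by
  refine ((hasDerivAt_fresnelTail hs).const_mul (2 / rotFactor)).congr_deriv ?_
  rw [fresnelAmpDeriv_eq hs, ← MeasureTheory.integral_const_mul,
    ← MeasureTheory.integral_const_mul]
  congr 1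
  ext r
  have hc := rotFactor_ne_zero
  field_simp

theorem continuousOn_fresnelAmp : ContinuousOn fresnelAmp (Ici 0) := fun _ hs =>
  (hasDerivAt_fresnelAmp hs).continuousAt.continuousWithinAt

theorem continuousOn_fresnelAmpDeriv : ContinuousOn fresnelAmpDeriv (Ici 0) := by
  have := continuousOn_fresnelAmp
  unfold fresnelAmpDeriv
  fun_prop

theorem norm_fresnelAmpDeriv_le {s : ℝ} (hs : 0 ≤ s) :
    ‖fresnelAmpDeriv s‖ ≤ 2 / (1 + s ^ 2) := by
  rw [fresnelAmpDeriv_eq hs, le_div_iff₀ (by positivity), norm_mul, norm_neg, Complex.norm_ofNat]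
  linarith [norm_integral_mul_tailKernel_le hs]

theorem norm_two_div_rotFactor : ‖2 / rotFactor‖ = 1 := by
  rw [norm_div, norm_rotFactor]; norm_num

theorem norm_fresnelAmp_le_one {s : ℝ} (hs : 0 ≤ s) : ‖fresnelAmp s‖ ≤ 1 := by
  rw [fresnelAmp, norm_mul, norm_two_div_rotFactor, one_mul]
  have h := integral_gaussian_Ioi 1
  calc ‖fresnelTail s‖ ≤ ∫ r in Ioi (0 : ℝ), Real.exp (-1 * r ^ 2) := by
        refine norm_integral_le_of_norm_le (integrable_exp_neg_mul_sq one_pos).integrableOn ?_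
        filter_upwards [ae_restrict_mem measurableSet_Ioi] with r hr
        exact norm_tailKernel_le hs (le_of_lt hr)
    _ = √(Real.pi / 1) / 2 := h
    _ ≤ 1 := by
        have : √(Real.pi / 1) ≤ 2 := by
          rw [Real.sqrt_le_left (by norm_num)]
          linarith [Real.pi_lt_four]
        linarith

theorem mul_norm_fresnelAmp_le {s : ℝ} (hs : 0 ≤ s) : s * ‖fresnelAmp s‖ ≤ 2 := by
  have h : (2 * Complex.I * s * fresnelAmp s) = -1 - fresnelAmpDeriv s := by
    rw [fresnelAmpDeriv]; ring
  have h2 : 2 * (s * ‖fresnelAmp s‖) = ‖2 * Complex.I * s * fresnelAmp s‖ := by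
    simp [abs_of_nonneg hs]; ring
  have h3 : ‖fresnelAmpDeriv s‖ ≤ 2 := (norm_fresnelAmpDeriv_le hs).trans
    (div_le_self (by norm_num) (by nlinarith))
  have h4 : ‖-1 - fresnelAmpDeriv s‖ ≤ 1 + ‖fresnelAmpDeriv s‖ :=
    (norm_sub_le _ _).trans (by simp)
  rw [h] at h2
  linarith

/-- Formally `fresnelAmp s` is e^{−is²} ∫_s^∞ e^{iu²} du along the ray u = s + e^{iπ/4} r, as
2/`rotFactor` = e^{iπ/4}. No contour is shifted: by its differential equation, −e^{is²}·`fresnelAmp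
s` is a primitive of e^{is²}. -/
theorem fresnel_eq {s : ℝ} (hs : 0 ≤ s) :
    fresnel s = fresnelAmp 0 - Complex.exp (Complex.I * (s ^ 2 : ℝ)) * fresnelAmp s := by
  have hd : ∀ u ∈ uIcc 0 s, HasDerivAt
      (fun u : ℝ => -(Complex.exp (Complex.I * (u ^ 2 : ℝ)) * fresnelAmp u))
      (Complex.exp (Complex.I * (u ^ 2 : ℝ))) u := by
    intro u hu
    rw [uIcc_of_le hs] at hu
    have a : HasDerivAt (fun u : ℝ => Complex.exp (Complex.I * (u ^ 2 : ℝ)))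
        (Complex.exp (Complex.I * (u ^ 2 : ℝ)) * (Complex.I * (2 * u))) u := by
      have := ((((hasDerivAt_id u).pow 2).ofReal_comp).const_mul Complex.I).cexp
      simpa using this
    refine (a.mul (hasDerivAt_fresnelAmp hu.1)).neg.congr_deriv ?_
    rw [fresnelAmpDeriv]
    ring
  have := integral_eq_sub_of_hasDerivAt hd (Continuous.intervalIntegrable (by fun_prop) _ _)
  rw [fresnel, this]
  simp
  ring

theorem fresnel_neg (s : ℝ) : fresnel (-s) = -fresnel s := by
  have := integral_comp_neg (a := 0) (b := s) fun u : ℝ => Complex.exp (Complex.I * (u ^ 2 : ℝ))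
  simp only [neg_sq, neg_zero] at this
  rw [fresnel, integral_symm, ← this, fresnel]

theorem continuous_fresnel : Continuous fresnel :=
  continuous_primitive (fun a b => Continuous.intervalIntegrable (by fun_prop) a b) 0

/-- The sign function with complex values. -/
noncomputable def csign (s : ℝ) : ℂ := SignType.sign s

theorem csign_of_pos {s : ℝ} (h : 0 < s) : csign s = 1 := by simp [csign, sign_pos h]

theorem csign_of_neg {s : ℝ} (h : s < 0) : csign s = -1 := by simp [csign, sign_neg h]

theorem norm_csign_le (s : ℝ) : ‖csign s‖ ≤ 1 := by
  rcases lt_trichotomy s 0 with h | rfl | h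
  · simp [csign_of_neg h]
  · simp [csign]
  · simp [csign_of_pos h]

theorem measurable_csign : Measurable csign := by
  have : csign = fun s : ℝ => if 0 < s then 1 else if s < 0 then -1 else 0 := by
    ext s
    rw [csign, sign_apply]
    split_ifs <;> simp
  rw [this]
  exact Measurable.ite measurableSet_Ioi measurable_const
    (Measurable.ite measurableSet_Iio measurable_const measurable_const)

/-- The Fresnel integral minus its limits at `±∞`. -/
noncomputable def fresnelRem (s : ℝ) : ℂ := fresnel s - csign s * fresnelAmp 0

theorem fresnelRem_of_pos {s : ℝ} (hs : 0 < s) :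
    fresnelRem s = -(Complex.exp (Complex.I * (s ^ 2 : ℝ)) * fresnelAmp s) := by
  rw [fresnelRem, fresnel_eq hs.le, csign_of_pos hs]
  ring

theorem fresnelRem_neg (s : ℝ) : fresnelRem (-s) = -fresnelRem s := by
  rw [fresnelRem, fresnelRem, fresnel_neg, csign, csign, Left.sign_neg]
  simp; ring

theorem fresnelRem_zero : fresnelRem 0 = 0 := by simp [fresnelRem, fresnel, csign]

theorem norm_fresnelRem_of_pos {s : ℝ} (hs : 0 < s) : ‖fresnelRem s‖ = ‖fresnelAmp s‖ := by
  rw [fresnelRem_of_pos hs, norm_neg, norm_mul, mul_comm Complex.I, Complex.norm_exp_ofReal_mul_I,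
    one_mul]

theorem norm_fresnelRem_abs (s : ℝ) : ‖fresnelRem |s|‖ = ‖fresnelRem s‖ := by
  rcases abs_choice s with h | h <;> rw [h]
  rw [fresnelRem_neg, norm_neg]

theorem norm_fresnelRem_le_one (s : ℝ) : ‖fresnelRem s‖ ≤ 1 := by
  rw [← norm_fresnelRem_abs]
  rcases (abs_nonneg s).eq_or_lt with h | h
  · rw [← h, fresnelRem_zero]; simp
  · rw [norm_fresnelRem_of_pos h]; exact norm_fresnelAmp_le_one h.le

theorem abs_mul_norm_fresnelRem_le (s : ℝ) : |s| * ‖fresnelRem s‖ ≤ 2 := by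
  rw [← norm_fresnelRem_abs]
  rcases (abs_nonneg s).eq_or_lt with h | h
  · rw [← h]; simp
  · rw [norm_fresnelRem_of_pos h]; exact mul_norm_fresnelAmp_le h.le

theorem measurable_fresnelRem : Measurable fresnelRem :=
  continuous_fresnel.measurable.sub (measurable_csign.mul_const _)

end BOZK

/-! ### Phases in the remaining variable u, and the contribution of a single edge. -/

namespace BOZK
open Set intervalIntegral

/-- A strictly increasing continuous function changes sign at most once. -/
theorem exists_sign_change {h : ℝ → ℝ} {c d : ℝ} (hcd : c ≤ d) (hc : ContinuousOn h (Icc c d))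
    (hm : StrictMonoOn h (Icc c d)) :
    ∃ e ∈ Icc c d, (∀ u ∈ Ioo c e, h u < 0) ∧ (∀ u ∈ Ioo e d, 0 < h u) ∧
      (c < e → ∀ u ∈ Icc c e, h u ≤ 0) ∧ (e < d → ∀ u ∈ Icc e d, 0 ≤ h u) := by
  have mc : c ∈ Icc c d := ⟨le_rfl, hcd⟩
  have md : d ∈ Icc c d := ⟨hcd, le_rfl⟩
  rcases le_total 0 (h c) with h0 | h0
  -- Here h may be positive at c = e already. This is why the weak inequalities on closed intervals
  -- are claimed only for nondegenerate ones.
  · refine ⟨c, mc, fun u hu => absurd (hu.1.trans hu.2) (lt_irrefl _), fun u hu => ?_,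
      fun h => absurd h (lt_irrefl _), fun _ u hu => ?_⟩
    · exact h0.trans_lt (hm mc ⟨hu.1.le, hu.2.le⟩ hu.1)
    · exact h0.trans (hm.monotoneOn mc hu hu.1)
  rcases le_total (h d) 0 with h1 | h1
  · refine ⟨d, md, fun u hu => ?_, fun u hu => absurd (hu.1.trans hu.2) (lt_irrefl _),
      fun _ u hu => ?_, fun h => absurd h (lt_irrefl _)⟩
    · exact (hm ⟨hu.1.le, hu.2.le⟩ md hu.2).trans_le h1
    · exact (hm.monotoneOn hu md hu.2).trans h1
  obtain ⟨e, he, h2⟩ := intermediate_value_Icc hcd hc ⟨h0, h1⟩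
  refine ⟨e, he, fun u hu => ?_, fun u hu => ?_, fun _ u hu => ?_, fun _ u hu => ?_⟩
  · rw [← h2]; exact hm ⟨hu.1.le, hu.2.le.trans he.2⟩ he hu.2
  · rw [← h2]; exact hm he ⟨he.1.trans hu.1.le, hu.2.le⟩ hu.1
  · rw [← h2]; exact hm.monotoneOn ⟨hu.1, hu.2.trans he.2⟩ he hu.2
  · rw [← h2]; exact hm.monotoneOn he ⟨he.1.trans hu.1, hu.2⟩ hu.1

theorem intervalIntegral_congr_Ioo {f g : ℝ → ℂ} {a b : ℝ} (hab : a ≤ b)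
    (h : ∀ u ∈ Ioo a b, f u = g u) : ∫ u in a..b, f u = ∫ u in a..b, g u := by
  rw [integral_of_le hab, integral_of_le hab, integral_Ioc_eq_integral_Ioo,
    integral_Ioc_eq_integral_Ioo]
  exact setIntegral_congr_fun measurableSet_Ioo h

theorem intervalIntegrable_mul_of_bounded {f g : ℝ → ℂ} {a b C : ℝ} (hab : a ≤ b)
    (hf : ContinuousOn f (Icc a b)) (hg : Measurable g) (hC : ∀ u, ‖g u‖ ≤ C) :
    IntervalIntegrable (fun u => f u * g u) volume a b := by
  rw [intervalIntegrable_iff_integrableOn_Icc_of_le hab]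
  exact Integrable.mul_bdd hf.integrableOn_Icc hg.aestronglyMeasurable
    (Filter.Eventually.of_forall hC)

theorem norm_exp_I_mul (t : ℝ) : ‖Complex.exp (Complex.I * t)‖ = 1 := by
  rw [mul_comm]; exact Complex.norm_exp_ofReal_mul_I t

theorem hasDerivAt_const_mul_rpow (c p : ℝ) {u : ℝ} (hu : 0 < u) :
    HasDerivAt (fun u : ℝ => c * u ^ p) (c * p * u ^ (p - 1)) u :=
  ((Real.hasDerivAt_rpow_const (Or.inl hu.ne')).const_mul c).congr_deriv (by ring)

theorem continuousOn_const_mul_rpow (c p : ℝ) : ContinuousOn (fun u : ℝ => c * u ^ p) (Ioi 0) :=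
  fun _ hu => (hasDerivAt_const_mul_rpow c p hu).continuousAt.continuousWithinAt

theorem Icc_half_subset_Ioi {c d : ℝ} (hc : 1 / 2 ≤ c) : Icc c d ⊆ Ioi 0 := fun u hu =>
  lt_of_lt_of_le (by norm_num) (hc.trans hu.1)

theorem half_le_rpow {p u : ℝ} (hp0 : 0 ≤ p) (hp : p ≤ 1) (hu : 1 / 2 ≤ u) : 1 / 2 ≤ u ^ p := by
  calc (1 / 2 : ℝ) = (1 / 2) ^ (1 : ℝ) := (Real.rpow_one _).symm
    _ ≤ (1 / 2) ^ p := Real.rpow_le_rpow_of_exponent_ge (by norm_num) (by norm_num) hp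
    _ ≤ u ^ p := Real.rpow_le_rpow (by norm_num) hu hp0

/-- The phase left after completing the square in `μ`, for `y = -2 τ b`. -/
noncomputable def sqPhase (α τ b x u : ℝ) : ℝ :=
  x * u + τ * u ^ (α + 1) + -(τ * b ^ 2) * u ^ (-1 : ℝ)

noncomputable def sqPhaseDeriv (α τ b x u : ℝ) : ℝ :=
  x + τ * (α + 1) * u ^ (α + 1 - 1) + -(τ * b ^ 2) * (-1) * u ^ (-1 - 1 : ℝ)

noncomputable def sqPhaseDeriv2 (α τ b u : ℝ) : ℝ :=
  τ * (α + 1) * (α + 1 - 1) * u ^ (α + 1 - 1 - 1) +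
    -(τ * b ^ 2) * (-1) * (-1 - 1) * u ^ (-1 - 1 - 1 : ℝ)

theorem hasDerivAt_sqPhase (α τ b x : ℝ) {u : ℝ} (hu : 0 < u) :
    HasDerivAt (sqPhase α τ b x) (sqPhaseDeriv α τ b x u) u :=
  ((((hasDerivAt_id u).const_mul x).congr_deriv (mul_one x)).add
    (hasDerivAt_const_mul_rpow _ _ hu)).add (hasDerivAt_const_mul_rpow _ _ hu)

theorem hasDerivAt_sqPhaseDeriv (α τ b x : ℝ) {u : ℝ} (hu : 0 < u) :
    HasDerivAt (sqPhaseDeriv α τ b x) (sqPhaseDeriv2 α τ b u) u :=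
  ((hasDerivAt_const_mul_rpow _ _ hu).const_add x).add (hasDerivAt_const_mul_rpow _ _ hu)

theorem continuousOn_sqPhaseDeriv2 (α τ b : ℝ) : ContinuousOn (sqPhaseDeriv2 α τ b) (Ioi 0) :=
  (continuousOn_const_mul_rpow _ _).add (continuousOn_const_mul_rpow _ _)

theorem continuousOn_sqPhase (α τ b x : ℝ) : ContinuousOn (sqPhase α τ b x) (Ioi 0) :=
  fun _ hu => (hasDerivAt_sqPhase α τ b x hu).continuousAt.continuousWithinAt

/-- The second derivative of the phase is `2 τ u⁻³ (B u ^ (α + 2) - b²)`. -/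
theorem sqPhaseDeriv2_eq (α τ b : ℝ) {u : ℝ} (hu : 0 < u) :
    sqPhaseDeriv2 α τ b u =
      2 * τ * u ^ (-3 : ℝ) * (α * (α + 1) / 2 * u ^ (α + 2) - b ^ 2) := by
  have h : u ^ (α + 1 - 1 - 1) = u ^ (-3 : ℝ) * u ^ (α + 2) := by
    rw [← Real.rpow_add hu]; congr 1; ring
  rw [sqPhaseDeriv2, h, show (-1 - 1 - 1 : ℝ) = -3 by norm_num]
  ring

/-- The data of an amplitude with bounded first derivative on `[1/2, 2]`. -/
structure IsAmplitude (ψ ψ' : ℝ → ℝ) (A : ℝ) : Prop where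
  hasDerivAt : ∀ u ∈ Icc (1 / 2 : ℝ) 2, HasDerivAt ψ (ψ' u) u
  continuousOn : ContinuousOn ψ' (Icc (1 / 2 : ℝ) 2)
  le : ∀ u ∈ Icc (1 / 2 : ℝ) 2, |ψ u| ≤ A
  deriv_le : ∀ u ∈ Icc (1 / 2 : ℝ) 2, |ψ' u| ≤ A

theorem IsAmplitude.continuousOn' {ψ ψ' : ℝ → ℝ} {A : ℝ} (h : IsAmplitude ψ ψ' A) :
    ContinuousOn ψ (Icc (1 / 2 : ℝ) 2) :=
  fun u hu => (h.hasDerivAt u hu).continuousAt.continuousWithinAt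

theorem IsAmplitude.nonneg {ψ ψ' : ℝ → ℝ} {A : ℝ} (h : IsAmplitude ψ ψ' A) : 0 ≤ A :=
  (abs_nonneg _).trans (h.le 1 (by norm_num))

theorem continuousOn_exp_phase {φ : ℝ → ℝ} {s : Set ℝ} (h : ContinuousOn φ s) :
    ContinuousOn (fun u => Complex.exp (Complex.I * φ u)) s := by fun_prop

section kernel

variable {α τ b x A δ c d : ℝ} {ψ ψ' : ℝ → ℝ}

/-- The contribution of an interval on which the phase is uniformly convex or concave. -/
theorem norm_integral_main_le (hα : α ∈ Icc (1 : ℝ) 2) (hτ : 0 < τ) (hδ : 0 < δ)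
    (hψ : IsAmplitude ψ ψ' A) (hc : 1 / 2 ≤ c) (hcd : c ≤ d) (hd : d ≤ 2)
    (hB : (∀ u ∈ Icc c d, b ^ 2 ≤ (α * (α + 1) / 2 - δ) * u ^ (α + 2)) ∨
      (∀ u ∈ Icc c d, (α * (α + 1) / 2 + δ) * u ^ (α + 2) ≤ b ^ 2)) :
    ‖∫ u in c..d, (ψ u : ℂ) * Complex.exp (Complex.I * sqPhase α τ b x u)‖ ≤
      54 * A / (√δ * √τ) := by
  have hpos := Icc_half_subset_Ioi (d := d) hc
  have hsub : Icc c d ⊆ Icc (1 / 2) 2 := Icc_subset_Icc hc hd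
  have hl : 0 < τ * δ := mul_pos hτ hδ
  -- The weight is τδ·2u^{α−1}, and 2u^{α−1} ≥ 1 for u ≥ 1/2 because 0 ≤ α − 1 ≤ 1.
  have hpow : ∀ u ∈ Icc c d, τ * δ ≤ 2 * τ * u ^ (-3 : ℝ) * (δ * u ^ (α + 2)) := by
    intro u hu
    have h1 : u ^ (-3 : ℝ) * u ^ (α + 2) = u ^ (α - 1) := by
      rw [← Real.rpow_add (hpos hu)]; congr 1; ring
    have h2 := half_le_rpow (p := α - 1) (by linarith [hα.1]) (by linarith [hα.2]) (hc.trans hu.1)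
    have : 2 * τ * u ^ (-3 : ℝ) * (δ * u ^ (α + 2)) = τ * δ * (2 * u ^ (α - 1)) := by
      rw [← h1]; ring
    rw [this]
    nlinarith
  have hw : ∀ u ∈ Icc c d, 0 ≤ 2 * τ * u ^ (-3 : ℝ) := fun u hu => by
    have : 0 < u := hpos hu
    positivity
  have hM : ∀ e ∈ Icc c d,
      ‖∫ u in c..e, Complex.exp (Complex.I * sqPhase α τ b x u)‖ ≤ 18 / √(τ * δ) := by
    intro e he
    have sub : Icc c e ⊆ Icc c d := Icc_subset_Icc_right he.2
    rcases hB with hB | hB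
    · refine norm_integral_exp_le_of_deriv2 he.1 hl
        (fun u hu => hasDerivAt_sqPhase α τ b x (hpos (sub hu)))
        (fun u hu => hasDerivAt_sqPhaseDeriv α τ b x (hpos (sub hu)))
        ((continuousOn_sqPhaseDeriv2 α τ b).mono (sub.trans hpos)) fun u hu => ?_
      rw [sqPhaseDeriv2_eq α τ b (hpos (sub hu))]
      refine (hpow u (sub hu)).trans (mul_le_mul_of_nonneg_left ?_ (hw u (sub hu)))
      linarith [hB u (sub hu)]
    · refine norm_integral_exp_le_of_deriv2_neg he.1 hl
        (fun u hu => hasDerivAt_sqPhase α τ b x (hpos (sub hu)))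
        (fun u hu => hasDerivAt_sqPhaseDeriv α τ b x (hpos (sub hu)))
        ((continuousOn_sqPhaseDeriv2 α τ b).mono (sub.trans hpos)) fun u hu => ?_
      rw [sqPhaseDeriv2_eq α τ b (hpos (sub hu)), le_neg, ← mul_neg]
      refine (hpow u (sub hu)).trans (mul_le_mul_of_nonneg_left ?_ (hw u (sub hu)))
      linarith [hB u (sub hu)]
  refine (norm_integral_mul_le_of_primitive hcd
    (continuousOn_exp_phase ((continuousOn_sqPhase α τ b x).mono hpos)) hM
    (fun u hu => (hψ.hasDerivAt u (hsub hu)).ofReal_comp)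
    (Complex.continuous_ofReal.comp_continuousOn (hψ.continuousOn.mono hsub))).trans ?_
  have h1 : ‖(ψ d : ℂ)‖ ≤ A := by
    rw [Complex.norm_real]; exact hψ.le d (hsub ⟨hcd, le_rfl⟩)
  have h2 : ∫ u in c..d, ‖(ψ' u : ℂ)‖ ≤ 2 * A := by
    have := intervalIntegral.norm_integral_le_of_norm_le_const (a := c) (b := d)
      (f := fun u => ‖(ψ' u : ℂ)‖) (C := A) fun u hu => by
        rw [uIoc_of_le hcd] at hu
        rw [norm_norm, Complex.norm_real]
        exact hψ.deriv_le u (hsub (Ioc_subset_Icc_self hu))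
    rw [abs_of_nonneg (by linarith)] at this
    refine (le_abs_self _).trans (this.trans ?_)
    nlinarith [hψ.nonneg]
  rw [← Real.sqrt_mul hδ.le, mul_comm δ τ]
  have hs : 0 < √(τ * δ) := Real.sqrt_pos.2 hl
  calc _ ≤ 18 / √(τ * δ) * (A + 2 * A) := by gcongr
    _ = _ := by ring

/-- The signed rescaled distance of the edge `μ = κ u ^ β` to the critical point `b / u`. -/
noncomputable def edgeDist (τ b κ β u : ℝ) : ℝ :=
  √τ * κ * u ^ (β + 1 / 2) + -(√τ * b) * u ^ (-(1 / 2) : ℝ)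

noncomputable def edgeDistDeriv (τ b κ β u : ℝ) : ℝ :=
  √τ * κ * (β + 1 / 2) * u ^ (β + 1 / 2 - 1) + -(√τ * b) * (-(1 / 2)) * u ^ (-(1 / 2) - 1 : ℝ)

theorem hasDerivAt_edgeDist (τ b κ β : ℝ) {u : ℝ} (hu : 0 < u) :
    HasDerivAt (edgeDist τ b κ β) (edgeDistDeriv τ b κ β u) u :=
  (hasDerivAt_const_mul_rpow _ _ hu).add (hasDerivAt_const_mul_rpow _ _ hu)

theorem continuousOn_edgeDist (τ b κ β : ℝ) : ContinuousOn (edgeDist τ b κ β) (Ioi 0) :=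
  fun _ hu => (hasDerivAt_edgeDist τ b κ β hu).continuousAt.continuousWithinAt

theorem continuousOn_edgeDistDeriv (τ b κ β : ℝ) :
    ContinuousOn (edgeDistDeriv τ b κ β) (Ioi 0) :=
  (continuousOn_const_mul_rpow _ _).add (continuousOn_const_mul_rpow _ _)

theorem measurable_edgeDist (τ b κ β : ℝ) : Measurable (edgeDist τ b κ β) := by
  unfold edgeDist; fun_prop

/-- The phase along the edge `μ = κ u ^ β`. -/
noncomputable def edgePhase (α τ b x κ β u : ℝ) : ℝ :=
  x * u + -(2 * τ * b * κ) * u ^ β + τ * u ^ (α + 1) + τ * κ ^ 2 * u ^ (2 * β + 1)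

/-- Adding the square of the edge distance undoes the completed square: the term −τb²/u cancels,
leaving the original phase restricted to the curve μ = κu^β. -/
theorem edgePhase_eq (hτ : 0 < τ) (κ β : ℝ) {u : ℝ} (hu : 0 < u) :
    edgePhase α τ b x κ β u = sqPhase α τ b x u + edgeDist τ b κ β u ^ 2 := by
  have h1 : u ^ (β + 1 / 2) * u ^ (β + 1 / 2) = u ^ (2 * β + 1) := by
    rw [← Real.rpow_add hu]; congr 1; ring
  have h2 : u ^ (β + 1 / 2) * u ^ (-(1 / 2) : ℝ) = u ^ β := by
    rw [← Real.rpow_add hu]; congr 1; ring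
  have h3 : u ^ (-(1 / 2) : ℝ) * u ^ (-(1 / 2) : ℝ) = u ^ (-1 : ℝ) := by
    rw [← Real.rpow_add hu]; congr 1; norm_num
  have hs : √τ * √τ = τ := Real.mul_self_sqrt hτ.le
  rw [edgePhase, sqPhase, edgeDist, ← h1, ← h2, ← h3]
  linear_combination (-(κ * u ^ (β + 1 / 2) - b * u ^ (-(1 / 2) : ℝ)) ^ 2) * hs

/-- For b, κ ≥ 0 and 0 ≤ β ≤ 1 the functions −u^β, u^{α+1} and u^{2β+1} are all convex, so nothing
cancels. The middle term alone gives second derivative at least τ, from α(α+1) ≥ 2 and u^{α−1} ≥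
1/2. No nondegeneracy of ω is needed on the edges. -/
theorem norm_integral_exp_edgePhase_le (hα : α ∈ Icc (1 : ℝ) 2) (hτ : 0 < τ) (hb : 0 ≤ b)
    {κ β : ℝ} (hκ : 0 ≤ κ) (hβ : β ∈ Icc (0 : ℝ) 1) (hc : 1 / 2 ≤ c) (hcd : c ≤ d) :
    ‖∫ u in c..d, Complex.exp (Complex.I * edgePhase α τ b x κ β u)‖ ≤ 18 / √τ := by
  have hpos := Icc_half_subset_Ioi (d := d) hc
  refine norm_integral_exp_le_of_deriv2 hcd hτ
    (Φ₁ := fun u => x + -(2 * τ * b * κ) * β * u ^ (β - 1) + τ * (α + 1) * u ^ (α + 1 - 1) +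
      τ * κ ^ 2 * (2 * β + 1) * u ^ (2 * β + 1 - 1))
    (Φ₂ := fun u => -(2 * τ * b * κ) * β * (β - 1) * u ^ (β - 1 - 1) +
      τ * (α + 1) * (α + 1 - 1) * u ^ (α + 1 - 1 - 1) +
      τ * κ ^ 2 * (2 * β + 1) * (2 * β + 1 - 1) * u ^ (2 * β + 1 - 1 - 1))
    (fun u hu => ?_) (fun u hu => ?_) ?_ fun u hu => ?_
  · have hu := hpos hu
    exact (((((hasDerivAt_id u).const_mul x).congr_deriv (mul_one x)).add
      (hasDerivAt_const_mul_rpow _ _ hu)).add (hasDerivAt_const_mul_rpow _ _ hu)).add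
      (hasDerivAt_const_mul_rpow _ _ hu)
  · have hu := hpos hu
    exact (((hasDerivAt_const_mul_rpow _ _ hu).const_add x).add
      (hasDerivAt_const_mul_rpow _ _ hu)).add (hasDerivAt_const_mul_rpow _ _ hu)
  · exact (((continuousOn_const_mul_rpow _ _).add (continuousOn_const_mul_rpow _ _)).add
      (continuousOn_const_mul_rpow _ _)).mono hpos
  · have h0 : 0 < u := hpos hu
    have h1 := half_le_rpow (p := α + 1 - 1 - 1) (by linarith [hα.1]) (by linarith [hα.2])
      (hc.trans hu.1)
    have t1 : 0 ≤ -(2 * τ * b * κ) * β * (β - 1) * u ^ (β - 1 - 1) := by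
      have e : -(2 * τ * b * κ) * β * (β - 1) * u ^ (β - 1 - 1) =
        2 * τ * b * κ * β * (1 - β) * u ^ (β - 1 - 1) := by ring
      have := hβ.1
      have : 0 ≤ 1 - β := by linarith [hβ.2]
      rw [e]; positivity
    have t3 : 0 ≤ τ * κ ^ 2 * (2 * β + 1) * (2 * β + 1 - 1) * u ^ (2 * β + 1 - 1 - 1) := by
      have := hβ.1
      have : 0 ≤ 2 * β + 1 - 1 := by linarith
      positivity
    have t2 : τ ≤ τ * (α + 1) * (α + 1 - 1) * u ^ (α + 1 - 1 - 1) := by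
      have h2 : 2 ≤ (α + 1) * (α + 1 - 1) := by nlinarith [hα.1]
      have h3 : 1 ≤ (α + 1) * (α + 1 - 1) * u ^ (α + 1 - 1 - 1) := by nlinarith
      calc τ = τ * 1 := (mul_one τ).symm
        _ ≤ τ * ((α + 1) * (α + 1 - 1) * u ^ (α + 1 - 1 - 1)) := by gcongr
        _ = _ := by ring
    linarith

theorem edgeDistDeriv_nonneg (hb : 0 ≤ b) {κ β : ℝ} (hκ : 0 ≤ κ) (hβ : 0 ≤ β) {u : ℝ}
    (hu : 0 < u) : 0 ≤ edgeDistDeriv τ b κ β u := by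
  have e : edgeDistDeriv τ b κ β u = √τ * κ * (β + 1 / 2) * u ^ (β + 1 / 2 - 1) +
      √τ * b * (1 / 2) * u ^ (-(1 / 2) - 1 : ℝ) := by rw [edgeDistDeriv]; ring
  rw [e]; positivity

theorem strictMonoOn_edgeDist (hτ : 0 < τ) (hb : 0 ≤ b) {κ β : ℝ} (hκ : 0 < κ) (hβ : 0 ≤ β) :
    StrictMonoOn (edgeDist τ b κ β) (Ioi 0) := by
  intro u hu v hv huv
  have hu : 0 < u := hu
  have h1 : u ^ (β + 1 / 2) < v ^ (β + 1 / 2) := Real.rpow_lt_rpow hu.le huv (by linarith)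
  have h2 : v ^ (-(1 / 2) : ℝ) ≤ u ^ (-(1 / 2) : ℝ) :=
    Real.rpow_le_rpow_of_nonpos hu huv.le (by norm_num)
  have hs : 0 < √τ := Real.sqrt_pos.2 hτ
  rw [edgeDist, edgeDist]
  have h3 := mul_lt_mul_of_pos_left h1 (mul_pos hs hκ)
  have h4 := mul_le_mul_of_nonneg_left h2 (mul_nonneg hs.le hb)
  linarith

/-- The variation of the amplitude is bounded uniformly in all parameters: s = `edgeDist` is
monotone in u, so the derivative of the Fresnel amplitude is at most 2s′/(1 + s²), an exact
arctangent derivative, however large s′ is. The sign σ selects the side of the zero of s, so that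
the amplitude is only evaluated on [0, ∞). -/
theorem norm_integral_edge_amp_le (hα : α ∈ Icc (1 : ℝ) 2) (hτ : 0 < τ) (hb : 0 ≤ b)
    (hψ : IsAmplitude ψ ψ' A) {κ β σ : ℝ} (hκ : 0 ≤ κ) (hβ : β ∈ Icc (0 : ℝ) 1)
    (hc : 1 / 2 ≤ c) (hcd : c ≤ d) (hd : d ≤ 2) (hσ : |σ| = 1)
    (hs : ∀ u ∈ Icc c d, 0 ≤ σ * edgeDist τ b κ β u) :
    ‖∫ u in c..d, (ψ u * fresnelAmp (σ * edgeDist τ b κ β u)) *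
      Complex.exp (Complex.I * edgePhase α τ b x κ β u)‖ ≤ 200 * A / √τ := by
  have hpos := Icc_half_subset_Ioi (d := d) hc
  have hsub : Icc c d ⊆ Icc (1 / 2) 2 := Icc_subset_Icc hc hd
  have cΨ : ContinuousOn (edgePhase α τ b x κ β) (Ioi 0) :=
    ((((continuousOn_const.mul continuousOn_id).add (continuousOn_const_mul_rpow _ _)).add
      (continuousOn_const_mul_rpow _ _)).add (continuousOn_const_mul_rpow _ _))
  set s := edgeDist τ b κ β with hsdef
  set s' := edgeDistDeriv τ b κ β with hs'def
  have cs : ContinuousOn s (Icc c d) := (continuousOn_edgeDist τ b κ β).mono hpos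
  have cs' : ContinuousOn s' (Icc c d) := (continuousOn_edgeDistDeriv τ b κ β).mono hpos
  have ds : ∀ u ∈ Icc c d, HasDerivAt s (s' u) u := fun u hu =>
    hasDerivAt_edgeDist τ b κ β (hpos hu)
  have s'0 : ∀ u ∈ Icc c d, 0 ≤ s' u := fun u hu =>
    edgeDistDeriv_nonneg hb hκ hβ.1 (hpos hu)
  have cψ : ContinuousOn (fun u => (ψ u : ℂ)) (Icc c d) :=
    Complex.continuous_ofReal.comp_continuousOn (hψ.continuousOn'.mono hsub)
  have cψ' : ContinuousOn (fun u => (ψ' u : ℂ)) (Icc c d) :=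
    Complex.continuous_ofReal.comp_continuousOn (hψ.continuousOn.mono hsub)
  have cσs : ContinuousOn (fun u => σ * s u) (Icc c d) := continuousOn_const.mul cs
  have cw : ContinuousOn (fun u => fresnelAmp (σ * s u)) (Icc c d) :=
    continuousOn_fresnelAmp.comp cσs hs
  have cw' : ContinuousOn (fun u => fresnelAmpDeriv (σ * s u)) (Icc c d) :=
    continuousOn_fresnelAmpDeriv.comp cσs hs
  set g' : ℝ → ℂ := fun u => ψ' u * fresnelAmp (σ * s u) +
    ψ u * ((σ * s' u : ℝ) • fresnelAmpDeriv (σ * s u)) with hg'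
  have hg : ∀ u ∈ Icc c d, HasDerivAt (fun u => (ψ u : ℂ) * fresnelAmp (σ * s u)) (g' u) u :=
    fun u hu => by
      have hw : HasDerivAt (fun u => fresnelAmp (σ * s u))
          ((σ * s' u : ℝ) • fresnelAmpDeriv (σ * s u)) u :=
        HasDerivAt.scomp u (hasDerivAt_fresnelAmp (hs u hu)) ((ds u hu).const_mul σ)
      exact ((hψ.hasDerivAt u (hsub hu)).ofReal_comp).mul hw
  have cg' : ContinuousOn g' (Icc c d) :=
    (cψ'.mul cw).add (cψ.mul ((continuousOn_const.mul cs').smul cw'))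
  refine (norm_integral_mul_le_of_primitive hcd (continuousOn_exp_phase (cΨ.mono hpos))
    (fun e he => norm_integral_exp_edgePhase_le hα hτ hb hκ hβ hc he.1) hg cg').trans ?_
  have hA := hψ.nonneg
  have h1 : ‖(ψ d : ℂ) * fresnelAmp (σ * s d)‖ ≤ A := by
    have hd' : d ∈ Icc c d := ⟨hcd, le_rfl⟩
    rw [norm_mul, Complex.norm_real]
    calc _ ≤ A * 1 := mul_le_mul (hψ.le d (hsub hd')) (norm_fresnelAmp_le_one (hs d hd'))
          (norm_nonneg _) hA
      _ = A := mul_one A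
  have h2 : ∫ u in c..d, ‖g' u‖ ≤ 2 * A + 8 * A := by
    have iat : IntervalIntegrable (fun u => s' u / (1 + s u ^ 2)) volume c d :=
      (cs'.div (continuousOn_const.add (cs.pow 2))
        fun u _ => (add_pos_of_pos_of_nonneg one_pos (sq_nonneg (s u))).ne').intervalIntegrable_of_Icc hcd
    have hat : ∫ u in c..d, s' u / (1 + s u ^ 2) = Real.arctan (s d) - Real.arctan (s c) :=
      integral_eq_sub_of_hasDerivAt (f := fun u => Real.arctan (s u))
        (fun u hu => ((ds u (uIcc_of_le hcd ▸ hu)).arctan).congr_deriv (by ring)) iat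
    have hmaj : ∀ u ∈ Icc c d, ‖g' u‖ ≤ A + 2 * A * (s' u / (1 + s u ^ 2)) := by
      intro u hu
      have hσ2 : (σ * s u) ^ 2 = s u ^ 2 := by
        rw [mul_pow, ← sq_abs σ, hσ]; ring
      have k1 := norm_fresnelAmp_le_one (hs u hu)
      have k2 := norm_fresnelAmpDeriv_le (hs u hu)
      rw [hσ2] at k2
      have k3 := hψ.le u (hsub hu)
      have k4 := hψ.deriv_le u (hsub hu)
      refine (norm_add_le _ _).trans (add_le_add ?_ ?_)
      · rw [norm_mul, Complex.norm_real]
        calc _ ≤ A * 1 := mul_le_mul k4 k1 (norm_nonneg _) hA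
          _ = A := mul_one A
      · rw [norm_mul, Complex.norm_real, norm_smul, Real.norm_eq_abs (σ * s' u), abs_mul, hσ,
          one_mul, abs_of_nonneg (s'0 u hu)]
        calc _ ≤ A * (s' u * (2 / (1 + s u ^ 2))) :=
              mul_le_mul k3 (mul_le_mul_of_nonneg_left k2 (s'0 u hu))
                (mul_nonneg (s'0 u hu) (norm_nonneg _)) hA
          _ = _ := by ring
    calc ∫ u in c..d, ‖g' u‖ ≤ ∫ u in c..d, (A + 2 * A * (s' u / (1 + s u ^ 2))) :=
          integral_mono_on hcd (cg'.norm.intervalIntegrable_of_Icc hcd)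
            (intervalIntegrable_const.add (iat.const_mul _)) hmaj
      _ = A * (d - c) + 2 * A * (Real.arctan (s d) - Real.arctan (s c)) := by
          rw [intervalIntegral.integral_add intervalIntegrable_const (iat.const_mul _),
            intervalIntegral.integral_const, intervalIntegral.integral_const_mul, hat, smul_eq_mul]
          ring
      _ ≤ 2 * A + 8 * A := by
          have p1 := Real.arctan_lt_pi_div_two (s d)
          have p2 := Real.neg_pi_div_two_lt_arctan (s c)
          have p3 := Real.pi_lt_four
          have p4 : d - c ≤ 2 := by linarith
          have p5 : Real.arctan (s d) - Real.arctan (s c) ≤ 4 := by linarith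
          nlinarith
  have hsq : 0 < √τ := Real.sqrt_pos.2 hτ
  calc _ ≤ 18 / √τ * (A + (2 * A + 8 * A)) := by gcongr
    _ ≤ 200 * A / √τ := by
      rw [div_mul_eq_mul_div]
      exact div_le_div_of_nonneg_right (by linarith) hsq.le

theorem norm_integral_edge_le_of_sign (hα : α ∈ Icc (1 : ℝ) 2) (hτ : 0 < τ) (hb : 0 ≤ b)
    (hψ : IsAmplitude ψ ψ' A) {κ β σ : ℝ} (hκ : 0 ≤ κ) (hβ : β ∈ Icc (0 : ℝ) 1)
    (hc : 1 / 2 ≤ c) (hcd : c ≤ d) (hd : d ≤ 2) (hσ : σ = 1 ∨ σ = -1)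
    (hs : c < d → ∀ u ∈ Icc c d, 0 ≤ σ * edgeDist τ b κ β u)
    (hs' : ∀ u ∈ Ioo c d, 0 < σ * edgeDist τ b κ β u) :
    ‖∫ u in c..d, (ψ u * Complex.exp (Complex.I * sqPhase α τ b x u)) *
      fresnelRem (edgeDist τ b κ β u)‖ ≤ 200 * A / √τ := by
  have hA := hψ.nonneg
  rcases hcd.eq_or_lt with rfl | hlt
  · simp only [integral_same, norm_zero]; positivity
  have hpos := Icc_half_subset_Ioi (d := d) hc
  have e : ∀ u ∈ Ioo c d, (ψ u * Complex.exp (Complex.I * sqPhase α τ b x u)) *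
      fresnelRem (edgeDist τ b κ β u) = -(σ : ℂ) * ((ψ u * fresnelAmp (σ * edgeDist τ b κ β u)) *
      Complex.exp (Complex.I * edgePhase α τ b x κ β u)) := by
    intro u hu
    have hrem : fresnelRem (edgeDist τ b κ β u) = σ * fresnelRem (σ * edgeDist τ b κ β u) := by
      rcases hσ with rfl | rfl
      · simp
      · rw [neg_one_mul, fresnelRem_neg]; simp
    have hsq : (σ * edgeDist τ b κ β u) ^ 2 = edgeDist τ b κ β u ^ 2 := by
      rcases hσ with rfl | rfl <;> ring
    rw [hrem, fresnelRem_of_pos (hs' u hu), hsq, edgePhase_eq hτ κ β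
      (hpos (Ioo_subset_Icc_self hu)), Complex.ofReal_add, mul_add, Complex.exp_add]
    ring
  have hσ1 : |σ| = 1 := by rcases hσ with rfl | rfl <;> simp
  rw [intervalIntegral_congr_Ioo hcd e, intervalIntegral.integral_const_mul, norm_mul, norm_neg,
    Complex.norm_real, Real.norm_eq_abs, hσ1, one_mul]
  exact norm_integral_edge_amp_le hα hτ hb hψ hκ hβ hc hcd hd hσ1 (hs hlt)

theorem intervalIntegrable_edge (hψ : IsAmplitude ψ ψ' A) {g : ℝ → ℂ} {C : ℝ} (hg : Measurable g)
    (hC : ∀ u, ‖g u‖ ≤ C) (hc : 1 / 2 ≤ c) (hcd : c ≤ d) (hd : d ≤ 2) :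
    IntervalIntegrable (fun u => (ψ u * Complex.exp (Complex.I * sqPhase α τ b x u)) * g u)
      volume c d := by
  refine intervalIntegrable_mul_of_bounded hcd ?_ hg hC
  exact (Complex.continuous_ofReal.comp_continuousOn
    (hψ.continuousOn'.mono (Icc_subset_Icc hc hd))).mul (continuousOn_exp_phase
      ((continuousOn_sqPhase α τ b x).mono (Icc_half_subset_Ioi hc)))

theorem norm_integral_edge_le (hα : α ∈ Icc (1 : ℝ) 2) (hτ : 0 < τ) (hb : 0 ≤ b)
    (hψ : IsAmplitude ψ ψ' A) {κ β : ℝ} (hκ : 0 < κ) (hβ : β ∈ Icc (0 : ℝ) 1) :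
    ‖∫ u in (1 / 2 : ℝ)..2, (ψ u * Complex.exp (Complex.I * sqPhase α τ b x u)) *
      fresnelRem (edgeDist τ b κ β u)‖ ≤ 400 * A / √τ := by
  have hpos := Icc_half_subset_Ioi (c := 1 / 2) (d := 2) le_rfl
  obtain ⟨e, he, h1, h2, h3, h4⟩ := exists_sign_change (c := 1 / 2) (d := 2) (by norm_num)
    ((continuousOn_edgeDist τ b κ β).mono hpos)
    ((strictMonoOn_edgeDist hτ hb hκ hβ.1).mono hpos)
  have hm : Measurable fun u => fresnelRem (edgeDist τ b κ β u) :=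
    measurable_fresnelRem.comp (measurable_edgeDist τ b κ β)
  rw [← integral_add_adjacent_intervals
    (intervalIntegrable_edge hψ hm (fun _ => norm_fresnelRem_le_one _) le_rfl he.1 he.2)
    (intervalIntegrable_edge hψ hm (fun _ => norm_fresnelRem_le_one _) he.1 he.2 le_rfl)]
  refine (norm_add_le _ _).trans ?_
  have p1 := norm_integral_edge_le_of_sign (x := x) (σ := -1) hα hτ hb hψ hκ.le hβ le_rfl he.1
    he.2 (Or.inr rfl) (fun h u hu => by linarith [h3 h u hu]) (fun u hu => by linarith [h1 u hu])
  have p2 := norm_integral_edge_le_of_sign (x := x) (σ := 1) hα hτ hb hψ hκ.le hβ he.1 he.2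
    le_rfl (Or.inl rfl) (fun h u hu => by linarith [h4 h u hu]) (fun u hu => by linarith [h2 u hu])
  calc _ ≤ 200 * A / √τ + 200 * A / √τ := add_le_add p1 p2
    _ = _ := by ring

theorem edgeDist_le_of_neg (hb : 0 ≤ b) {κ β u : ℝ} (hκ : κ < 0) (hβ : β ∈ Icc (0 : ℝ) 1)
    (hu : 1 / 2 ≤ u) : edgeDist τ b κ β u ≤ -(√τ * |κ| / 4) := by
  have h0 : 0 < u := by linarith
  have h1 : 1 / 4 ≤ u ^ (β + 1 / 2) := by
    calc (1 / 4 : ℝ) = (1 / 2) ^ (2 : ℝ) := by norm_num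
      _ ≤ (1 / 2) ^ (β + 1 / 2) := Real.rpow_le_rpow_of_exponent_ge (by norm_num) (by norm_num)
          (by linarith [hβ.2])
      _ ≤ _ := Real.rpow_le_rpow (by norm_num) hu (by linarith [hβ.1])
  have h2 : 0 ≤ √τ * b * u ^ (-(1 / 2) : ℝ) := by positivity
  have h3 : 0 ≤ √τ * |κ| := by positivity
  rw [edgeDist]
  have h4 : κ = -|κ| := by rw [abs_of_neg hκ]; ring
  rw [h4, abs_neg, abs_abs]
  nlinarith

/-- For κ < 0 the edge phase need not be convex. But the edge and the critical point b/u ≥ 0 lie on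
opposite sides of 0, at rescaled distance at least √τ|κ|/4, so the decay of `fresnelRem` gives
τ^{−1/2} pointwise, without oscillation in u. -/
theorem norm_integral_edge_le_of_neg (hτ : 0 < τ) (hb : 0 ≤ b)
    (hψ : IsAmplitude ψ ψ' A) {κ β : ℝ} (hκ : κ < 0) (hβ : β ∈ Icc (0 : ℝ) 1) :
    ‖∫ u in (1 / 2 : ℝ)..2, (ψ u * Complex.exp (Complex.I * sqPhase α τ b x u)) *
      fresnelRem (edgeDist τ b κ β u)‖ ≤ 16 / |κ| * A / √τ := by
  have hκ' : 0 < |κ| := abs_pos.2 hκ.ne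
  have hs : 0 < √τ := Real.sqrt_pos.2 hτ
  have hA := hψ.nonneg
  have key : ∀ u ∈ uIoc (1 / 2 : ℝ) 2, ‖(ψ u * Complex.exp (Complex.I * sqPhase α τ b x u)) *
      fresnelRem (edgeDist τ b κ β u)‖ ≤ A * (8 / (√τ * |κ|)) := by
    intro u hu
    rw [uIoc_of_le (by norm_num)] at hu
    have hu' := Ioc_subset_Icc_self hu
    rw [norm_mul, norm_mul, norm_exp_I_mul, mul_one, Complex.norm_real]
    refine mul_le_mul (hψ.le u hu') ?_ (norm_nonneg _) hA
    have h1 := edgeDist_le_of_neg (τ := τ) hb hκ hβ hu'.1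
    have h2 := abs_mul_norm_fresnelRem_le (edgeDist τ b κ β u)
    have h3 : √τ * |κ| / 4 ≤ |edgeDist τ b κ β u| := (le_neg.1 h1).trans (neg_le_abs _)
    rw [le_div_iff₀ (by positivity)]
    have h4 := mul_le_mul_of_nonneg_right h3 (norm_nonneg (fresnelRem (edgeDist τ b κ β u)))
    linarith
  refine (intervalIntegral.norm_integral_le_of_norm_le_const key).trans ?_
  rw [abs_of_nonneg (by norm_num : (0 : ℝ) ≤ 2 - 1 / 2)]
  calc A * (8 / (√τ * |κ|)) * (2 - 1 / 2) ≤ A * (8 / (√τ * |κ|)) * 2 := by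
        gcongr; norm_num
    _ = _ := by field_simp; ring

end kernel

end BOZK

/-! ### Summation over the six edges. -/

namespace BOZK
open Set intervalIntegral

section kernel

variable {α τ b x A δ : ℝ} {ψ ψ' : ℝ → ℝ}

theorem edgeDist_eq (τ b κ β : ℝ) {u : ℝ} (hu : 0 < u) :
    edgeDist τ b κ β u = √τ * u ^ (-(1 / 2) : ℝ) * (κ * u ^ (β + 1) - b) := by
  have h : u ^ (β + 1 / 2) = u ^ (-(1 / 2) : ℝ) * u ^ (β + 1) := by
    rw [← Real.rpow_add hu]; congr 1; ring
  rw [edgeDist, h]; ring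

theorem edgeDist_nonneg_iff (hτ : 0 < τ) {κ β u : ℝ} (hu : 0 < u) :
    0 ≤ edgeDist τ b κ β u ↔ b ≤ κ * u ^ (β + 1) := by
  rw [edgeDist_eq τ b κ β hu, mul_nonneg_iff_of_pos_left (by positivity), sub_nonneg]

theorem edgeDist_nonpos_iff (hτ : 0 < τ) {κ β u : ℝ} (hu : 0 < u) :
    edgeDist τ b κ β u ≤ 0 ↔ κ * u ^ (β + 1) ≤ b := by
  have hp : 0 < √τ * u ^ (-(1 / 2) : ℝ) := by positivity
  rw [edgeDist_eq τ b κ β hu, ← sub_nonpos (b := b), ← not_lt, ← not_lt,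
    mul_pos_iff_of_pos_left hp]

theorem sq_rpow_half_add_one (α : ℝ) {u : ℝ} (hu : 0 < u) :
    (u ^ (α / 2 + 1)) ^ 2 = u ^ (α + 2) := by
  rw [← Real.rpow_natCast, ← Real.rpow_mul hu.le]; congr 1; push_cast; ring

/-- Alternating sum of a function over the six edges of the truncated noncritical region. -/
noncomputable def edgeSum (g : ℝ → ℂ) (α τ b κ₁ κ₂ R u : ℝ) : ℂ :=
  (g (edgeDist τ b R 0 u) - g (edgeDist τ b (-R) 0 u)) -
    (g (edgeDist τ b κ₂ (α / 2) u) - g (edgeDist τ b κ₁ (α / 2) u)) -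
    (g (edgeDist τ b (-κ₁) (α / 2) u) - g (edgeDist τ b (-κ₂) (α / 2) u))

theorem measurable_edgeSum {g : ℝ → ℂ} (hg : Measurable g) (α τ b κ₁ κ₂ R : ℝ) :
    Measurable (edgeSum g α τ b κ₁ κ₂ R) := by
  have h := fun κ β => hg.comp (measurable_edgeDist τ b κ β)
  exact (((h _ _).sub (h _ _)).sub ((h _ _).sub (h _ _))).sub ((h _ _).sub (h _ _))

theorem norm_edgeSum_le {g : ℝ → ℂ} {C : ℝ} (hg : ∀ s, ‖g s‖ ≤ C) (α τ b κ₁ κ₂ R u : ℝ) :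
    ‖edgeSum g α τ b κ₁ κ₂ R u‖ ≤ 6 * C := by
  have t := fun s t => (norm_sub_le (g s) (g t)).trans (add_le_add (hg s) (hg t))
  unfold edgeSum
  refine (norm_sub_le _ _).trans ?_
  refine (add_le_add ((norm_sub_le _ _).trans (add_le_add (t _ _) (t _ _))) (t _ _)).trans ?_
  linarith

/-- Away from the edges the alternating sum of signs is 2 if the critical point b/u lies in the
noncritical section and 0 otherwise. The negative edges always have sign −1. The distances to R,
κ₂u^{α/2}, κ₁u^{α/2} increase in u and are ordered, hence change sign at points eR ≤ e2 ≤ e1,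
between which the sum is successively 0, 2, 0, 2. Where it is 2, b² is at least δu^{α+2} away from
Bu^{α+2}, so the phase is uniformly convex or concave. -/
theorem norm_integral_edgeSum_csign_le (hα : α ∈ Icc (1 : ℝ) 2) (hτ : 0 < τ) (hδ : 0 < δ)
    (hb : 0 ≤ b) (hψ : IsAmplitude ψ ψ' A) {κ₁ κ₂ R : ℝ} (h1 : 0 < κ₁) (h12 : κ₁ < κ₂)
    (hR : κ₂ * 2 ^ (α / 2) ≤ R) (hκ₁ : κ₁ ^ 2 = α * (α + 1) / 2 - δ)
    (hκ₂ : κ₂ ^ 2 = α * (α + 1) / 2 + δ) :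
    ‖∫ u in (1 / 2 : ℝ)..2, (ψ u * Complex.exp (Complex.I * sqPhase α τ b x u)) *
      edgeSum csign α τ b κ₁ κ₂ R u‖ ≤ 216 * A / (√δ * √τ) := by
  have hpos := Icc_half_subset_Ioi (c := 1 / 2) (d := 2) le_rfl
  have h2 : 0 < κ₂ := h1.trans h12
  have hR0 : 0 < R := lt_of_lt_of_le (by positivity) hR
  have hβ : α / 2 ∈ Icc (0 : ℝ) 1 := ⟨by linarith [hα.1], by linarith [hα.2]⟩
  have h02 : (1 / 2 : ℝ) ≤ 2 := by norm_num
  have hA := hψ.nonneg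
  have neg : ∀ u ∈ Icc (1 / 2 : ℝ) 2, ∀ κ : ℝ, 0 < κ → ∀ β ∈ Icc (0 : ℝ) 1,
      csign (edgeDist τ b (-κ) β u) = -1 := fun u hu κ hκ β hβ => by
    refine csign_of_neg ((edgeDist_le_of_neg hb (neg_neg_of_pos hκ) hβ hu.1).trans_lt ?_)
    have : 0 < |-κ| := abs_pos.2 (by linarith)
    have : 0 < √τ := Real.sqrt_pos.2 hτ
    exact neg_neg_of_pos (by positivity)
  have le12 : ∀ u ∈ Icc (1 / 2 : ℝ) 2, edgeDist τ b κ₁ (α / 2) u ≤ edgeDist τ b κ₂ (α / 2) u := by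
    intro u hu
    have h0 : 0 < u := hpos hu
    unfold edgeDist
    have : √τ * κ₁ * u ^ (α / 2 + 1 / 2) ≤ √τ * κ₂ * u ^ (α / 2 + 1 / 2) := by gcongr
    linarith
  have le2R : ∀ u ∈ Icc (1 / 2 : ℝ) 2, edgeDist τ b κ₂ (α / 2) u ≤ edgeDist τ b R 0 u := by
    intro u hu
    have h0 : 0 < u := hpos hu
    unfold edgeDist
    have : √τ * κ₂ * u ^ (α / 2 + 1 / 2) ≤ √τ * R * u ^ (0 + 1 / 2 : ℝ) := by
      rw [Real.rpow_add h0, zero_add]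
      have h3 : u ^ (α / 2) ≤ 2 ^ (α / 2) := Real.rpow_le_rpow h0.le hu.2 hβ.1
      calc √τ * κ₂ * (u ^ (α / 2) * u ^ (1 / 2 : ℝ)) = √τ * (κ₂ * u ^ (α / 2)) * u ^ (1 / 2 : ℝ) := by
            ring
        _ ≤ √τ * (κ₂ * 2 ^ (α / 2)) * u ^ (1 / 2 : ℝ) := by gcongr
        _ ≤ _ := by gcongr
    linarith
  obtain ⟨eR, meR, R1, R2, R3, R4⟩ := exists_sign_change h02
    ((continuousOn_edgeDist τ b R 0).mono hpos) ((strictMonoOn_edgeDist hτ hb hR0 le_rfl).mono hpos)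
  obtain ⟨e2, me2, S1, S2, S3, S4⟩ := exists_sign_change h02
    ((continuousOn_edgeDist τ b κ₂ (α / 2)).mono hpos)
    ((strictMonoOn_edgeDist hτ hb h2 hβ.1).mono hpos)
  obtain ⟨e1, me1, T1, T2, T3, T4⟩ := exists_sign_change h02
    ((continuousOn_edgeDist τ b κ₁ (α / 2)).mono hpos)
    ((strictMonoOn_edgeDist hτ hb h1 hβ.1).mono hpos)
  -- The larger distance changes sign first: between e2 and eR the distance to R would be negative
  -- and the smaller one positive.
  have heR2 : eR ≤ e2 := by
    by_contra! h
    obtain ⟨u, hu1, hu2⟩ := exists_between h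
    have hu : u ∈ Icc (1 / 2 : ℝ) 2 := ⟨me2.1.trans hu1.le, hu2.le.trans meR.2⟩
    have := le2R u hu
    have := R1 u ⟨me2.1.trans_lt hu1, hu2⟩
    have := S2 u ⟨hu1, hu2.trans_le meR.2⟩
    linarith
  have he21 : e2 ≤ e1 := by
    by_contra! h
    obtain ⟨u, hu1, hu2⟩ := exists_between h
    have hu : u ∈ Icc (1 / 2 : ℝ) 2 := ⟨me1.1.trans hu1.le, hu2.le.trans me2.2⟩
    have := le12 u hu
    have := S1 u ⟨me1.1.trans_lt hu1, hu2⟩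
    have := T2 u ⟨hu1, hu2.trans_le me2.2⟩
    linarith
  have hm := measurable_edgeSum measurable_csign α τ b κ₁ κ₂ R
  have hC := norm_edgeSum_le norm_csign_le α τ b κ₁ κ₂ R
  have int := fun c d (hc : 1 / 2 ≤ c) (hcd : c ≤ d) (hd : d ≤ 2) =>
    intervalIntegrable_edge (α := α) (τ := τ) (b := b) (x := x) hψ hm hC hc hcd hd
  have val : ∀ u ∈ Icc (1 / 2 : ℝ) 2, ∀ ε₁ ε₂ ε₃ : ℂ, csign (edgeDist τ b R 0 u) = ε₁ →
      csign (edgeDist τ b κ₂ (α / 2) u) = ε₂ → csign (edgeDist τ b κ₁ (α / 2) u) = ε₃ →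
      edgeSum csign α τ b κ₁ κ₂ R u = ε₁ + 1 - (ε₂ - ε₃) := by
    intro u hu ε₁ ε₂ ε₃ h3 h4 h5
    rw [edgeSum, h3, h4, h5, neg u hu R hR0 0 (by norm_num), neg u hu κ₁ h1 _ hβ,
      neg u hu κ₂ h2 _ hβ]
    ring
  have zero : ∀ c d, c ≤ d → (∀ u ∈ Ioo c d, edgeSum csign α τ b κ₁ κ₂ R u = 0) →
      ‖∫ u in c..d, (ψ u * Complex.exp (Complex.I * sqPhase α τ b x u)) *
        edgeSum csign α τ b κ₁ κ₂ R u‖ = 0 := by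
    intro c d hcd h
    rw [intervalIntegral_congr_Ioo (g := fun _ => 0) hcd (fun u hu => by rw [h u hu, mul_zero])]
    simp
  have main : ∀ c d, 1 / 2 ≤ c → c ≤ d → d ≤ 2 →
      (∀ u ∈ Ioo c d, edgeSum csign α τ b κ₁ κ₂ R u = 2) →
      (c < d → (∀ u ∈ Icc c d, b ^ 2 ≤ (α * (α + 1) / 2 - δ) * u ^ (α + 2)) ∨
      (∀ u ∈ Icc c d, (α * (α + 1) / 2 + δ) * u ^ (α + 2) ≤ b ^ 2)) →
      ‖∫ u in c..d, (ψ u * Complex.exp (Complex.I * sqPhase α τ b x u)) *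
        edgeSum csign α τ b κ₁ κ₂ R u‖ ≤ 108 * A / (√δ * √τ) := by
    intro c d hc hcd hd hval hB
    rcases hcd.eq_or_lt with rfl | hlt
    · simp only [integral_same, norm_zero]; positivity
    rw [intervalIntegral_congr_Ioo (g := fun u => 2 *
      (ψ u * Complex.exp (Complex.I * sqPhase α τ b x u))) hcd
      (fun u hu => by rw [hval u hu, mul_comm]), intervalIntegral.integral_const_mul, norm_mul,
      Complex.norm_ofNat]
    have := norm_integral_main_le (x := x) hα hτ hδ hψ hc hcd hd (hB hlt)
    calc _ ≤ 2 * (54 * A / (√δ * √τ)) := by gcongr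
      _ = _ := by ring
  have heR1 := heR2.trans he21
  have p1 := zero (1 / 2) eR meR.1 fun u hu => by
    have hu' : u ∈ Icc (1 / 2 : ℝ) 2 := ⟨hu.1.le, hu.2.le.trans meR.2⟩
    rw [val u hu' (-1) (-1) (-1) (csign_of_neg (R1 u hu))
      (csign_of_neg (S1 u ⟨hu.1, hu.2.trans_le heR2⟩))
      (csign_of_neg (T1 u ⟨hu.1, hu.2.trans_le heR1⟩))]
    ring
  -- The critical point lies between κ₂u^{α/2} and R: the concave range.
  have p2 := main eR e2 meR.1 heR2 me2.2 (fun u hu => by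
    have hu' : u ∈ Icc (1 / 2 : ℝ) 2 := ⟨meR.1.trans hu.1.le, hu.2.le.trans me2.2⟩
    rw [val u hu' 1 (-1) (-1) (csign_of_pos (R2 u ⟨hu.1, hu.2.trans_le me2.2⟩))
      (csign_of_neg (S1 u ⟨meR.1.trans_lt hu.1, hu.2⟩))
      (csign_of_neg (T1 u ⟨meR.1.trans_lt hu.1, hu.2.trans_le he21⟩))]
    ring) fun hlt => Or.inr fun u hu => by
    have h0 : 0 < u := hpos ⟨meR.1.trans hu.1, hu.2.trans me2.2⟩
    have := (edgeDist_nonpos_iff hτ h0).1 (S3 (meR.1.trans_lt hlt) u ⟨meR.1.trans hu.1, hu.2⟩)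
    rw [← hκ₂, ← sq_rpow_half_add_one α h0, ← mul_pow]
    exact pow_le_pow_left₀ (by positivity) this 2
  have p3 := zero e2 e1 he21 fun u hu => by
    have hu' : u ∈ Icc (1 / 2 : ℝ) 2 := ⟨me2.1.trans hu.1.le, hu.2.le.trans me1.2⟩
    rw [val u hu' 1 1 (-1) (csign_of_pos (R2 u ⟨heR2.trans_lt hu.1, hu.2.trans_le me1.2⟩))
      (csign_of_pos (S2 u ⟨hu.1, hu.2.trans_le me1.2⟩))
      (csign_of_neg (T1 u ⟨me2.1.trans_lt hu.1, hu.2⟩))]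
    ring
  -- The critical point lies inside the inner radius κ₁u^{α/2}: the convex range.
  have p4 := main e1 2 me1.1 me1.2 le_rfl (fun u hu => by
    have hu' : u ∈ Icc (1 / 2 : ℝ) 2 := ⟨me1.1.trans hu.1.le, hu.2.le⟩
    rw [val u hu' 1 1 1 (csign_of_pos (R2 u ⟨heR1.trans_lt hu.1, hu.2⟩))
      (csign_of_pos (S2 u ⟨he21.trans_lt hu.1, hu.2⟩)) (csign_of_pos (T2 u hu))]
    ring) fun hlt => Or.inl fun u hu => by
    have h0 : 0 < u := hpos ⟨me1.1.trans hu.1, hu.2⟩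
    have := (edgeDist_nonneg_iff hτ h0).1 (T4 hlt u hu)
    rw [← hκ₁, ← sq_rpow_half_add_one α h0, ← mul_pow]
    exact pow_le_pow_left₀ hb this 2
  rw [← integral_add_adjacent_intervals (int _ _ le_rfl meR.1 meR.2) (int _ _ meR.1 meR.2 le_rfl),
    ← integral_add_adjacent_intervals (int _ _ meR.1 heR2 me2.2) (int _ _ me2.1 me2.2 le_rfl),
    ← integral_add_adjacent_intervals (int _ _ me2.1 he21 me1.2) (int _ _ me1.1 me1.2 le_rfl)]
  refine (norm_add_le _ _).trans ?_
  refine (add_le_add le_rfl ((norm_add_le _ _).trans (add_le_add le_rfl (norm_add_le _ _)))).trans ?_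
  rw [p1, p3]
  calc _ ≤ 0 + (108 * A / (√δ * √τ) + (0 + 108 * A / (√δ * √τ))) := by gcongr
    _ = _ := by ring

/-- The oscillatory integral left after integrating out `μ`. -/
theorem norm_integral_edgeSum_fresnel_le (hα : α ∈ Icc (1 : ℝ) 2) (hτ : 0 < τ) (hδ : 0 < δ)
    (hb : 0 ≤ b) (hψ : IsAmplitude ψ ψ' A) {κ₁ κ₂ R : ℝ} (h1 : 0 < κ₁) (h12 : κ₁ < κ₂)
    (hR : κ₂ * 2 ^ (α / 2) ≤ R) (hκ₁ : κ₁ ^ 2 = α * (α + 1) / 2 - δ)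
    (hκ₂ : κ₂ ^ 2 = α * (α + 1) / 2 + δ) :
    ‖∫ u in (1 / 2 : ℝ)..2, (ψ u * Complex.exp (Complex.I * sqPhase α τ b x u)) *
      edgeSum fresnel α τ b κ₁ κ₂ R u‖ ≤ (1200 + 48 / κ₁ + 216 / √δ) * A / √τ := by
  have h2 : 0 < κ₂ := h1.trans h12
  have hκR : κ₂ ≤ R := by
    refine le_trans ?_ hR
    have : (1 : ℝ) ≤ 2 ^ (α / 2) := Real.one_le_rpow (by norm_num) (by linarith [hα.1])
    nlinarith
  have hR0 : 0 < R := h2.trans_le hκR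
  have hβ : α / 2 ∈ Icc (0 : ℝ) 1 := ⟨by linarith [hα.1], by linarith [hα.2]⟩
  have h0 : (0 : ℝ) ∈ Icc (0 : ℝ) 1 := by norm_num
  have hA := hψ.nonneg
  have h02 : (1 / 2 : ℝ) ≤ 2 := by norm_num
  set E : ℝ → ℂ := fun u => ψ u * Complex.exp (Complex.I * sqPhase α τ b x u) with hE
  have split : ∀ u, E u * edgeSum fresnel α τ b κ₁ κ₂ R u =
      ((E u * fresnelRem (edgeDist τ b R 0 u) - E u * fresnelRem (edgeDist τ b (-R) 0 u)) -
      (E u * fresnelRem (edgeDist τ b κ₂ (α / 2) u) -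
        E u * fresnelRem (edgeDist τ b κ₁ (α / 2) u)) -
      (E u * fresnelRem (edgeDist τ b (-κ₁) (α / 2) u) -
        E u * fresnelRem (edgeDist τ b (-κ₂) (α / 2) u))) +
      fresnelAmp 0 * (E u * edgeSum csign α τ b κ₁ κ₂ R u) := by
    intro u
    simp only [edgeSum, fresnelRem, csign]
    ring
  have int : ∀ κ β, IntervalIntegrable (fun u => E u * fresnelRem (edgeDist τ b κ β u))
      volume (1 / 2) 2 := fun κ β => intervalIntegrable_edge hψ
    (measurable_fresnelRem.comp (measurable_edgeDist τ b κ β))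
    (fun _ => norm_fresnelRem_le_one _) le_rfl h02 le_rfl
  have intS : IntervalIntegrable (fun u => E u * edgeSum csign α τ b κ₁ κ₂ R u)
      volume (1 / 2) 2 := intervalIntegrable_edge hψ
    (measurable_edgeSum measurable_csign α τ b κ₁ κ₂ R)
    (norm_edgeSum_le norm_csign_le α τ b κ₁ κ₂ R) le_rfl h02 le_rfl
  change ‖∫ u in (1 / 2 : ℝ)..2, E u * edgeSum fresnel α τ b κ₁ κ₂ R u‖ ≤ _
  simp_rw [split]
  rw [intervalIntegral.integral_add
      ((((int _ _).sub (int _ _)).sub ((int _ _).sub (int _ _))).sub ((int _ _).sub (int _ _)))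
      (intS.const_mul _),
    intervalIntegral.integral_sub (((int _ _).sub (int _ _)).sub ((int _ _).sub (int _ _)))
      ((int _ _).sub (int _ _)),
    intervalIntegral.integral_sub ((int _ _).sub (int _ _)) ((int _ _).sub (int _ _)),
    intervalIntegral.integral_sub (int _ _) (int _ _),
    intervalIntegral.integral_sub (int _ _) (int _ _),
    intervalIntegral.integral_sub (int _ _) (int _ _), intervalIntegral.integral_const_mul]
  -- Three edges with κ > 0 cost 400 each, three with κ < 0 cost at most 16/κ₁ each, and the sign
  -- part costs 216/√δ.
  have eR := norm_integral_edge_le (x := x) hα hτ hb hψ hR0 h0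
  have e2 := norm_integral_edge_le (x := x) hα hτ hb hψ h2 hβ
  have e1 := norm_integral_edge_le (x := x) hα hτ hb hψ h1 hβ
  have nR := norm_integral_edge_le_of_neg (α := α) (x := x) hτ hb hψ (neg_neg_of_pos hR0) h0
  have n2 := norm_integral_edge_le_of_neg (α := α) (x := x) hτ hb hψ (neg_neg_of_pos h2) hβ
  have n1 := norm_integral_edge_le_of_neg (α := α) (x := x) hτ hb hψ (neg_neg_of_pos h1) hβ
  have hs := norm_integral_edgeSum_csign_le (x := x) hα hτ hδ hb hψ h1 h12 hR hκ₁ hκ₂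
  have hγ : ‖fresnelAmp 0‖ ≤ 1 := norm_fresnelAmp_le_one le_rfl
  rw [abs_neg, abs_of_pos hR0] at nR
  rw [abs_neg, abs_of_pos h2] at n2
  rw [abs_neg, abs_of_pos h1] at n1
  have hτ' : 0 < √τ := Real.sqrt_pos.2 hτ
  have nR' : 16 / R * A / √τ ≤ 16 / κ₁ * A / √τ := by gcongr; linarith
  have n2' : 16 / κ₂ * A / √τ ≤ 16 / κ₁ * A / √τ := by gcongr
  refine (norm_add_le _ _).trans ?_
  have tri : ∀ a₁ a₂ a₃ a₄ a₅ a₆ : ℂ, ‖(a₁ - a₂) - (a₃ - a₄) - (a₅ - a₆)‖ ≤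
      (‖a₁‖ + ‖a₂‖) + (‖a₃‖ + ‖a₄‖) + (‖a₅‖ + ‖a₆‖) := fun a₁ a₂ a₃ a₄ a₅ a₆ =>
    (norm_sub_le _ _).trans (add_le_add ((norm_sub_le _ _).trans
      (add_le_add (norm_sub_le _ _) (norm_sub_le _ _))) (norm_sub_le _ _))
  have e7 : ‖fresnelAmp 0 * ∫ u in (1 / 2 : ℝ)..2, E u * edgeSum csign α τ b κ₁ κ₂ R u‖ ≤
      1 * (216 * A / (√δ * √τ)) := by
    rw [norm_mul]
    exact mul_le_mul hγ hs (norm_nonneg _) zero_le_one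
  refine (add_le_add (tri _ _ _ _ _ _) e7).trans ?_
  have fin : (1200 + 48 / κ₁ + 216 / √δ) * A / √τ = 3 * (400 * A / √τ) +
      3 * (16 / κ₁ * A / √τ) + 1 * (216 * A / (√δ * √τ)) := by
    field_simp
    ring
  rw [fin]
  linarith

end kernel

end BOZK

/-! ### The kernel of the localized flow: integration in μ, symmetries, decay and scaling. -/

namespace BOZK
open Set intervalIntegral

/-- The truncated section of the noncritical region over the frequency `ξ`. -/
def ncSection (α δ R ξ : ℝ) : Set ℝ := {μ | |μ| ≤ R ∧ (ξ, μ) ∉ critRegion α δ}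

theorem measurableSet_ncSection (α δ R ξ : ℝ) : MeasurableSet (ncSection α δ R ξ) := by
  refine MeasurableSet.inter (measurableSet_le measurable_norm measurable_const) ?_
  exact (measurable_prodMk_left (measurableSet_critRegion α δ)).compl

/-- The oscillatory integral in `μ` over the noncritical section. -/
noncomputable def sectionInt (α δ R τ y ξ : ℝ) : ℂ :=
  ∫ μ in ncSection α δ R ξ, Complex.exp (Complex.I * (y * μ + τ * (ξ * μ ^ 2) : ℝ))

/-- Radii of the critical region. -/
noncomputable def innerRadius (α δ : ℝ) : ℝ := √(α * (α + 1) / 2 - δ)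

noncomputable def outerRadius (α δ : ℝ) : ℝ := √(α * (α + 1) / 2 + δ)

section radius

variable {α δ : ℝ}

theorem innerRadius_sq (hα : 1 ≤ α) (hδ : δ < 1) :
    innerRadius α δ ^ 2 = α * (α + 1) / 2 - δ := Real.sq_sqrt (by nlinarith)

theorem outerRadius_sq (hα : 1 ≤ α) (hδ : 0 < δ) :
    outerRadius α δ ^ 2 = α * (α + 1) / 2 + δ := Real.sq_sqrt (by nlinarith)

theorem innerRadius_pos (hα : 1 ≤ α) (hδ : δ < 1) : 0 < innerRadius α δ :=
  Real.sqrt_pos.2 (by nlinarith)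

theorem innerRadius_lt (hα : 1 ≤ α) (hδ : 0 < δ) : innerRadius α δ < outerRadius α δ :=
  Real.sqrt_lt_sqrt_iff_of_pos (by nlinarith) |>.2 (by linarith)

theorem rpow_half_sq (α : ℝ) {t : ℝ} (ht : 0 ≤ t) : (t ^ (α / 2)) ^ 2 = t ^ α := by
  rw [← Real.rpow_natCast, ← Real.rpow_mul ht]; congr 1; push_cast; ring

theorem mem_critRegion_iff (hα : 1 ≤ α) (hδ : δ ∈ Ioo (0 : ℝ) 1) (ξ μ : ℝ) :
    (ξ, μ) ∈ critRegion α δ ↔ innerRadius α δ * |ξ| ^ (α / 2) ≤ |μ| ∧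
      |μ| ≤ outerRadius α δ * |ξ| ^ (α / 2) := by
  have h1 := innerRadius_pos hα hδ.2
  have h2 := h1.trans (innerRadius_lt hα hδ.1)
  have h3 : 0 ≤ |ξ| ^ (α / 2) := Real.rpow_nonneg (abs_nonneg _) _
  simp only [critRegion, mem_ofPred_eq]
  rw [← innerRadius_sq hα hδ.2, ← outerRadius_sq hα hδ.1, ← rpow_half_sq α (abs_nonneg ξ),
    ← mul_pow, ← mul_pow, ← sq_abs μ, pow_le_pow_iff_left₀ (by positivity) (abs_nonneg _)
    two_ne_zero, pow_le_pow_iff_left₀ (abs_nonneg _) (by positivity) two_ne_zero]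

theorem integral_ncSection (hα : 1 ≤ α) (hδ : δ ∈ Ioo (0 : ℝ) 1) {R ξ : ℝ} (hξ : ξ ≠ 0)
    (hR : outerRadius α δ * |ξ| ^ (α / 2) ≤ R) {f : ℝ → ℂ} (hf : Continuous f) :
    ∫ μ in ncSection α δ R ξ, f μ = (∫ μ in (-R)..R, f μ) -
      (∫ μ in (innerRadius α δ * |ξ| ^ (α / 2))..(outerRadius α δ * |ξ| ^ (α / 2)), f μ) -
      ∫ μ in (-(outerRadius α δ * |ξ| ^ (α / 2)))..(-(innerRadius α δ * |ξ| ^ (α / 2))), f μ := by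
  have h3 : 0 < |ξ| ^ (α / 2) := Real.rpow_pos_of_pos (abs_pos.2 hξ) _
  set a := innerRadius α δ * |ξ| ^ (α / 2) with ha
  set b := outerRadius α δ * |ξ| ^ (α / 2) with hb
  have ha0 : 0 < a := mul_pos (innerRadius_pos hα hδ.2) h3
  have hab : a < b := mul_lt_mul_of_pos_right (innerRadius_lt hα hδ.1) h3
  have hset : ncSection α δ R ξ = Icc (-R) R \ (Icc a b ∪ Icc (-b) (-a)) := by
    ext μ
    simp only [ncSection, mem_ofPred_eq, mem_critRegion_iff hα hδ, mem_sdiff, mem_union, mem_Icc,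
      abs_le, ← ha, ← hb]
    refine and_congr_right fun _ => not_congr ?_
    rw [le_abs]
    constructor
    · rintro ⟨h | h, h4, h5⟩
      · exact Or.inl ⟨h, h5⟩
      · exact Or.inr ⟨h4, by linarith⟩
    · rintro (⟨h4, h5⟩ | ⟨h4, h5⟩)
      · exact ⟨Or.inl h4, by linarith, h5⟩
      · exact ⟨Or.inr (by linarith), h4, by linarith⟩
  have hi : ∀ c d, IntegrableOn f (Icc c d) := fun c d => hf.continuousOn.integrableOn_Icc
  rw [hset, setIntegral_sdiff (measurableSet_Icc.union measurableSet_Icc) (hi _ _)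
    (union_subset (Icc_subset_Icc (by linarith) hR) (Icc_subset_Icc (by linarith) (by linarith))),
    setIntegral_union ?_ measurableSet_Icc (hi _ _) (hi _ _), integral_of_le (by linarith),
    integral_of_le hab.le, integral_of_le (by linarith), integral_Icc_eq_integral_Ioc,
    integral_Icc_eq_integral_Ioc, integral_Icc_eq_integral_Ioc]
  · ring
  · rw [Set.disjoint_left]
    rintro μ ⟨h4, _⟩ ⟨_, h5⟩
    linarith

end radius

theorem continuous_quadExp (τ y ξ : ℝ) : Continuous fun μ : ℝ =>
    Complex.exp (Complex.I * (y * μ + τ * (ξ * μ ^ 2) : ℝ)) := by fun_prop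

theorem norm_integral_quadExp_le {τ ξ : ℝ} (hτ : τ ≠ 0) (hξ : ξ ≠ 0) (y : ℝ) {c d : ℝ}
    (hcd : c ≤ d) : ‖∫ μ in c..d, Complex.exp (Complex.I * (y * μ + τ * (ξ * μ ^ 2) : ℝ))‖ ≤
      18 / √|τ * ξ| := by
  have hp : 0 < |τ * ξ| := abs_pos.2 (mul_ne_zero hτ hξ)
  have d1 : ∀ μ : ℝ, HasDerivAt (fun μ : ℝ => y * μ + τ * (ξ * μ ^ 2)) (y + 2 * (τ * ξ) * μ) μ :=
    fun μ => (((hasDerivAt_id μ).const_mul y).add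
      ((((hasDerivAt_id μ).pow 2).const_mul ξ).const_mul τ)).congr_deriv (by simp; ring)
  have d2 : ∀ μ : ℝ, HasDerivAt (fun μ : ℝ => y + 2 * (τ * ξ) * μ) (2 * (τ * ξ)) μ :=
    fun μ => (((hasDerivAt_id μ).const_mul _).const_add y).congr_deriv (by simp)
  rcases lt_or_gt_of_ne (mul_ne_zero hτ hξ) with h | h
  · refine norm_integral_exp_le_of_deriv2_neg hcd hp (fun μ _ => d1 μ) (fun μ _ => d2 μ)
      continuousOn_const fun μ _ => ?_
    rw [abs_of_neg h]; linarith
  · refine norm_integral_exp_le_of_deriv2 hcd hp (fun μ _ => d1 μ) (fun μ _ => d2 μ)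
      continuousOn_const fun μ _ => ?_
    rw [abs_of_pos h]; linarith

section kernel

variable {α δ : ℝ}

theorem outerRadius_mul_le (hα : 1 ≤ α) (hδ : δ ∈ Ioo (0 : ℝ) 1) {R ξ : ℝ} (hξ : |ξ| ≤ 2)
    (hR : outerRadius α δ * 2 ^ (α / 2) ≤ R) : outerRadius α δ * |ξ| ^ (α / 2) ≤ R := by
  refine le_trans ?_ hR
  have := (innerRadius_pos hα hδ.2).trans (innerRadius_lt hα hδ.1)
  exact mul_le_mul_of_nonneg_left (Real.rpow_le_rpow (abs_nonneg _) hξ (by linarith)) this.le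

theorem norm_sectionInt_le (hα : 1 ≤ α) (hδ : δ ∈ Ioo (0 : ℝ) 1) {R τ ξ : ℝ} (hτ : τ ≠ 0)
    (hξ : ξ ≠ 0) (hξ2 : |ξ| ≤ 2) (hR : outerRadius α δ * 2 ^ (α / 2) ≤ R) (y : ℝ) :
    ‖sectionInt α δ R τ y ξ‖ ≤ 54 / √|τ * ξ| := by
  have h3 : 0 < |ξ| ^ (α / 2) := Real.rpow_pos_of_pos (abs_pos.2 hξ) _
  have hlt := innerRadius_lt hα hδ.1
  have h0 := innerRadius_pos hα hδ.2
  have hR' := outerRadius_mul_le hα hδ hξ2 hR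
  have hR0 : 0 ≤ R := le_trans (mul_nonneg (h0.trans hlt).le h3.le) hR'
  have hle := mul_le_mul_of_nonneg_right hlt.le h3.le
  rw [sectionInt, integral_ncSection hα hδ hξ hR' (continuous_quadExp τ y ξ)]
  refine (norm_sub_le _ _).trans ((add_le_add (norm_sub_le _ _) le_rfl).trans ?_)
  have e1 := norm_integral_quadExp_le hτ hξ y (by linarith : -R ≤ R)
  have e2 := norm_integral_quadExp_le hτ hξ y hle
  have e3 := norm_integral_quadExp_le hτ hξ y (neg_le_neg hle)
  calc _ ≤ 18 / √|τ * ξ| + 18 / √|τ * ξ| + 18 / √|τ * ξ| := by gcongr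
    _ = _ := by ring

/-- Completing the square: −2τbμ + τuμ² = (k(μ − b/u))² − τb²/u with k = √(τu). The substitution v =
k(μ − b/u) costs 1/k = τ^{−1/2}u^{−1/2}; the factor u^{−1/2} later joins the amplitude in u. -/
theorem integral_quadExp_eq {τ b u : ℝ} (hτ : 0 < τ) (hu : 0 < u) (c d : ℝ) :
    ∫ μ in c..d, Complex.exp (Complex.I * (-(2 * τ * b) * μ + τ * (u * μ ^ 2) : ℝ)) =
      Complex.exp (Complex.I * (-(τ * b ^ 2) * u ^ (-1 : ℝ) : ℝ)) * ((√τ)⁻¹ : ℝ) *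
        (u ^ (-(1 / 2) : ℝ) : ℝ) * (fresnel (√(τ * u) * d - √(τ * u) * (b / u)) -
          fresnel (√(τ * u) * c - √(τ * u) * (b / u))) := by
  set k := √(τ * u) with hk
  have hk0 : 0 < k := Real.sqrt_pos.2 (mul_pos hτ hu)
  have hk2 : k ^ 2 = τ * u := Real.sq_sqrt (mul_pos hτ hu).le
  have hkinv : k⁻¹ = (√τ)⁻¹ * u ^ (-(1 / 2) : ℝ) := by
    rw [hk, Real.sqrt_mul hτ.le, mul_inv, Real.rpow_neg hu.le, ← Real.sqrt_eq_rpow]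
  have e : ∀ μ : ℝ, Complex.exp (Complex.I * (-(2 * τ * b) * μ + τ * (u * μ ^ 2) : ℝ)) =
      Complex.exp (Complex.I * (-(τ * b ^ 2) * u ^ (-1 : ℝ) : ℝ)) *
        Complex.exp (Complex.I * ((k * μ - k * (b / u)) ^ 2 : ℝ)) := by
    intro μ
    rw [← Complex.exp_add, ← mul_add, ← Complex.ofReal_add]
    congr 3
    have : (k * μ - k * (b / u)) ^ 2 = k ^ 2 * (μ - b / u) ^ 2 := by ring
    rw [this, hk2, Real.rpow_neg_one]
    field_simp
    ring
  simp_rw [e]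
  rw [intervalIntegral.integral_const_mul,
    integral_comp_mul_sub (fun v : ℝ => Complex.exp (Complex.I * (v ^ 2 : ℝ))) hk0.ne', hkinv]
  have : ∫ v in (k * c - k * (b / u))..(k * d - k * (b / u)), Complex.exp (Complex.I * (v ^ 2 : ℝ))
      = fresnel (k * d - k * (b / u)) - fresnel (k * c - k * (b / u)) := by
    rw [fresnel, fresnel]
    exact (integral_interval_sub_left (Continuous.intervalIntegrable (by fun_prop) _ _)
      (Continuous.intervalIntegrable (by fun_prop) _ _)).symm
  rw [this, Complex.real_smul, Complex.ofReal_mul (√τ)⁻¹]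
  simp only [mul_assoc]

theorem edgeDist_eq_sqrt_mul {τ : ℝ} (hτ : 0 < τ) (b κ β : ℝ) {u : ℝ} (hu : 0 < u) :
    edgeDist τ b κ β u = √(τ * u) * (κ * u ^ β) - √(τ * u) * (b / u) := by
  have h1 : u ^ (β + 1 / 2) = √u * u ^ β := by
    rw [Real.rpow_add hu, Real.sqrt_eq_rpow]; ring
  have h2 : u ^ (-(1 / 2) : ℝ) = √u * u⁻¹ := by
    rw [Real.sqrt_eq_rpow, ← Real.rpow_neg_one, ← Real.rpow_add hu]; norm_num
  rw [edgeDist, h1, h2, Real.sqrt_mul hτ.le]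
  ring

theorem sectionInt_eq (hα : α ∈ Icc (1 : ℝ) 2) (hδ : δ ∈ Ioo (0 : ℝ) 1) {R τ b u : ℝ}
    (hτ : 0 < τ) (hu : 0 < u) (hu2 : u ≤ 2) (hR : outerRadius α δ * 2 ^ (α / 2) ≤ R) :
    sectionInt α δ R τ (-(2 * τ * b)) u =
      Complex.exp (Complex.I * (-(τ * b ^ 2) * u ^ (-1 : ℝ) : ℝ)) * ((√τ)⁻¹ : ℝ) *
        (u ^ (-(1 / 2) : ℝ) : ℝ) *
        edgeSum fresnel α τ b (innerRadius α δ) (outerRadius α δ) R u := by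
  have hab : |u| = u := abs_of_pos hu
  rw [sectionInt, integral_ncSection hα.1 hδ hu.ne' (outerRadius_mul_le hα.1 hδ (by rwa [hab]) hR)
    (continuous_quadExp _ _ _), hab, integral_quadExp_eq hτ hu, integral_quadExp_eq hτ hu,
    integral_quadExp_eq hτ hu, edgeSum]
  simp only [edgeDist_eq_sqrt_mul hτ _ _ _ hu, Real.rpow_zero, mul_one, neg_mul]
  ring

theorem exists_isAmplitude {ψ : ℝ → ℝ} (hψ : ContDiff ℝ 1 ψ) :
    ∃ ψ' A, IsAmplitude (fun u => ψ u * u ^ (-(1 / 2) : ℝ)) ψ' A := by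
  have hpos := Icc_half_subset_Ioi (c := 1 / 2) (d := 2) le_rfl
  have cp : ∀ p : ℝ, ContinuousOn (fun u : ℝ => u ^ p) (Icc (1 / 2) 2) := fun p => by
    simpa using (continuousOn_const_mul_rpow 1 p).mono hpos
  set ψ' : ℝ → ℝ := fun u => deriv ψ u * u ^ (-(1 / 2) : ℝ) +
    ψ u * (-(1 / 2) * u ^ (-(1 / 2) - 1 : ℝ))
  have c1 : ContinuousOn (fun u => ψ u * u ^ (-(1 / 2) : ℝ)) (Icc (1 / 2) 2) :=
    hψ.continuous.continuousOn.mul (cp _)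
  have c2 : ContinuousOn ψ' (Icc (1 / 2) 2) :=
    ((hψ.continuous_deriv le_rfl).continuousOn.mul (cp _)).add
      (hψ.continuous.continuousOn.mul (continuousOn_const.mul (cp _)))
  obtain ⟨A₁, h1⟩ := isCompact_Icc.exists_bound_of_continuousOn c1
  obtain ⟨A₂, h2⟩ := isCompact_Icc.exists_bound_of_continuousOn c2
  refine ⟨ψ', max A₁ A₂, fun u hu => ?_, c2, fun u hu => (h1 u hu).trans (le_max_left _ _),
    fun u hu => (h2 u hu).trans (le_max_right _ _)⟩
  have hd : HasDerivAt ψ (deriv ψ u) u := (hψ.differentiable one_ne_zero u).hasDerivAt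
  exact hd.mul (Real.hasDerivAt_rpow_const (Or.inl (ne_of_gt (hpos hu))))

/-- The integrand in `ξ` of the kernel of the localized flow. -/
noncomputable def kernelFun (ψ : ℝ → ℝ) (α δ R τ x y ξ : ℝ) : ℂ :=
  ψ ξ * (Complex.exp (Complex.I * (x * ξ + τ * (ξ * |ξ| ^ α) : ℝ)) * sectionInt α δ R τ y ξ)

/-- One factor τ^{−1/2} comes from the exact integration in μ, the other from the oscillation in u.
The normalization y = −2τb with b ≥ 0, τ > 0 is removed below by symmetry. -/
theorem norm_integral_kernelFun_le_of_nonneg (hα : α ∈ Icc (1 : ℝ) 2) (hδ : δ ∈ Ioo (0 : ℝ) 1)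
    {ψ : ℝ → ℝ} (hψ : ContDiff ℝ 1 ψ) : ∃ C : ℝ, 0 ≤ C ∧ ∀ R τ x b : ℝ,
      outerRadius α δ * 2 ^ (α / 2) ≤ R → 0 < τ → 0 ≤ b →
      ‖∫ ξ in (1 / 2 : ℝ)..2, kernelFun ψ α δ R τ x (-(2 * τ * b)) ξ‖ ≤ C / τ := by
  obtain ⟨ψ', A, hA⟩ := exists_isAmplitude hψ
  have hA0 := hA.nonneg
  have h1 := innerRadius_pos hα.1 hδ.2
  refine ⟨(1200 + 48 / innerRadius α δ + 216 / √δ) * A, by positivity,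
    fun R τ x b hR hτ hb => ?_⟩
  have key : ∀ u ∈ Ioo (1 / 2 : ℝ) 2, kernelFun ψ α δ R τ x (-(2 * τ * b)) u =
      ((√τ)⁻¹ : ℝ) * (((ψ u * u ^ (-(1 / 2) : ℝ) : ℝ) * Complex.exp (Complex.I *
        sqPhase α τ b x u)) * edgeSum fresnel α τ b (innerRadius α δ) (outerRadius α δ) R u) := by
    intro u hu
    have hu0 : 0 < u := lt_trans (by norm_num) hu.1
    have e : sqPhase α τ b x u = (x * u + τ * (u * |u| ^ α)) + -(τ * b ^ 2) * u ^ (-1 : ℝ) := by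
      rw [sqPhase, abs_of_pos hu0, Real.rpow_add_one hu0.ne']; ring
    rw [kernelFun, sectionInt_eq hα hδ hτ hu0 hu.2.le hR, e, Complex.ofReal_add _
      (-(τ * b ^ 2) * u ^ (-1 : ℝ)), mul_add, Complex.exp_add, Complex.ofReal_mul (ψ u)]
    ring
  rw [intervalIntegral_congr_Ioo (by norm_num) key, intervalIntegral.integral_const_mul, norm_mul,
    Complex.norm_real, norm_inv, Real.norm_of_nonneg (Real.sqrt_nonneg τ)]
  have := norm_integral_edgeSum_fresnel_le (x := x) hα hτ hδ.1 hb hA h1 (innerRadius_lt hα.1 hδ.1)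
    hR (innerRadius_sq hα.1 hδ.2) (outerRadius_sq hα.1 hδ.1)
  have hs : 0 < √τ := Real.sqrt_pos.2 hτ
  calc _ ≤ (√τ)⁻¹ * ((1200 + 48 / innerRadius α δ + 216 / √δ) * A / √τ) := by gcongr
    _ = (1200 + 48 / innerRadius α δ + 216 / √δ) * A / (√τ * √τ) := by
      rw [div_mul_eq_div_div_swap, inv_mul_eq_div, div_right_comm]
    _ = _ := by rw [Real.mul_self_sqrt hτ.le]

/-- The section is even in μ and in ξ. Evenness in μ makes the kernel even in y; reflecting ξ
reverses x and τ; conjugation reverses x, y and τ. Together these reduce every case to ξ > 0, τ > 0,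
y ≤ 0. -/
theorem neg_mem_ncSection_iff (R ξ μ : ℝ) : -μ ∈ ncSection α δ R ξ ↔ μ ∈ ncSection α δ R ξ := by
  simp [ncSection, critRegion]

theorem mem_ncSection_neg_iff (R ξ μ : ℝ) : μ ∈ ncSection α δ R (-ξ) ↔ μ ∈ ncSection α δ R ξ := by
  simp [ncSection, critRegion]

theorem sectionInt_neg_y (R τ y ξ : ℝ) :
    sectionInt α δ R τ (-y) ξ = sectionInt α δ R τ y ξ := by
  rw [sectionInt, sectionInt, ← MeasureTheory.integral_indicator (measurableSet_ncSection α δ R ξ),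
    ← MeasureTheory.integral_indicator (measurableSet_ncSection α δ R ξ),
      ← MeasureTheory.integral_neg_eq_self]
  congr 1
  ext μ
  by_cases h : μ ∈ ncSection α δ R ξ
  · rw [indicator_of_mem h, indicator_of_mem ((neg_mem_ncSection_iff R ξ μ).2 h)]
    simp
  · rw [indicator_of_notMem h, indicator_of_notMem (fun h' => h ((neg_mem_ncSection_iff R ξ μ).1 h'))]

theorem sectionInt_neg_xi (R τ y ξ : ℝ) :
    sectionInt α δ R τ y (-ξ) = sectionInt α δ R (-τ) y ξ := by
  have : ncSection α δ R (-ξ) = ncSection α δ R ξ := by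
    ext μ; exact mem_ncSection_neg_iff R ξ μ
  rw [sectionInt, sectionInt, this]
  simp

theorem conj_exp_I_mul (t : ℝ) :
    (starRingEnd ℂ) (Complex.exp (Complex.I * t)) = Complex.exp (Complex.I * (-t : ℝ)) := by
  rw [← Complex.exp_conj]
  simp

theorem conj_sectionInt (R τ y ξ : ℝ) :
    (starRingEnd ℂ) (sectionInt α δ R τ y ξ) = sectionInt α δ R (-τ) (-y) ξ := by
  rw [sectionInt, sectionInt, ← integral_conj]
  congr 1
  ext μ
  rw [conj_exp_I_mul]
  congr 3
  ring

theorem conj_kernelFun (ψ : ℝ → ℝ) (R τ x y ξ : ℝ) :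
    (starRingEnd ℂ) (kernelFun ψ α δ R τ x y ξ) = kernelFun ψ α δ R (-τ) (-x) (-y) ξ := by
  rw [kernelFun, kernelFun, map_mul, map_mul, Complex.conj_ofReal, conj_exp_I_mul,
    conj_sectionInt]
  congr 5
  ring

theorem kernelFun_neg (ψ : ℝ → ℝ) (R τ x y ξ : ℝ) :
    kernelFun ψ α δ R τ x y (-ξ) = kernelFun (fun u => ψ (-u)) α δ R (-τ) (-x) y ξ := by
  rw [kernelFun, kernelFun, sectionInt_neg_xi, abs_neg]
  congr 5
  ring

theorem norm_integral_kernelFun_half_le (hα : α ∈ Icc (1 : ℝ) 2) (hδ : δ ∈ Ioo (0 : ℝ) 1)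
    {ψ : ℝ → ℝ} (hψ : ContDiff ℝ 1 ψ) : ∃ C : ℝ, 0 ≤ C ∧ ∀ R τ x y : ℝ,
      outerRadius α δ * 2 ^ (α / 2) ≤ R → τ ≠ 0 →
      ‖∫ ξ in (1 / 2 : ℝ)..2, kernelFun ψ α δ R τ x y ξ‖ ≤ C / |τ| := by
  obtain ⟨C, hC0, hC⟩ := norm_integral_kernelFun_le_of_nonneg hα hδ hψ
  have pos : ∀ R τ x y : ℝ, outerRadius α δ * 2 ^ (α / 2) ≤ R → 0 < τ →
      ‖∫ ξ in (1 / 2 : ℝ)..2, kernelFun ψ α δ R τ x y ξ‖ ≤ C / τ := by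
    intro R τ x y hR hτ
    have hyabs : ∀ ξ, kernelFun ψ α δ R τ x y ξ = kernelFun ψ α δ R τ x (-|y|) ξ := fun ξ => by
      rw [kernelFun, kernelFun, sectionInt_neg_y]
      rcases abs_choice y with h | h <;> rw [h]
      rw [sectionInt_neg_y]
    have h := hC R τ x (|y| / (2 * τ)) hR hτ (by positivity)
    have e : -(2 * τ * (|y| / (2 * τ))) = -|y| := by field_simp
    rw [e] at h
    simpa only [← hyabs] using h
  refine ⟨C, hC0, fun R τ x y hR hτ => ?_⟩
  rcases lt_or_gt_of_ne hτ with h | h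
  · rw [abs_of_neg h, ← Complex.norm_conj, ← intervalIntegral_conj]
    simp_rw [conj_kernelFun]
    exact pos R (-τ) (-x) (-y) hR (by linarith)
  · rw [abs_of_pos h]
    exact pos R τ x y hR h

/-- Dispersive decay of the kernel at unit frequency. -/
theorem norm_integral_kernelFun_le (hα : α ∈ Icc (1 : ℝ) 2) (hδ : δ ∈ Ioo (0 : ℝ) 1)
    {ψ : ℝ → ℝ} (hψ : ContDiff ℝ 1 ψ) (hsupp : ∀ ξ, ψ ξ ≠ 0 → 1 / 2 < |ξ| ∧ |ξ| ≤ 2) :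
    ∃ C : ℝ, 0 ≤ C ∧ ∀ R τ x y : ℝ, outerRadius α δ * 2 ^ (α / 2) ≤ R → τ ≠ 0 →
      ‖∫ ξ, kernelFun ψ α δ R τ x y ξ‖ ≤ C / |τ| := by
  obtain ⟨C₁, h10, h1⟩ := norm_integral_kernelFun_half_le hα hδ hψ
  obtain ⟨C₂, h20, h2⟩ := norm_integral_kernelFun_half_le hα hδ (hψ.comp contDiff_neg)
  refine ⟨C₁ + C₂, by positivity, fun R τ x y hR hτ => ?_⟩
  -- Otherwise the integral is 0 by convention, so integrability need not be proved.
  set f := kernelFun ψ α δ R τ x y with hf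
  by_cases hi_int : Integrable f
  swap
  · rw [integral_undef hi_int, norm_zero]; positivity
  have z : ∀ ξ, ψ ξ = 0 → f ξ = 0 := fun ξ h => by simp [hf, kernelFun, h]
  have half : ∀ (g : ℝ → ℂ) (ρ : ℝ → ℝ), (∀ ξ, ρ ξ = 0 → g ξ = 0) →
      (∀ ξ, ρ ξ ≠ 0 → 1 / 2 < |ξ| ∧ |ξ| ≤ 2) →
      ∫ ξ in Ioi (0 : ℝ), g ξ = ∫ ξ in (1 / 2 : ℝ)..2, g ξ := by
    intro g ρ hg hρ
    rw [integral_of_le (by norm_num)]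
    refine (setIntegral_eq_of_subset_of_forall_sdiff_eq_zero measurableSet_Ioi
      (fun ξ hξ => lt_trans (by norm_num) hξ.1) fun ξ hξ => ?_)
    apply hg
    by_contra h
    have := hρ ξ h
    rw [abs_of_pos hξ.1] at this
    exact hξ.2 this
  have split : ∫ ξ, f ξ = (∫ ξ in Ioi (0 : ℝ), f ξ) + ∫ ξ in Ioi (0 : ℝ), f (-ξ) := by
    rw [integral_comp_neg_Ioi, neg_zero, add_comm]
    exact (integral_Iic_add_Ioi hi_int.integrableOn hi_int.integrableOn).symm
  rw [split, half f ψ z hsupp, half (fun ξ => f (-ξ)) (fun ξ => ψ (-ξ)) (fun ξ h => z _ h)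
    (fun ξ h => by simpa using hsupp (-ξ) h)]
  refine (norm_add_le _ _).trans ?_
  rw [add_div]
  refine add_le_add (h1 R τ x y hR hτ) ?_
  simp only [hf, kernelFun_neg]
  have := h2 R (-τ) (-x) y hR (neg_ne_zero.2 hτ)
  rwa [abs_neg] at this

/-- The weaker decay without a lower bound on the frequency. -/
theorem norm_integral_kernelFun_le_sqrt (hα : α ∈ Icc (1 : ℝ) 2) (hδ : δ ∈ Ioo (0 : ℝ) 1)
    {ψ : ℝ → ℝ} (hψ : ∀ ξ, |ψ ξ| ≤ 1) (hsupp : ∀ ξ, ψ ξ ≠ 0 → |ξ| ≤ 2) {R τ : ℝ}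
    (hR : outerRadius α δ * 2 ^ (α / 2) ≤ R) (hτ : τ ≠ 0) (x y : ℝ) :
    ‖∫ ξ, kernelFun ψ α δ R τ x y ξ‖ ≤ 500 / √|τ| := by
  have hτ' : 0 < |τ| := abs_pos.2 hτ
  -- Only the oscillation in μ is used: it gives 54/√|τξ|, and |ξ|^{−1/2} has integral at most 8
  -- over [−2, 2]. The constant is 54·8 = 432 ≤ 500.
  set w : ℝ → ℝ := fun ξ => |ξ| ^ (-(1 / 2) : ℝ)
  have ipos : IntegrableOn w (Ioc 0 2) := by
    have h := (intervalIntegrable_rpow' (a := 0) (b := 2) (r := -(1 / 2)) (by norm_num)).1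
    exact h.congr_fun (fun ξ hξ => by simp only [w, abs_of_pos hξ.1]) measurableSet_Ioc
  have vpos : ∫ ξ in Ioc (0 : ℝ) 2, w ξ ≤ 4 := by
    have h := integral_rpow (a := 0) (b := 2) (r := -(1 / 2)) (Or.inl (by norm_num))
    rw [integral_of_le (by norm_num)] at h
    have e : ∫ ξ in Ioc (0 : ℝ) 2, w ξ = ∫ ξ in Ioc (0 : ℝ) 2, ξ ^ (-(1 / 2) : ℝ) :=
      setIntegral_congr_fun measurableSet_Ioc fun ξ hξ => by simp only [w, abs_of_pos hξ.1]
    rw [e, h, show (-(1 / 2) + 1 : ℝ) = 1 / 2 by norm_num, ← Real.sqrt_eq_rpow, ← Real.sqrt_eq_rpow,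
      Real.sqrt_zero]
    have : √2 ≤ 2 := by rw [Real.sqrt_le_left (by norm_num)]; norm_num
    linarith
  have hw : ∀ ξ, w (-ξ) = w ξ := fun ξ => by simp [w]
  have iw : IntegrableOn w (Icc (-2) 2) := by
    have h0 : IntervalIntegrable w volume 0 2 :=
      (intervalIntegrable_iff_integrableOn_Ioc_of_le (by norm_num)).2 ipos
    have h1 : IntervalIntegrable w volume (-2) 0 := by
      have := ((IntervalIntegrable.iff_comp_neg).1 h0).symm
      simpa [hw] using this
    exact (intervalIntegrable_iff_integrableOn_Icc_of_le (by norm_num)).1 (h1.trans h0)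
  have vw : ∫ ξ in Icc (-2 : ℝ) 2, w ξ ≤ 8 := by
    have h0 : IntervalIntegrable w volume 0 2 :=
      (intervalIntegrable_iff_integrableOn_Ioc_of_le (by norm_num)).2 ipos
    have h1 : IntervalIntegrable w volume (-2) 0 := by
      have := ((IntervalIntegrable.iff_comp_neg).1 h0).symm
      simpa [hw] using this
    rw [integral_Icc_eq_integral_Ioc, ← integral_of_le (by norm_num),
      ← integral_add_adjacent_intervals h1 h0]
    have h2 : ∫ ξ in (-2 : ℝ)..0, w ξ = ∫ ξ in (0 : ℝ)..2, w ξ := by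
      have := integral_comp_neg (a := (0 : ℝ)) (b := 2) w
      simp only [hw, neg_zero] at this
      exact this.symm
    rw [h2, integral_of_le (by norm_num)]
    linarith
  have hmaj : ∀ᵐ ξ : ℝ, ‖kernelFun ψ α δ R τ x y ξ‖ ≤
      (Icc (-2 : ℝ) 2).indicator (fun ξ => 54 / √|τ| * w ξ) ξ := by
    filter_upwards [compl_mem_ae_iff.2 (measure_singleton (0 : ℝ))] with ξ hξ
    have hξ : ξ ≠ 0 := hξ
    by_cases hz : ψ ξ = 0
    · simp only [kernelFun, hz, Complex.ofReal_zero, zero_mul, norm_zero]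
      exact indicator_nonneg (fun u _ => by positivity) _
    have hξ2 := hsupp ξ hz
    rw [indicator_of_mem (show ξ ∈ Icc (-2 : ℝ) 2 from abs_le.1 hξ2), kernelFun, norm_mul, norm_mul,
      norm_exp_I_mul, one_mul,
      Complex.norm_real]
    have h1 := norm_sectionInt_le hα.1 hδ hτ hξ hξ2 hR y
    have h2 : 54 / √|τ * ξ| = 54 / √|τ| * w ξ := by
      rw [abs_mul, Real.sqrt_mul (abs_nonneg _)]
      simp only [w]
      rw [Real.rpow_neg (abs_nonneg _), ← Real.sqrt_eq_rpow]
      rw [div_mul_eq_div_div, div_eq_mul_inv (54 / √|τ|)]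
    rw [← h2]
    calc _ ≤ 1 * (54 / √|τ * ξ|) := mul_le_mul (hψ ξ) h1 (norm_nonneg _) zero_le_one
      _ = _ := one_mul _
  have iw' : IntegrableOn (fun ξ => 54 / √|τ| * w ξ) (Icc (-2) 2) := Integrable.const_mul iw _
  calc _ ≤ ∫ ξ, (Icc (-2 : ℝ) 2).indicator (fun ξ => 54 / √|τ| * w ξ) ξ :=
        norm_integral_le_of_norm_le (iw'.integrable_indicator measurableSet_Icc) hmaj
    _ = 54 / √|τ| * ∫ ξ in Icc (-2 : ℝ) 2, w ξ := by
        rw [MeasureTheory.integral_indicator measurableSet_Icc, MeasureTheory.integral_const_mul]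
    _ ≤ 54 / √|τ| * 8 := by gcongr
    _ ≤ 500 / √|τ| := by
        rw [div_mul_eq_mul_div]
        exact div_le_div_of_nonneg_right (by norm_num) (Real.sqrt_nonneg _)

/-- The critical region is invariant under (ξ, μ) ↦ (Nξ, N^{α/2}μ); only the truncation R is
rescaled. Under the same map ω is homogeneous of degree α + 1, so the frequency-N kernel is a
rescaled unit-frequency kernel. -/
theorem mul_mem_ncSection_iff {N : ℝ} (hN : 0 < N) (R ξ μ : ℝ) :
    N ^ (α / 2) * μ ∈ ncSection α δ R (N * ξ) ↔ μ ∈ ncSection α δ (R / N ^ (α / 2)) ξ := by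
  have hp : 0 < N ^ (α / 2) := Real.rpow_pos_of_pos hN _
  have hq : 0 < N ^ α := Real.rpow_pos_of_pos hN _
  simp only [ncSection, critRegion, mem_ofPred_eq]
  rw [abs_mul, abs_of_pos hp, mul_comm, ← le_div_iff₀ hp, abs_mul, abs_of_pos hN,
    Real.mul_rpow hN.le (abs_nonneg _), mul_pow, rpow_half_sq α hN.le]
  have e1 : ∀ k : ℝ, k * (N ^ α * |ξ| ^ α) = N ^ α * (k * |ξ| ^ α) := fun k => by ring
  rw [e1, e1, mul_le_mul_iff_right₀ hq, mul_le_mul_iff_right₀ hq]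

theorem sectionInt_mul {N : ℝ} (hN : 0 < N) (R τ y ξ : ℝ) :
    sectionInt α δ R τ y (N * ξ) = (N ^ (α / 2) : ℝ) *
      sectionInt α δ (R / N ^ (α / 2)) (N ^ (α + 1) * τ) (N ^ (α / 2) * y) ξ := by
  have hp : 0 < N ^ (α / 2) := Real.rpow_pos_of_pos hN _
  rw [sectionInt, sectionInt, ← MeasureTheory.integral_indicator (measurableSet_ncSection _ _ _ _),
    ← MeasureTheory.integral_indicator (measurableSet_ncSection _ _ _ _)]
  set g := (ncSection α δ R (N * ξ)).indicator fun μ : ℝ =>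
    Complex.exp (Complex.I * (y * μ + τ * (N * ξ * μ ^ 2) : ℝ)) with hg
  have h := Measure.integral_comp_mul_left g (N ^ (α / 2))
  have e : ∀ μ, g (N ^ (α / 2) * μ) = (ncSection α δ (R / N ^ (α / 2)) ξ).indicator (fun μ : ℝ =>
      Complex.exp (Complex.I * (N ^ (α / 2) * y * μ + N ^ (α + 1) * τ * (ξ * μ ^ 2) : ℝ))) μ := by
    intro μ
    by_cases hμ : μ ∈ ncSection α δ (R / N ^ (α / 2)) ξ
    · rw [indicator_of_mem hμ, hg, indicator_of_mem ((mul_mem_ncSection_iff hN R ξ μ).2 hμ),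
        mul_pow, rpow_half_sq α hN.le, Real.rpow_add_one hN.ne']
      congr 3
      ring
    · rw [indicator_of_notMem hμ, hg,
        indicator_of_notMem (fun h' => hμ ((mul_mem_ncSection_iff hN R ξ μ).1 h'))]
  simp_rw [e] at h
  rw [h, abs_of_pos (inv_pos.2 hp), Complex.real_smul, ← mul_assoc, ← Complex.ofReal_mul,
    mul_inv_cancel₀ hp.ne', Complex.ofReal_one, one_mul]

theorem integral_kernelFun_scale {N : ℝ} (hN : 0 < N) (ψ : ℝ → ℝ) (R τ x y : ℝ) :
    ∫ ξ, kernelFun (fun ξ => ψ (ξ / N)) α δ R τ x y ξ = (N ^ (1 + α / 2) : ℝ) *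
      ∫ ξ, kernelFun ψ α δ (R / N ^ (α / 2)) (N ^ (α + 1) * τ) (N * x) (N ^ (α / 2) * y) ξ := by
  have h := Measure.integral_comp_mul_left
    (kernelFun (fun ξ => ψ (ξ / N)) α δ R τ x y) N
  have e : ∀ ξ, kernelFun (fun ξ => ψ (ξ / N)) α δ R τ x y (N * ξ) = (N ^ (α / 2) : ℝ) *
      kernelFun ψ α δ (R / N ^ (α / 2)) (N ^ (α + 1) * τ) (N * x) (N ^ (α / 2) * y) ξ := by
    intro ξ
    have e2 : x * (N * ξ) + τ * (N * ξ * |N * ξ| ^ α) =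
        N * x * ξ + N ^ (α + 1) * τ * (ξ * |ξ| ^ α) := by
      rw [abs_mul, abs_of_pos hN, Real.mul_rpow hN.le (abs_nonneg _), Real.rpow_add_one hN.ne']
      ring
    rw [kernelFun, kernelFun, sectionInt_mul hN, mul_div_cancel_left₀ _ hN.ne', e2]
    ring
  simp_rw [e] at h
  rw [MeasureTheory.integral_const_mul, abs_of_pos (inv_pos.2 hN), Complex.real_smul] at h
  rw [Real.rpow_add hN, Real.rpow_one, Complex.ofReal_mul, mul_assoc, h, ← mul_assoc,
    ← Complex.ofReal_mul, mul_inv_cancel₀ hN.ne', Complex.ofReal_one, one_mul]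

end kernel

end BOZK

/-! ### Riesz–Thorin interpolation for finite sums, via the three-lines theorem. -/

namespace BOZK
open Set

theorem norm_ofReal_cpow {a : ℝ} (ha : 0 < a) (z : ℂ) : ‖(a : ℂ) ^ z‖ = a ^ z.re :=
  Complex.norm_cpow_eq_rpow_re_of_pos ha z

/-- Riesz–Thorin interpolation between `ℓ² × ℓ²` and `ℓ¹ × ℓ¹` for a bilinear form on weighted
finite sequence spaces, evaluated at normalized positive sequences. -/
theorem norm_bilin_le_rpow {ι κ : Type*} [Fintype ι] [Fintype κ] (b : ι → κ → ℂ) (m : ι → ℝ)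
    (n : κ → ℝ) {D θ : ℝ} (hD : 0 ≤ D) (hθ : θ ∈ Ioo (0 : ℝ) 1)
    (hn : ∀ j, 0 ≤ n j)
    (h2 : ∀ (c : ι → ℂ) (d : κ → ℂ), ‖∑ i, ∑ j, c i * d j * b i j‖ ^ 2 ≤
      (∑ i, m i * ‖c i‖ ^ 2) * ∑ j, n j * ‖d j‖ ^ 2)
    (h1 : ∀ (c : ι → ℂ) (d : κ → ℂ), ‖∑ i, ∑ j, c i * d j * b i j‖ ≤
      D * ((∑ i, m i * ‖c i‖) * ∑ j, n j * ‖d j‖))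
    {f : ι → ℝ} {g : κ → ℝ} (hf0 : ∀ i, 0 < f i) (hg0 : ∀ j, 0 < g j)
    (hf : ∑ i, m i * f i ^ (2 / (1 + θ)) ≤ 1) (hg : ∑ j, n j * g j ^ (2 / (1 + θ)) ≤ 1) :
    ‖∑ i, ∑ j, (f i : ℂ) * g j * b i j‖ ≤ D ^ θ := by
  have h1θ : 0 < 1 + θ := by linarith [hθ.1]
  -- The exponent equals 1 at z = θ. On Re z = 0 the squared moduli, and on Re z = 1 the moduli
  -- themselves, are f^{2/(1+θ)}, so a single normalization serves both boundary lines.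
  set e : ℂ → ℂ := fun z => (1 + z) / (1 + θ) with he
  have ere : ∀ z : ℂ, (e z).re = (1 + z.re) / (1 + θ) := fun z => by
    have : e z = (1 + z) / ((1 + θ : ℝ) : ℂ) := by simp [he]
    rw [this, Complex.div_ofReal_re]
    simp
  set F : ℂ → ℂ := fun z => ∑ i, ∑ j, (f i : ℂ) ^ e z * (g j : ℂ) ^ e z * b i j with hF
  have hfne : ∀ i, (f i : ℂ) ≠ 0 := fun i => by exact_mod_cast (hf0 i).ne'
  have hgne : ∀ j, (g j : ℂ) ≠ 0 := fun j => by exact_mod_cast (hg0 j).ne'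
  have de : Differentiable ℂ e := by fun_prop
  have dF : Differentiable ℂ F := by
    refine Differentiable.fun_sum fun i _ => Differentiable.fun_sum fun j _ => ?_
    exact ((de.const_cpow (Or.inl (hfne i))).mul (de.const_cpow (Or.inl (hgne j)))).mul_const _
  have hbdd : BddAbove ((norm ∘ F) '' Complex.HadamardThreeLines.verticalClosedStrip 0 1) := by
    set K : ℝ → ℝ := fun t => max 1 (t ^ (2 / (1 + θ))) with hK
    have pw : ∀ t : ℝ, 0 < t → ∀ z ∈ Complex.HadamardThreeLines.verticalClosedStrip 0 1,
        ‖(t : ℂ) ^ e z‖ ≤ K t := by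
      intro t ht z hz
      have hz : z.re ∈ Icc (0 : ℝ) 1 := hz
      rw [norm_ofReal_cpow ht, ere]
      have hle : (1 + z.re) / (1 + θ) ≤ 2 / (1 + θ) := by gcongr; linarith [hz.2]
      rcases le_total 1 t with h | h
      · exact (Real.rpow_le_rpow_of_exponent_le h hle).trans (le_max_right _ _)
      · exact (Real.rpow_le_one ht.le h (div_nonneg (by linarith [hz.1]) h1θ.le)).trans
          (le_max_left _ _)
    refine ⟨∑ i, ∑ j, K (f i) * K (g j) * ‖b i j‖, ?_⟩
    rintro _ ⟨z, hz, rfl⟩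
    refine (norm_sum_le _ _).trans (Finset.sum_le_sum fun i _ =>
      (norm_sum_le _ _).trans (Finset.sum_le_sum fun j _ => ?_))
    rw [norm_mul, norm_mul]
    have k1 := pw (f i) (hf0 i) z hz
    have k2 := pw (g j) (hg0 j) z hz
    have : 0 ≤ K (f i) := zero_le_one.trans (le_max_left _ _)
    gcongr
  have hsq : ∀ (t s : ℝ), 0 < t → (t ^ s) ^ 2 = t ^ (2 * s) := fun t s ht => by
    rw [← Real.rpow_natCast, ← Real.rpow_mul ht.le, mul_comm]; norm_num
  have hleft : ∀ z ∈ Complex.re ⁻¹' {0}, ‖F z‖ ≤ 1 := by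
    intro z hz
    have hz : z.re = 0 := hz
    have := h2 (fun i => (f i : ℂ) ^ e z) (fun j => (g j : ℂ) ^ e z)
    simp only [fun i => norm_ofReal_cpow (hf0 i), fun j => norm_ofReal_cpow (hg0 j), ere, hz,
      add_zero, fun i => hsq (f i) (1 / (1 + θ)) (hf0 i),
      fun j => hsq (g j) (1 / (1 + θ)) (hg0 j), mul_one_div] at this
    have h3 : ‖F z‖ ^ 2 ≤ 1 := this.trans (mul_le_one₀ hf
      (Finset.sum_nonneg fun j _ => mul_nonneg (hn j) (Real.rpow_nonneg (hg0 j).le _)) hg)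
    exact (sq_le_one_iff₀ (norm_nonneg _)).1 h3
  have hright : ∀ z ∈ Complex.re ⁻¹' {1}, ‖F z‖ ≤ D := by
    intro z hz
    have hz : z.re = 1 := hz
    have := h1 (fun i => (f i : ℂ) ^ e z) (fun j => (g j : ℂ) ^ e z)
    simp only [fun i => norm_ofReal_cpow (hf0 i), fun j => norm_ofReal_cpow (hg0 j), ere, hz,
      one_add_one_eq_two] at this
    exact this.trans (mul_le_of_le_one_right hD (mul_le_one₀ hf
      (Finset.sum_nonneg fun j _ => mul_nonneg (hn j) (Real.rpow_nonneg (hg0 j).le _)) hg))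
  have hmem : (θ : ℂ) ∈ Complex.HadamardThreeLines.verticalClosedStrip 0 1 := by
    change (θ : ℂ).re ∈ Icc (0 : ℝ) 1
    exact ⟨hθ.1.le, hθ.2.le⟩
  have := Complex.HadamardThreeLines.norm_le_interp_of_mem_verticalClosedStrip₀₁' F hmem
    dF.diffContOnCl hbdd hleft hright
  have eθ : e θ = 1 := by
    simp only [he]
    rw [div_self]
    exact_mod_cast h1θ.ne'
  simpa [hF, eθ] using this

end BOZK

/-! ### Fourier multipliers from L¹ to L^∞, in bilinear form. -/

namespace BOZK
open Set

/-- The Fourier transform on `L²` agrees with the Fourier integral on `L¹ ∩ L²`. -/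
theorem fourier_toLp_ae_eq {f : Plane → ℂ} (h1 : Integrable f) (h2 : MemLp f 2 volume) :
    (𝓕 (h2.toLp f : L2) : L2) =ᵐ[volume] 𝓕 f := by
  have hc : Continuous (𝓕 f) := VectorFourier.fourierIntegral_continuous
    Real.continuous_fourierChar continuous_inner h1
  refine ae_eq_of_integral_contDiff_smul_eq
    ((Lp.memLp _).locallyIntegrable (by norm_num)) hc.locallyIntegrable fun g hg hs => ?_
  have hs' : HasCompactSupport fun x => (g x : ℂ) := hs.comp_left Complex.ofReal_zero
  set G : SchwartzMap Plane ℂ := hs'.toSchwartzMap (Complex.ofRealCLM.contDiff.comp hg) with hG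
  have hGv : ∀ x, G x = g x := fun x => rfl
  have e1 : ∫ x, g x • (𝓕 (h2.toLp f : L2) : L2) x = ∫ x, (𝓕 G) x • f x := by
    have := congrArg (fun T : TemperedDistribution Plane ℂ => T G)
      (Lp.fourier_toTemperedDistribution_eq (h2.toLp f : L2))
    simp only [TemperedDistribution.fourier_apply, Lp.toTemperedDistribution_apply] at this
    rw [integral_congr_ae (g := fun x => (𝓕 G) x • f x)] at this
    · rw [this]
      simp only [hGv]
      rfl
    · filter_upwards [h2.coeFn_toLp] with x hx
      rw [hx]
  rw [e1]
  have := VectorFourier.integral_fourierIntegral_smul_eq_flip (L := innerₗ Plane)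
    (μ := volume) (ν := volume) Real.continuous_fourierChar continuous_inner h1 G.integrable
  rw [flip_innerₗ] at this
  calc ∫ x, (𝓕 G) x • f x = ∫ x, f x • (𝓕 (G : Plane → ℂ)) x := by
        congr 1; ext x; rw [smul_eq_mul, smul_eq_mul, mul_comm]; rfl
    _ = ∫ x, (𝓕 f) x • G x := this.symm
    _ = _ := by congr 1; ext x; rw [hGv, smul_eq_mul, mul_comm]; rfl

theorem norm_integral_mul_le_of_norm_le {f h : Plane → ℂ} {D : ℝ} (hf : Integrable f)
    (hh : ∀ x, ‖h x‖ ≤ D) : ‖∫ x, f x * h x‖ ≤ D * ∫ x, ‖f x‖ := by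
  rw [← MeasureTheory.integral_const_mul]
  refine norm_integral_le_of_norm_le (hf.norm.const_mul D) (Filter.Eventually.of_forall fun x => ?_)
  rw [norm_mul, mul_comm]
  exact mul_le_mul_of_nonneg_right (hh x) (norm_nonneg _)

theorem integral_fourier_mul_eq {f g : Plane → ℂ} (hf : Integrable f) (hg : Integrable g) :
    ∫ z, 𝓕 f z * g z = ∫ x, f x * 𝓕 g x := by
  have := VectorFourier.integral_fourierIntegral_smul_eq_flip (L := innerₗ Plane)
    (μ := volume) (ν := volume) Real.continuous_fourierChar continuous_inner hf hg
  rw [flip_innerₗ] at this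
  exact this

theorem norm_fourier_le_integral {f : Plane → ℂ} (z : Plane) : ‖𝓕 f z‖ ≤ ∫ x, ‖f x‖ :=
  VectorFourier.norm_fourierIntegral_le_integral_norm _ _ _ _ _

theorem continuous_fourier_of_integrable {f : Plane → ℂ} (h1 : Integrable f) :
    Continuous (𝓕 f) := VectorFourier.fourierIntegral_continuous
    Real.continuous_fourierChar continuous_inner h1

theorem norm_integral_fourier_mul_le {f k : Plane → ℂ} {D : ℝ} (hf : Integrable f)
    (hk : Integrable k) (hD : ∀ v, ‖𝓕 k v‖ ≤ D) :
    ‖∫ z, 𝓕 f z * k z‖ ≤ D * ∫ x, ‖f x‖ := by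
  rw [integral_fourier_mul_eq hf hk]
  exact norm_integral_mul_le_of_norm_le hf hD

/-- A Fourier multiplier whose symbol has bounded Fourier transform maps `L¹` to `L^∞`. -/
theorem norm_integral_fourier_bilin_le_of_integrable {f g k : Plane → ℂ} {D : ℝ}
    (hf : Integrable f) (hg : Integrable g) (hk : Integrable k) (hD : ∀ v, ‖𝓕 k v‖ ≤ D) :
    ‖∫ z, (starRingEnd ℂ) (𝓕 f z) * (k z * 𝓕 g z)‖ ≤ D * (∫ x, ‖f x‖) * ∫ x, ‖g x‖ := by
  -- The multiplication formula is used twice. First 𝓕 moves off g, leaving a bound for 𝓕 h to be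
  -- found. Then 𝓕 h v is the conjugate of ∫ 𝓕 f · k′, with k′ the conjugate of a modulation of k,
  -- and 𝓕 moves off f. Modulation only translates 𝓕 k, so the bound D survives.
  set h : Plane → ℂ := fun z => (starRingEnd ℂ) (𝓕 f z) * k z with hh
  have cf := continuous_fourier_of_integrable hf
  have hi_int : Integrable h := by
    refine Integrable.bdd_mul (c := ∫ x, ‖f x‖) hk
      (Complex.continuous_conj.comp cf).aestronglyMeasurable (Filter.Eventually.of_forall fun z => ?_)
    rw [Complex.norm_conj]
    exact norm_fourier_le_integral z
  have e : ∀ z, (starRingEnd ℂ) (𝓕 f z) * (k z * 𝓕 g z) = 𝓕 g z * h z := fun z => by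
    rw [hh]; ring
  simp_rw [e]
  refine norm_integral_fourier_mul_le hg hi_int fun v => ?_
  set k' : Plane → ℂ := fun z =>
    (starRingEnd ℂ) (Complex.exp (((-2 * Real.pi * inner ℝ z v : ℝ) : ℂ) * Complex.I) * k z)
  have hunit : ∀ t : ℝ, ‖Complex.exp ((t : ℂ) * Complex.I)‖ = 1 := Complex.norm_exp_ofReal_mul_I
  have hk' : Integrable k' := by
    have : Integrable fun z => Complex.exp (((-2 * Real.pi * inner ℝ z v : ℝ) : ℂ) * Complex.I) * k z :=
      Integrable.bdd_mul (c := 1) hk (Continuous.aestronglyMeasurable (by fun_prop))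
        (Filter.Eventually.of_forall fun z => (hunit _).le)
    exact Complex.conjCLE.toContinuousLinearMap.integrable_comp this
  have hbD : ∀ w, ‖𝓕 k' w‖ ≤ D := fun w => by
    refine le_trans (le_of_eq ?_) (hD (v - w))
    rw [Real.fourier_eq', Real.fourier_eq', ← Complex.norm_conj, ← integral_conj]
    congr 2
    ext z
    simp only [k', smul_eq_mul, map_mul, Complex.conj_conj]
    rw [← mul_assoc, ← Complex.exp_conj, ← Complex.exp_add]
    congr 2
    simp only [map_mul, Complex.conj_ofReal, Complex.conj_I, inner_sub_right]
    push_cast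
    ring
  have e2 : 𝓕 h v = (starRingEnd ℂ) (∫ z, 𝓕 f z * k' z) := by
    rw [Real.fourier_eq', ← integral_conj]
    congr 1
    ext z
    simp only [hh, k', smul_eq_mul, map_mul, Complex.conj_conj]
    ring
  rw [e2, Complex.norm_conj]
  exact norm_integral_fourier_mul_le hf hk' hbD

/-- The truncation of a symbol to bounded second frequency. -/
noncomputable def truncSymbol (k : Plane → ℂ) (R : ℝ) (z : Plane) : ℂ :=
  {z : Plane | |2 * Real.pi * z 1| ≤ R}.indicator k z

/-- The symbol need not be integrable, being unrestricted in the second frequency. It is truncated,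
and since D does not depend on R, dominated convergence with the majorant |𝓕 f||𝓕 g| removes the
truncation. -/
theorem norm_integral_fourier_bilin_le {f g k : Plane → ℂ} {D R₀ : ℝ} (hf : Integrable f)
    (hg : Integrable g) (hf2 : MemLp (𝓕 f) 2 volume) (hg2 : MemLp (𝓕 g) 2 volume)
    (hkm : Measurable k) (hk1 : ∀ z, ‖k z‖ ≤ 1)
    (hk : ∀ R, R₀ ≤ R → Integrable (truncSymbol k R) ∧ ∀ v, ‖𝓕 (truncSymbol k R) v‖ ≤ D) :
    ‖∫ z, (starRingEnd ℂ) (𝓕 f z) * (k z * 𝓕 g z)‖ ≤ D * (∫ x, ‖f x‖) * ∫ x, ‖g x‖ := by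
  have hms : ∀ R, MeasurableSet {z : Plane | |2 * Real.pi * z 1| ≤ R} := fun R =>
    measurableSet_le (by fun_prop) measurable_const
  have hcf := (Complex.continuous_conj.comp (continuous_fourier_of_integrable hf))
  have hcg := continuous_fourier_of_integrable hg
  have hlim : Filter.Tendsto
      (fun R : ℝ => ∫ z, (starRingEnd ℂ) (𝓕 f z) * (truncSymbol k R z * 𝓕 g z)) Filter.atTop
      (nhds (∫ z, (starRingEnd ℂ) (𝓕 f z) * (k z * 𝓕 g z))) := by
    refine tendsto_integral_filter_of_dominated_convergence (fun z => ‖𝓕 f z‖ * ‖𝓕 g z‖) ?_ ?_ ?_ ?_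
    · refine Filter.Eventually.of_forall fun R => ?_
      exact (hcf.measurable.mul ((hkm.indicator (hms R)).mul hcg.measurable)).aestronglyMeasurable
    · refine Filter.Eventually.of_forall fun R => Filter.Eventually.of_forall fun z => ?_
      rw [norm_mul, norm_mul, Complex.norm_conj]
      have : ‖truncSymbol k R z‖ ≤ 1 := (norm_indicator_le_norm_self _ _).trans (hk1 z)
      calc _ ≤ ‖𝓕 f z‖ * (1 * ‖𝓕 g z‖) := by gcongr
        _ = _ := by ring
    · exact hf2.norm.integrable_mul hg2.norm
    · refine Filter.Eventually.of_forall fun z => tendsto_const_nhds.congr' ?_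
      filter_upwards [Filter.eventually_ge_atTop |2 * Real.pi * z 1|] with R hR
      rw [truncSymbol, indicator_of_mem (show z ∈ {z : Plane | |2 * Real.pi * z 1| ≤ R} from hR)]
  refine le_of_tendsto hlim.norm ?_
  filter_upwards [Filter.eventually_ge_atTop R₀] with R hR
  exact norm_integral_fourier_bilin_le_of_integrable hf hg (hk R hR).1 (hk R hR).2

theorem measurePreserving_plane : MeasurePreserving
    (fun z : Plane => ((z 0, z 1) : ℝ × ℝ)) volume volume :=
  (volume_preserving_finTwoArrow ℝ).comp (PiLp.volume_preserving_ofLp (Fin 2))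

theorem measurableEmbedding_plane :
    MeasurableEmbedding (fun z : Plane => ((z 0, z 1) : ℝ × ℝ)) :=
  (MeasurableEquiv.finTwoArrow.measurableEmbedding).comp
    (MeasurableEquiv.toLp 2 (Fin 2 → ℝ)).symm.measurableEmbedding

/-- The Fourier transform of a symbol given in frequency coordinates. -/
theorem fourier_symbol_eq {q : ℝ × ℝ → ℂ} (hq : Integrable q) (v : Plane) :
    𝓕 (fun z : Plane => q (2 * Real.pi * z 0, 2 * Real.pi * z 1)) v =
      (((2 * Real.pi) ^ 2)⁻¹ : ℝ) * ∫ ξ : ℝ, ∫ μ : ℝ,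
        Complex.exp (Complex.I * (-v 0 * ξ + -v 1 * μ : ℝ)) * q (ξ, μ) := by
  set h : ℝ × ℝ → ℂ := fun p => Complex.exp (Complex.I * (-v 0 * p.1 + -v 1 * p.2 : ℝ)) * q p
  have hh : Integrable h := Integrable.bdd_mul (c := 1) hq
    (Continuous.aestronglyMeasurable (by fun_prop))
    (Filter.Eventually.of_forall fun z => (norm_exp_I_mul _).le)
  have e : ∀ z : Plane, Complex.exp (((-2 * Real.pi * inner ℝ z v : ℝ) : ℂ) * Complex.I) •
      q (2 * Real.pi * z 0, 2 * Real.pi * z 1) =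
      (fun p : ℝ × ℝ => h ((2 * Real.pi) • p)) (z 0, z 1) := by
    intro z
    simp only [h, Prod.smul_mk, smul_eq_mul]
    congr 2
    rw [mul_comm, EuclideanSpace.inner_eq_star_dotProduct]
    congr 2
    simp [dotProduct, Fin.sum_univ_two]
    ring
  rw [Real.fourier_eq']
  simp_rw [e]
  rw [measurePreserving_plane.integral_comp measurableEmbedding_plane
    (fun p : ℝ × ℝ => h ((2 * Real.pi) • p)), Measure.integral_comp_smul,
    Module.finrank_prod, Module.finrank_self, Complex.real_smul, Measure.volume_eq_prod,
    integral_prod _ hh, abs_of_nonneg (by positivity)]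

/-- The symbol of the square of the localized flow between two times. -/
noncomputable def flowSymbol (ψ : ℝ → ℝ) (α δ τ : ℝ) (p : ℝ × ℝ) : ℂ :=
  ψ p.1 * (critRegion α δ)ᶜ.indicator (fun _ => (1 : ℂ)) p *
    Complex.exp (Complex.I * (τ * omega α p.1 p.2 : ℝ))

section symbol

variable {ψ : ℝ → ℝ} {α δ τ : ℝ}

theorem measurable_flowSymbol (hψ : Measurable ψ) : Measurable (flowSymbol ψ α δ τ) := by
  unfold flowSymbol omega
  refine Measurable.mul (Measurable.mul (by fun_prop) ?_) (by fun_prop)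
  exact measurable_const.indicator (measurableSet_critRegion α δ).compl

theorem norm_flowSymbol_le (hψ : ∀ ξ, |ψ ξ| ≤ 1) (p : ℝ × ℝ) : ‖flowSymbol ψ α δ τ p‖ ≤ 1 := by
  rw [flowSymbol, norm_mul, norm_exp_I_mul, mul_one, norm_mul, Complex.norm_real]
  refine mul_le_one₀ (hψ _) (norm_nonneg _) ?_
  by_cases h : p ∈ (critRegion α δ)ᶜ <;> simp [h]

theorem integrable_flowSymbol_trunc (hm : Measurable ψ) (hψ : ∀ ξ, |ψ ξ| ≤ 1) {L : ℝ}
    (hsupp : ∀ ξ, ψ ξ ≠ 0 → |ξ| ≤ L) (R : ℝ) :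
    Integrable ({p : ℝ × ℝ | |p.2| ≤ R}.indicator (flowSymbol ψ α δ τ)) := by
  have hset : MeasurableSet {p : ℝ × ℝ | |p.2| ≤ R} := measurableSet_le (by fun_prop) measurable_const
  have hfin : volume (Icc (-L) L ×ˢ Icc (-R) R) ≠ ⊤ :=
    (isCompact_Icc.prod isCompact_Icc).measure_lt_top.ne
  have hmS : MeasurableSet (Icc (-L) L ×ˢ Icc (-R) R) := measurableSet_Icc.prod measurableSet_Icc
  refine Integrable.mono' ((integrable_indicator_iff hmS).2 (integrableOn_const (C := (1 : ℝ)) hfin))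
    ((measurable_flowSymbol hm).indicator hset).aestronglyMeasurable
    (Filter.Eventually.of_forall fun p => ?_)
  by_cases hp : p ∈ {p : ℝ × ℝ | |p.2| ≤ R}
  · rw [indicator_of_mem hp]
    by_cases hz : ψ p.1 = 0
    · rw [flowSymbol, hz]
      simp only [Complex.ofReal_zero, zero_mul, norm_zero]
      exact indicator_nonneg (fun _ _ => zero_le_one) _
    · have : p ∈ Icc (-L) L ×ˢ Icc (-R) R := ⟨abs_le.1 (hsupp _ hz), abs_le.1 hp⟩
      rw [indicator_of_mem this]
      exact norm_flowSymbol_le hψ p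
  · rw [indicator_of_notMem hp, norm_zero]
    exact indicator_nonneg (fun _ _ => zero_le_one) _

theorem integral_flowSymbol_trunc (R x y : ℝ) :
    ∫ ξ, ∫ μ, Complex.exp (Complex.I * (x * ξ + y * μ : ℝ)) *
      {p : ℝ × ℝ | |p.2| ≤ R}.indicator (flowSymbol ψ α δ τ) (ξ, μ) =
      ∫ ξ, kernelFun ψ α δ R τ x y ξ := by
  congr 1
  ext ξ
  rw [kernelFun, sectionInt, ← integral_indicator (measurableSet_ncSection α δ R ξ),
    ← MeasureTheory.integral_const_mul, ← MeasureTheory.integral_const_mul]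
  congr 1
  ext μ
  by_cases h1 : |μ| ≤ R
  · rw [indicator_of_mem (show (ξ, μ) ∈ {p : ℝ × ℝ | |p.2| ≤ R} from h1), flowSymbol]
    by_cases h2 : (ξ, μ) ∈ critRegion α δ
    · rw [indicator_of_notMem (show (ξ, μ) ∉ (critRegion α δ)ᶜ from fun h => h h2),
        indicator_of_notMem (show μ ∉ ncSection α δ R ξ from fun h => h.2 h2)]
      simp
    · rw [indicator_of_mem (show (ξ, μ) ∈ (critRegion α δ)ᶜ from h2),
        indicator_of_mem (show μ ∈ ncSection α δ R ξ from ⟨h1, h2⟩), mul_one,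
        mul_left_comm, ← Complex.exp_add, ← Complex.exp_add, ← mul_add, ← mul_add,
        ← Complex.ofReal_add, ← Complex.ofReal_add]
      congr 4
      simp only [omega]
      ring
  · rw [indicator_of_notMem (show (ξ, μ) ∉ {p : ℝ × ℝ | |p.2| ≤ R} from h1),
      indicator_of_notMem (show μ ∉ ncSection α δ R ξ from fun h => h1 h.1)]
    simp

/-- Dispersive estimate in bilinear form, given a bound for the truncated kernels. -/
theorem norm_integral_flowSymbol_le (hm : Measurable ψ) (hψ : ∀ ξ, |ψ ξ| ≤ 1) {L : ℝ}
    (hsupp : ∀ ξ, ψ ξ ≠ 0 → |ξ| ≤ L) {D R₀ : ℝ}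
    (hD : ∀ R, R₀ ≤ R → ∀ x y, ‖∫ ξ, kernelFun ψ α δ R τ x y ξ‖ ≤ D) {f g : Plane → ℂ}
    (hf : Integrable f) (hg : Integrable g) (hf2 : MemLp (𝓕 f) 2 volume)
    (hg2 : MemLp (𝓕 g) 2 volume) :
    ‖∫ z : Plane, (starRingEnd ℂ) (𝓕 f z) *
      (flowSymbol ψ α δ τ (2 * Real.pi * z 0, 2 * Real.pi * z 1) * 𝓕 g z)‖ ≤
      D * (∫ x, ‖f x‖) * ∫ x, ‖g x‖ := by
  refine norm_integral_fourier_bilin_le (R₀ := R₀) hf hg hf2 hg2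
    ((measurable_flowSymbol hm).comp (by fun_prop)) (fun z => norm_flowSymbol_le hψ _)
    fun R hR => ?_
  set q := {p : ℝ × ℝ | |p.2| ≤ R}.indicator (flowSymbol ψ α δ τ) with hq
  have hqi : Integrable q := integrable_flowSymbol_trunc hm hψ hsupp R
  have e : truncSymbol (fun z : Plane => flowSymbol ψ α δ τ (2 * Real.pi * z 0, 2 * Real.pi * z 1))
      R = fun z : Plane => q (2 * Real.pi * z 0, 2 * Real.pi * z 1) := rfl
  rw [e]
  refine ⟨?_, fun v => ?_⟩
  · have := (hqi.comp_smul (R := (2 * Real.pi)) (by positivity))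
    exact measurePreserving_plane.integrable_comp_of_integrable this
  · rw [fourier_symbol_eq hqi, integral_flowSymbol_trunc, norm_mul]
    have h1 : ‖((((2 * Real.pi) ^ 2)⁻¹ : ℝ) : ℂ)‖ ≤ 1 := by
      rw [Complex.norm_real, Real.norm_of_nonneg (by positivity)]
      apply inv_le_one_of_one_le₀
      have := Real.pi_gt_three
      nlinarith
    have h2 := hD R hR (-v 0) (-v 1)
    calc _ ≤ 1 * D := mul_le_mul h1 h2 (norm_nonneg _) zero_le_one
      _ = D := one_mul D

end symbol

end BOZK

/-! ### Test functions with finitely many levels, and interpolation of sesquilinear forms on them.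
-/

namespace BOZK
open Set
open scoped NNReal

theorem norm_sq_eq_integral (f : L2) : ‖f‖ ^ 2 = ∫ x, ‖f x‖ ^ 2 := by
  have h : ((‖f‖ ^ 2 : ℝ) : ℂ) = ((∫ x, ‖f x‖ ^ 2 : ℝ) : ℂ) := by
    have := inner_self_eq_norm_sq_to_K (𝕜 := ℂ) f
    rw [L2.inner_def] at this
    simp only [inner_self_eq_norm_sq_to_K] at this
    rw [Complex.ofReal_pow]
    refine this.symm.trans ?_
    rw [← integral_complex_ofReal]
    congr 1
    ext x
    push_cast
    rfl
  exact_mod_cast h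

/-- Finite-level functions with modulus normalized in `L^r`. -/
def IsTest (r : ℝ) (φ : L2) : Prop :=
  ∃ (s : SimpleFunc Plane ℝ≥0) (σ : Plane → ℂ), Measurable σ ∧ (∀ x, ‖σ x‖ ≤ 1) ∧
    s.FinMeasSupp volume ∧ ∫⁻ x, (s x : ℝ≥0∞) ^ r ≤ 1 ∧
    φ =ᵐ[volume] fun x => ((s x : ℝ) : ℂ) * σ x

/-- Decomposition of a test function along its level sets. -/
theorem IsTest.exists_levels {r : ℝ} (hr : 0 < r) {φ : L2} (hφ : IsTest r φ) :
    ∃ (ι : Finset ℝ≥0) (e : ι → L2) (m a : ι → ℝ), (∀ i, 0 ≤ m i) ∧ (∀ i, 0 < a i) ∧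
      ∑ i, m i * a i ^ r ≤ 1 ∧ φ = ∑ i, (a i : ℂ) • e i ∧ ∀ c : ι → ℂ,
        ‖∑ i, c i • e i‖ ^ 2 ≤ ∑ i, m i * ‖c i‖ ^ 2 ∧
        Integrable (∑ i, c i • e i : L2) ∧
        ∫ x, ‖(∑ i, c i • e i : L2) x‖ ≤ ∑ i, m i * ‖c i‖ := by
  obtain ⟨s, σ, hσ, hσ1, hs, hr1, hφ⟩ := hφ
  -- Discarding the value 0 leaves level sets of finite measure and strictly positive heights, which
  -- can be raised to complex powers.
  set ι : Finset ℝ≥0 := s.range.erase 0 with hι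
  set E : ι → Set Plane := fun i => s ⁻¹' {(i : ℝ≥0)} with hE
  have i0 : ∀ i : ι, (i : ℝ≥0) ≠ 0 := fun i => (Finset.mem_erase.1 i.2).1
  have mE : ∀ i, MeasurableSet (E i) := fun i => s.measurableSet_fiber _
  have fE : ∀ i, volume (E i) ≠ ⊤ := fun i => (hs.meas_preimage_singleton_ne_zero (i0 i)).ne
  have hmem : ∀ i, MemLp ((E i).indicator σ) 2 volume := fun i =>
    (memLp_indicator_const 2 (mE i) (1 : ℝ) (Or.inr (fE i))).of_le
      (hσ.indicator (mE i)).aestronglyMeasurable (Filter.Eventually.of_forall fun x => by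
        by_cases hx : x ∈ E i
        · simpa [hx] using hσ1 x
        · simp [hx])
  -- The factor σ stays inside the vectors e i, so that interpolation only varies the positive
  -- heights.
  set e : ι → L2 := fun i => (hmem i).toLp _ with he
  set m : ι → ℝ := fun i => (volume (E i)).toReal with hm
  set H : (ι → ℂ) → Plane → ℂ := fun c x => ∑ i, c i * (E i).indicator σ x with hH
  have coe : ∀ c : ι → ℂ, (∑ i, c i • e i : L2) =ᵐ[volume] H c := by
    intro c
    have h2 : ∀ᵐ x, ∀ i, (c i • e i : L2) x = c i * (E i).indicator σ x := by
      rw [ae_all_iff]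
      intro i
      filter_upwards [Lp.coeFn_smul (c i) (e i), (hmem i).coeFn_toLp] with x h3 h4
      rw [h3, Pi.smul_apply, smul_eq_mul, ← h4]
    filter_upwards [Lp.coeFn_finsetSum Finset.univ fun i => c i • e i, h2] with x h1 h2
    rw [h1, Finset.sum_apply]
    exact Finset.sum_congr rfl fun i _ => h2 i
  have single : ∀ (c : ι → ℂ) x, (∀ i, x ∉ E i) ∧ H c x = 0 ∨
      ∃ i, x ∈ E i ∧ H c x = c i * σ x := by
    intro c x
    by_cases hx : ∃ i, x ∈ E i
    · obtain ⟨i, hi⟩ := hx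
      refine Or.inr ⟨i, hi, ?_⟩
      rw [hH]
      dsimp only
      rw [Finset.sum_eq_single i, indicator_of_mem hi]
      · intro j _ hj
        rw [indicator_of_notMem, mul_zero]
        intro hxj
        apply hj
        have h1 : s x = i := hi
        have h2 : s x = j := hxj
        exact Subtype.ext (h2.symm.trans h1)
      · intro h; exact absurd (Finset.mem_univ i) h
    · push Not at hx
      refine Or.inl ⟨hx, ?_⟩
      exact Finset.sum_eq_zero fun i _ => by rw [indicator_of_notMem (hx i), mul_zero]
  have bound : ∀ (c : ι → ℂ) (k : ℕ), k ≠ 0 → ∀ x, ‖H c x‖ ^ k ≤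
      ∑ i, ‖c i‖ ^ k * (E i).indicator (fun _ => (1 : ℝ)) x := by
    intro c k hk x
    have nn : ∀ i ∈ Finset.univ, 0 ≤ ‖c i‖ ^ k * (E i).indicator (fun _ => (1 : ℝ)) x :=
      fun i _ => mul_nonneg (by positivity) (indicator_nonneg (fun _ _ => zero_le_one) _)
    rcases single c x with ⟨_, h0⟩ | ⟨i, hi, h1⟩
    · rw [h0, norm_zero, zero_pow hk]
      exact Finset.sum_nonneg nn
    · refine le_trans ?_ (Finset.single_le_sum nn (Finset.mem_univ i))
      rw [h1, indicator_of_mem hi, mul_one, norm_mul]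
      refine pow_le_pow_left₀ (by positivity) ?_ k
      exact mul_le_of_le_one_right (norm_nonneg _) (hσ1 x)
  have ig : ∀ (c : ι → ℂ) (k : ℕ), Integrable fun x => ∑ i, ‖c i‖ ^ k *
      (E i).indicator (fun _ => (1 : ℝ)) x := fun c k =>
    integrable_finsetSum _ fun i _ =>
      ((integrable_indicator_iff (mE i)).2 (integrableOn_const (fE i))).const_mul _
  have vg : ∀ (c : ι → ℂ) (k : ℕ), ∫ x, ∑ i, ‖c i‖ ^ k *
      (E i).indicator (fun _ => (1 : ℝ)) x = ∑ i, m i * ‖c i‖ ^ k := fun c k => by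
    rw [integral_finsetSum _ fun i _ =>
      ((integrable_indicator_iff (mE i)).2 (integrableOn_const (fE i))).const_mul _]
    refine Finset.sum_congr rfl fun i _ => ?_
    rw [MeasureTheory.integral_const_mul, integral_indicator_const _ (mE i), smul_eq_mul, mul_one,
      mul_comm]
    rfl
  refine ⟨ι, e, m, fun i => ((i : ℝ≥0) : ℝ), fun i => ENNReal.toReal_nonneg,
    fun i => NNReal.coe_pos.2 (pos_iff_ne_zero.2 (i0 i)), ?_, ?_, fun c => ⟨?_, ?_, ?_⟩⟩
  · have h1 : ∫⁻ x, (s x : ℝ≥0∞) ^ r = ∑ t ∈ s.range, (t : ℝ≥0∞) ^ r * volume (s ⁻¹' {t}) := by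
      rw [← SimpleFunc.map_lintegral (fun t : ℝ≥0 => (t : ℝ≥0∞) ^ r) s,
        ← SimpleFunc.lintegral_eq_lintegral]
      rfl
    have h2 : ∑ i : ι, ((i : ℝ≥0) : ℝ≥0∞) ^ r * volume (E i) ≤ 1 := by
      refine le_trans ?_ (h1 ▸ hr1)
      rw [Finset.sum_coe_sort ι (fun t : ℝ≥0 => (t : ℝ≥0∞) ^ r * volume (s ⁻¹' {t}))]
      exact Finset.sum_le_sum_of_subset (Finset.erase_subset _ _)
    have h3 : ∑ i : ι, m i * ((i : ℝ≥0) : ℝ) ^ r =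
        (∑ i : ι, ((i : ℝ≥0) : ℝ≥0∞) ^ r * volume (E i)).toReal := by
      rw [ENNReal.toReal_sum fun i _ => ENNReal.mul_ne_top
        (ENNReal.rpow_ne_top_of_nonneg hr.le ENNReal.coe_ne_top) (fE i)]
      refine Finset.sum_congr rfl fun i _ => ?_
      rw [ENNReal.toReal_mul, ← ENNReal.toReal_rpow, ENNReal.coe_toReal, mul_comm]
    rw [h3]
    exact ENNReal.toReal_le_of_le_ofReal zero_le_one (by simpa using h2)
  · refine Lp.ext (hφ.trans (Filter.EventuallyEq.trans (Filter.Eventually.of_forall fun x => ?_)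
      (coe fun i => (((i : ℝ≥0) : ℝ) : ℂ)).symm))
    dsimp only
    rcases single (fun i => (((i : ℝ≥0) : ℝ) : ℂ)) x with ⟨h0, h1⟩ | ⟨i, hi, h1⟩
    · have : s x = 0 := by
        by_contra h
        exact h0 ⟨s x, Finset.mem_erase.2 ⟨h, s.mem_range_self x⟩⟩ rfl
      rw [h1, this]; simp
    · have : s x = i := hi
      rw [h1, this]
  · rw [norm_sq_eq_integral, ← vg c 2]
    have : ∫ x, ‖(∑ i, c i • e i : L2) x‖ ^ 2 = ∫ x, ‖H c x‖ ^ 2 :=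
      integral_congr_ae ((coe c).mono fun x hx => by simp only [hx])
    rw [this]
    exact integral_mono_of_nonneg (Filter.Eventually.of_forall fun x => by positivity) (ig c 2)
      (Filter.Eventually.of_forall (bound c 2 two_ne_zero))
  · refine Integrable.mono' (ig c 1) (Lp.aestronglyMeasurable _) ?_
    filter_upwards [coe c] with x hx
    rw [hx, ← pow_one ‖H c x‖]
    exact bound c 1 one_ne_zero x
  · have h1 := vg c 1
    simp only [pow_one] at h1
    rw [← h1]
    have : ∫ x, ‖(∑ i, c i • e i : L2) x‖ = ∫ x, ‖H c x‖ :=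
      integral_congr_ae ((coe c).mono fun x hx => by simp only [hx])
    rw [this]
    refine integral_mono_of_nonneg (Filter.Eventually.of_forall fun x => norm_nonneg _)
      (by simpa using ig c 1) (Filter.Eventually.of_forall fun x => ?_)
    simpa using bound c 1 one_ne_zero x

/-- Interpolation of an `L² × L²` and an `L¹ × L¹` bound for a sesquilinear form. -/
theorem norm_inner_le_rpow_of_isTest {V W : L2 →ₗ[ℂ] L2} (hV : ∀ f, ‖V f‖ ≤ ‖f‖)
    (hW : ∀ f, ‖W f‖ ≤ ‖f‖) {D θ : ℝ} (hD0 : 0 ≤ D) (hθ : θ ∈ Ioo (0 : ℝ) 1)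
    (hD : ∀ f g : L2, Integrable f → Integrable g →
      ‖inner ℂ (V f) (W g)‖ ≤ D * (∫ x, ‖f x‖) * ∫ x, ‖g x‖)
    {f g : L2} (hf : IsTest (2 / (1 + θ)) f) (hg : IsTest (2 / (1 + θ)) g) :
    ‖inner ℂ (V f) (W g)‖ ≤ D ^ θ := by
  have hr : 0 < 2 / (1 + θ) := by have := hθ.1; positivity
  obtain ⟨ι, e, m, a, hm, ha, hma, rfl, h⟩ := hf.exists_levels hr
  obtain ⟨κ, e', n, a', hn, ha', hna, rfl, h'⟩ := hg.exists_levels hr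
  -- The coefficients on the left are conjugated in advance, which makes the form bilinear in c and
  -- d.
  have expand : ∀ (c : ι → ℂ) (d : κ → ℂ),
      inner ℂ (V (∑ i, (starRingEnd ℂ) (c i) • e i)) (W (∑ j, d j • e' j)) =
        ∑ i, ∑ j, c i * d j * inner ℂ (V (e i)) (W (e' j)) := by
    intro c d
    simp only [map_sum, map_smul, sum_inner, inner_sum, inner_smul_left, inner_smul_right,
      Complex.conj_conj, Finset.mul_sum]
    rw [Finset.sum_comm]
    exact Finset.sum_congr rfl fun i _ => Finset.sum_congr rfl fun j _ => by ring
  have hc : ∀ c : ι → ℂ, ∀ i, ‖(starRingEnd ℂ) (c i)‖ = ‖c i‖ := fun c i => Complex.norm_conj _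
  have := norm_bilin_le_rpow (fun i j => inner ℂ (V (e i)) (W (e' j))) m n hD0 hθ hn
    (fun c d => by
      rw [← expand]
      have h1 := (h fun i => (starRingEnd ℂ) (c i)).1
      have h2 := (h' d).1
      simp only [hc] at h1
      calc _ ≤ (‖∑ i, (starRingEnd ℂ) (c i) • e i‖ * ‖∑ j, d j • e' j‖) ^ 2 := by
            refine pow_le_pow_left₀ (norm_nonneg _) ((norm_inner_le_norm _ _).trans ?_) 2
            exact mul_le_mul (hV _) (hW _) (norm_nonneg _) (norm_nonneg _)
        _ = ‖∑ i, (starRingEnd ℂ) (c i) • e i‖ ^ 2 * ‖∑ j, d j • e' j‖ ^ 2 := mul_pow _ _ 2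
        _ ≤ _ := mul_le_mul h1 h2 (by positivity) ((by positivity : (0 : ℝ) ≤ _).trans h1))
    (fun c d => by
      rw [← expand]
      have h1 := (h fun i => (starRingEnd ℂ) (c i)).2
      have h2 := (h' d).2
      simp only [hc] at h1
      refine (hD _ _ h1.1 h2.1).trans ?_
      rw [mul_assoc]
      refine mul_le_mul_of_nonneg_left (mul_le_mul h1.2 h2.2
        (integral_nonneg fun _ => norm_nonneg _) ?_) hD0
      exact (integral_nonneg fun _ => norm_nonneg _).trans h1.2)
    ha ha' hma hna
  rw [← expand] at this
  simpa using this

end BOZK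

/-! ### Duality for L^p norms, with countably many test functions. -/

namespace BOZK
open Set
open scoped NNReal

theorem enorm_inner_simple_mul_sign (u : L2) {s : SimpleFunc Plane ℝ≥0} {g : L2}
    (hg : g =ᵐ[volume] fun x => ((s x : ℝ) : ℂ) * (u x / ‖u x‖)) :
    ‖(inner ℂ g u : ℂ)‖ₑ = ∫⁻ x, (s x : ℝ≥0∞) * ‖u x‖ₑ := by
  have hae : (fun x => inner ℂ (g x) (u x)) =ᵐ[volume] fun x => ((s x * ‖u x‖ : ℝ) : ℂ) := by
    filter_upwards [hg] with x hx
    rw [hx]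
    by_cases h : u x = 0
    · simp [h]
    have hn : (‖u x‖ : ℂ) ≠ 0 := by exact_mod_cast norm_ne_zero_iff.2 h
    simp only [RCLike.inner_apply, map_mul, map_div₀, Complex.conj_ofReal]
    have : u x * (starRingEnd ℂ) (u x) = (‖u x‖ : ℂ) ^ 2 := by
      rw [Complex.mul_conj, Complex.normSq_eq_norm_sq]; push_cast; rfl
    field_simp
    push_cast
    linear_combination (s x : ℂ) * this
  have hi_int : Integrable fun x => (s x : ℝ) * ‖u x‖ := by
    have h1 := (L2.integrable_inner (𝕜 := ℂ) g u).norm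
    refine h1.congr ?_
    filter_upwards [hae] with x hx
    rw [hx, Complex.norm_real, Real.norm_of_nonneg (by positivity)]
  rw [L2.inner_def, integral_congr_ae hae, integral_complex_ofReal, ← ofReal_norm,
    Complex.norm_real, Real.norm_of_nonneg (integral_nonneg fun x => by positivity),
    ofReal_integral_eq_lintegral_ofReal hi_int (Filter.Eventually.of_forall fun x => by positivity)]
  refine lintegral_congr fun x => ?_
  rw [ENNReal.ofReal_mul (by positivity), ENNReal.ofReal_coe_nnreal, ofReal_norm]

/-- This is the extremizer in Hölder's inequality: test u against s^{p−1}·u/|u|, normalized in the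
conjugate space. Using a simple minorant s of |u| in place of |u| makes I = ∫ s^p finite before u is
known to lie in L^p, and the conclusion reads I^{1/p} ≤ A. -/
theorem lintegral_rpow_le_of_isTest {u : L2} {p : ℝ} (hp : 1 < p) {A : ℝ≥0∞}
    (hA : ∀ g : L2, IsTest (p / (p - 1)) g → ‖(inner ℂ g u : ℂ)‖ₑ ≤ A)
    {s : SimpleFunc Plane ℝ≥0} (hsu : ∀ x, (s x : ℝ≥0∞) ≤ ‖u x‖ₑ) :
    ∫⁻ x, (s x : ℝ≥0∞) ^ p ≤ A ^ p := by
  have hp0 : 0 < p := by linarith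
  have hp1 : 0 < p - 1 := by linarith
  set r := p / (p - 1) with hr
  have hr0 : 0 < r := by positivity
  have hu2 : ∫⁻ x, ‖u x‖ₑ ^ 2 < ⊤ := by
    have := lintegral_rpow_enorm_lt_top_of_eLpNorm_lt_top two_ne_zero ENNReal.ofNat_ne_top
      (Lp.memLp u).2
    simpa using this
  have hs : s.FinMeasSupp volume := by
    have h1 : (s.map fun t : ℝ≥0 => (t : ℝ≥0∞) ^ 2).FinMeasSupp volume := by
      apply SimpleFunc.FinMeasSupp.of_lintegral_ne_top
      rw [← SimpleFunc.lintegral_eq_lintegral]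
      refine ne_top_of_le_ne_top hu2.ne (lintegral_mono fun x => ?_)
      simp only [SimpleFunc.map_apply]
      gcongr
      exact hsu x
    exact h1.of_map fun b hb => by simpa using hb
  set I := ∫⁻ x, (s x : ℝ≥0∞) ^ p with hI
  have hItop : I ≠ ⊤ := by
    have h1 : (s.map fun t : ℝ≥0 => (t : ℝ≥0∞) ^ p).FinMeasSupp volume :=
      hs.map (by simp [hp0])
    have h2 := h1.lintegral_lt_top (Filter.Eventually.of_forall fun x => by
      simp [ENNReal.rpow_eq_top_iff, hp0.not_gt])
    rw [← SimpleFunc.lintegral_eq_lintegral] at h2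
    exact h2.ne
  by_cases hI0 : I = 0
  · rw [hI0]; exact zero_le
  set i := I.toNNReal with hi
  have hiI : (i : ℝ≥0∞) = I := ENNReal.coe_toNNReal hItop
  have hi0 : i ≠ 0 := by
    rw [hi, ENNReal.toNNReal_ne_zero]; exact ⟨hI0, hItop⟩
  -- Since (p − 1)r = p, dividing by I^{1/r} normalizes s^{p−1} in L^r.
  set c : ℝ≥0 := i ^ (1 / r) with hc
  have hc0 : c ≠ 0 := by simp [hc, hi0]
  set s' : SimpleFunc Plane ℝ≥0 := s.map fun t => t ^ (p - 1) / c with hs'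
  have hs'fin : s'.FinMeasSupp volume := hs.map (by simp [NNReal.zero_rpow hp1.ne'])
  set σ : Plane → ℂ := fun x => u x / ‖u x‖ with hσ
  have hum : Measurable u := (Lp.stronglyMeasurable u).measurable
  have hσm : Measurable σ := by fun_prop
  have hσ1 : ∀ x, ‖σ x‖ ≤ 1 := fun x => by
    rw [hσ, norm_div, Complex.norm_real, norm_norm]
    exact div_self_le_one _
  have hmem : MemLp (fun x => ((s' x : ℝ) : ℂ) * σ x) 2 volume := by
    have h1 : MemLp (s'.map fun t : ℝ≥0 => (t : ℝ)) 2 volume :=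
      (SimpleFunc.memLp_iff_finMeasSupp two_ne_zero ENNReal.ofNat_ne_top).2 (hs'fin.map (by simp))
    refine h1.of_le ((Complex.measurable_ofReal.comp
      (measurable_coe_nnreal_real.comp s'.measurable)).mul hσm).aestronglyMeasurable
      (Filter.Eventually.of_forall fun x => ?_)
    rw [norm_mul, Complex.norm_real]
    exact mul_le_of_le_one_right (norm_nonneg _) (hσ1 x)
  set g : L2 := hmem.toLp _ with hg
  have htest : IsTest r g := by
    refine ⟨s', σ, hσm, hσ1, hs'fin, ?_, hmem.coeFn_toLp⟩
    have h1 : ∀ x, (s' x : ℝ≥0∞) ^ r = I⁻¹ * (s x : ℝ≥0∞) ^ p := by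
      intro x
      simp only [hs', SimpleFunc.map_apply]
      rw [← ENNReal.coe_rpow_of_nonneg _ hr0.le, NNReal.div_rpow, ← NNReal.rpow_mul, hc,
        ← NNReal.rpow_mul, one_div_mul_cancel hr0.ne', NNReal.rpow_one,
        show (p - 1) * r = p by rw [hr]; field_simp, ENNReal.coe_div hi0, hiI,
        ENNReal.coe_rpow_of_nonneg _ hp0.le, ENNReal.div_eq_inv_mul]
    simp_rw [h1]
    rw [lintegral_const_mul' _ _ (ENNReal.inv_ne_top.2 hI0), ENNReal.inv_mul_cancel hI0 hItop]
  have hbd := hA g htest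
  rw [enorm_inner_simple_mul_sign u hmem.coeFn_toLp] at hbd
  have hlow : I / c ≤ A := by
    refine le_trans ?_ hbd
    rw [ENNReal.div_eq_inv_mul, hI, ← lintegral_const_mul' _ _ (ENNReal.inv_ne_top.2 (by simpa using hc0))]
    refine lintegral_mono fun x => ?_
    refine le_trans ?_ (mul_le_mul_right (hsu x) _)
    simp only [hs', SimpleFunc.map_apply]
    rw [ENNReal.coe_div hc0, ENNReal.coe_rpow_of_nonneg _ hp1.le, ENNReal.div_eq_inv_mul, mul_assoc]
    gcongr
    conv_rhs => rw [← ENNReal.rpow_one (s x : ℝ≥0∞)]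
    by_cases h0 : s x = 0
    · simp [h0, hp0]
    · rw [ENNReal.rpow_one, ← ENNReal.coe_rpow_of_nonneg _ hp1.le, ← ENNReal.coe_mul,
        ← ENNReal.coe_rpow_of_nonneg _ hp0.le, ENNReal.coe_le_coe]
      conv_rhs => rw [← NNReal.rpow_one (s x), ← NNReal.rpow_mul, one_mul]
      rw [← NNReal.rpow_add h0, sub_add_cancel]
  have hIc : I / c = I ^ (1 / p) := by
    rw [← hiI, hc, ← ENNReal.coe_div (by simpa [hc] using hc0),
      ← ENNReal.coe_rpow_of_nonneg _ (by positivity)]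
    congr 1
    nth_rewrite 1 [← NNReal.rpow_one i]
    rw [← NNReal.rpow_sub hi0]
    congr 1
    rw [hr]; field_simp; ring
  rw [hIc] at hlow
  calc I = (I ^ (1 / p)) ^ p := by
        rw [← ENNReal.rpow_mul, one_div_mul_cancel hp0.ne', ENNReal.rpow_one]
    _ ≤ A ^ p := ENNReal.rpow_le_rpow hlow hp0.le

/-- Duality for the `L^p` norm of an `L²` function. -/
theorem eLpNorm_le_of_isTest {u : L2} {p : ℝ} (hp : 1 < p) {A : ℝ≥0∞}
    (hA : ∀ g : L2, IsTest (p / (p - 1)) g → ‖(inner ℂ g u : ℂ)‖ₑ ≤ A) :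
    eLpNorm u (ENNReal.ofReal p) volume ≤ A := by
  have hp0 : 0 < p := by linarith
  have hum : Measurable fun x => ‖u x‖ₑ := (Lp.stronglyMeasurable u).measurable.enorm
  set E := SimpleFunc.eapprox fun x => ‖u x‖ₑ with hE
  have hval : ∀ n x, ((((E n).map ENNReal.toNNReal) x : ℝ≥0) : ℝ≥0∞) = E n x := fun n x => by
    rw [SimpleFunc.map_apply, ENNReal.coe_toNNReal (SimpleFunc.eapprox_lt_top _ n x).ne]
  have hle : ∀ n x, E n x ≤ ‖u x‖ₑ := fun n x => by
    rw [← SimpleFunc.iSup_eapprox_apply hum x]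
    exact le_iSup (fun n => (E n : Plane → ℝ≥0∞) x) n
  have hstep : ∀ n, ∫⁻ x, (E n x) ^ p ≤ A ^ p := fun n => by
    have := lintegral_rpow_le_of_isTest hp hA (s := (E n).map ENNReal.toNNReal)
      (fun x => by rw [hval]; exact hle n x)
    simpa only [hval] using this
  have hlim : ∫⁻ x, ‖u x‖ₑ ^ p = ⨆ n, ∫⁻ x, (E n x) ^ p := by
    rw [← lintegral_iSup (fun n => (E n).measurable.pow_const p)
      (fun n m hnm x => ENNReal.rpow_le_rpow (SimpleFunc.monotone_eapprox _ hnm x) hp0.le)]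
    refine lintegral_congr fun x => ?_
    rw [← SimpleFunc.iSup_eapprox_apply hum x]
    exact ((ENNReal.orderIsoRpow p hp0).map_iSup fun n => E n x)
  rw [eLpNorm_eq_lintegral_rpow_enorm_toReal (by simpa using hp0) ENNReal.ofReal_ne_top,
    ENNReal.toReal_ofReal hp0.le]
  calc (∫⁻ x, ‖u x‖ₑ ^ p) ^ (1 / p) ≤ (A ^ p) ^ (1 / p) := by
        refine ENNReal.rpow_le_rpow ?_ (by positivity)
        rw [hlim]
        exact iSup_le hstep
    _ = A := by rw [← ENNReal.rpow_mul, mul_one_div_cancel hp0.ne', ENNReal.rpow_one]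

theorem isTest_zero {r : ℝ} (hr : 0 < r) : IsTest r 0 := by
  refine ⟨0, 0, measurable_zero, fun _ => by simp, ?_, ?_, ?_⟩
  · rw [SimpleFunc.finMeasSupp_iff_support]; simp [Function.support]
  · simp [hr]
  · filter_upwards [Lp.coeFn_zero ℂ 2 (volume : Measure Plane)] with x hx
    rw [hx]; simp

/-- The `L^p` norm is dominated by a supremum over countably many test functions. -/
theorem exists_seq_isTest {p : ℝ} (hp : 1 < p) : ∃ d : ℕ → L2,
    (∀ n, IsTest (p / (p - 1)) (d n)) ∧ ∀ u : L2,
      eLpNorm u (ENNReal.ofReal p) volume ≤ ⨆ n, ‖(inner ℂ (d n) u : ℂ)‖ₑ := by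
  have hp1 : 0 < p - 1 := by linarith
  set S : Set L2 := {g | IsTest (p / (p - 1)) g} with hS
  have : Fact ((2 : ℝ≥0∞) ≠ ⊤) := ⟨ENNReal.ofNat_ne_top⟩
  -- Density in L² is enough: u is in L², so the pairing is L²-continuous in the test function and
  -- the bound passes to the closure. Countability makes the supremum measurable in time later on.
  obtain ⟨t, htS, htc, hSt⟩ :=
    (TopologicalSpace.IsSeparable.of_separableSpace S).exists_countable_dense_subset
  have hne : t.Nonempty := by
    by_contra h
    rw [not_nonempty_iff_eq_empty] at h
    rw [h, closure_empty] at hSt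
    exact hSt (show (0 : L2) ∈ S from isTest_zero (by positivity))
  obtain ⟨d, hd⟩ := htc.exists_eq_range hne
  refine ⟨d, fun n => htS (hd ▸ mem_range_self n), fun u => eLpNorm_le_of_isTest hp fun g hg => ?_⟩
  have hclosed : IsClosed {g : L2 | ‖(inner ℂ g u : ℂ)‖ₑ ≤ ⨆ n, ‖(inner ℂ (d n) u : ℂ)‖ₑ} :=
    isClosed_le (by fun_prop) continuous_const
  have hsub : t ⊆ {g : L2 | ‖(inner ℂ g u : ℂ)‖ₑ ≤ ⨆ n, ‖(inner ℂ (d n) u : ℂ)‖ₑ} := by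
    rw [hd]
    rintro _ ⟨n, rfl⟩
    exact le_iSup (fun n => ‖(inner ℂ (d n) u : ℂ)‖ₑ) n
  exact closure_minimal hsub hclosed (hSt hg)

end BOZK

/-! ### The TT* argument in time. -/

namespace BOZK
open Set
open scoped NNReal

/-- A Young–Hölder inequality for a convolution kernel. -/
theorem lintegral_lintegral_mul_kernel_le {q : ℝ} (hq : 2 < q) {g K : ℝ → ℝ≥0∞} (hg : Measurable g)
    (hK : Measurable K) :
    ∫⁻ t, ∫⁻ s, g t ^ (1 - 1 / q) * g s ^ (1 - 1 / q) * K (t - s) ≤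
      (∫⁻ t, g t) ^ (2 - 2 / q) * (∫⁻ t, K t ^ (q / 2)) ^ (2 / q) := by
  have hq0 : 0 < q := by linarith
  have h1 : 0 ≤ 1 - 2 / q := by rw [sub_nonneg, div_le_one hq0]; exact hq.le
  have hqi : 0 < 1 / q := by positivity
  have h2 : 0 < 1 - 1 / q := by rw [sub_pos, div_lt_one hq0]; linarith
  set G := ∫⁻ t, g t with hG
  set B := ∫⁻ t, K t ^ (q / 2) with hB
  have hKr : Measurable fun t => K t ^ (q / 2) := hK.pow_const _
  -- Hölder with the three factors g(t)g(s), g(t)K^{q/2}, g(s)K^{q/2} and exponents 1 − 2/q, 1/q,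
  -- 1/q reproduces the integrand; each factor integrates exactly.
  let f : Fin 3 → ℝ × ℝ → ℝ≥0∞ := ![fun z => g z.1 * g z.2, fun z => g z.1 * K (z.1 - z.2) ^ (q / 2),
    fun z => g z.2 * K (z.1 - z.2) ^ (q / 2)]
  let p : Fin 3 → ℝ := ![1 - 2 / q, 1 / q, 1 / q]
  have hf : ∀ i ∈ Finset.univ, AEMeasurable (f i) (volume.prod volume) := by
    intro i _
    fin_cases i <;> simp only [f] <;> refine Measurable.aemeasurable ?_ <;> simp <;> fun_prop
  have hp1 : ∑ i, p i = 1 := by simp [p, Fin.sum_univ_three]; ring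
  have hp0 : ∀ i ∈ Finset.univ, 0 ≤ p i := by
    intro i _
    fin_cases i <;> simp only [p]
    · exact h1
    · exact hqi.le
    · exact hqi.le
  have key := ENNReal.lintegral_prod_norm_pow_le Finset.univ hf hp1 hp0
  have e0 : ∫⁻ z, g z.1 * g z.2 ∂(volume.prod volume) = G * G := by
    rw [lintegral_prod _ (by fun_prop)]
    simp only [lintegral_const_mul _ hg, lintegral_mul_const _ hg, ← hG]
  have e1 : ∫⁻ z : ℝ × ℝ, g z.1 * K (z.1 - z.2) ^ (q / 2) ∂(volume.prod volume) = G * B := by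
    rw [lintegral_prod _ (by fun_prop)]
    have : ∀ t, ∫⁻ s, g t * K (t - s) ^ (q / 2) = g t * B := fun t => by
      rw [lintegral_const_mul _ (by fun_prop), lintegral_sub_left_eq_self (fun s => K s ^ (q / 2)) t]
    simp only [this, lintegral_mul_const _ hg, ← hG]
  have e2 : ∫⁻ z : ℝ × ℝ, g z.2 * K (z.1 - z.2) ^ (q / 2) ∂(volume.prod volume) = G * B := by
    rw [lintegral_prod_symm _ (by fun_prop)]
    have : ∀ s, ∫⁻ t, g s * K (t - s) ^ (q / 2) = g s * B := fun s => by
      rw [lintegral_const_mul _ (by fun_prop), lintegral_sub_right_eq_self (fun t => K t ^ (q / 2)) s]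
    simp only [this, lintegral_mul_const _ hg, ← hG]
  rw [← lintegral_prod (fun z : ℝ × ℝ => g z.1 ^ (1 - 1 / q) * g z.2 ^ (1 - 1 / q) * K (z.1 - z.2))
    (by fun_prop)]
  simp only [Fin.prod_univ_three, f, p, Matrix.cons_val_zero, Matrix.cons_val_one, Matrix.cons_val]
    at key
  rw [e0, e1, e2] at key
  refine le_trans (le_of_eq (lintegral_congr fun z => ?_)) (key.trans_eq ?_)
  · have e : (1 - 1 / q) = (1 - 2 / q) + 1 / q := by ring
    rw [ENNReal.mul_rpow_of_nonneg _ _ h1, ENNReal.mul_rpow_of_nonneg _ _ hqi.le,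
      ENNReal.mul_rpow_of_nonneg _ _ hqi.le, ← ENNReal.rpow_mul,
      e, ENNReal.rpow_add_of_nonneg _ _ h1 hqi.le, ENNReal.rpow_add_of_nonneg _ _ h1 hqi.le]
    have : K (z.1 - z.2) = K (z.1 - z.2) ^ (q / 2 * (1 / q)) * K (z.1 - z.2) ^ (q / 2 * (1 / q)) := by
      rw [← ENNReal.rpow_add_of_nonneg _ _ (by positivity) (by positivity)]
      rw [show q / 2 * (1 / q) + q / 2 * (1 / q) = 1 by field_simp; norm_num, ENNReal.rpow_one]
    nth_rewrite 1 [this]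
    ring
  · rw [ENNReal.mul_rpow_of_nonneg _ _ h1, ENNReal.mul_rpow_of_nonneg _ _ hqi.le,
      show 2 - 2 / q = (1 - 2 / q) + (1 - 2 / q) + (1 / q + 1 / q) by ring,
      show 2 / q = 1 / q + 1 / q by ring,
      ENNReal.rpow_add_of_nonneg _ _ (by ring_nf at h1 ⊢; linarith) (by positivity),
      ENNReal.rpow_add_of_nonneg _ _ hqi.le hqi.le, ENNReal.rpow_add_of_nonneg (x := B) _ _ hqi.le hqi.le,
      ENNReal.rpow_add_of_nonneg _ _ (by ring_nf at h1 ⊢; linarith) (by ring_nf at h1 ⊢; linarith)]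
    ring_nf

/-- A measurable choice of an index of the largest of the first few terms. -/
theorem exists_measurable_argmax {a : ℕ → ℝ → ℝ} (ha : ∀ n, Measurable (a n)) (M : ℕ) :
    ∃ k : ℝ → ℕ, Measurable k ∧ (∀ t, k t ≤ M) ∧ ∀ t, ∀ n ≤ M, a n t ≤ a (k t) t := by
  induction M with
  | zero => exact ⟨fun _ => 0, measurable_const, fun _ => le_rfl, fun t n hn => by
      rw [Nat.le_zero.1 hn]⟩
  | succ M ih =>
    obtain ⟨k, hk, hkM, hkm⟩ := ih
    have hmk : Measurable fun t => a (k t) t := by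
      have : Measurable fun z : ℕ × ℝ => a z.1 z.2 := measurable_from_prod_countable_right ha
      exact this.comp (hk.prodMk measurable_id)
    classical
    refine ⟨fun t => if a (k t) t ≤ a (M + 1) t then M + 1 else k t,
      Measurable.ite (measurableSet_le hmk (ha _)) measurable_const hk, fun t => ?_, fun t n hn => ?_⟩
    · dsimp only
      split_ifs
      · exact le_rfl
      · exact (hkM t).trans (Nat.le_succ M)
    · dsimp only
      rcases Nat.le_or_eq_of_le_succ hn with h | h
      · split_ifs with hc
        · exact (hkm t n h).trans hc
        · exact hkm t n h
      · subst h
        split_ifs with hc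
        · exact le_rfl
        · exact (not_le.1 hc).le

section TTstar

variable {H : Type*} [NormedAddCommGroup H] [InnerProductSpace ℂ H] [CompleteSpace H]

/-- Let b = ⟨w, ψ⟩ and P = ∫_I |b|^q. Pairing ψ with the vector ∫_I b|b|^{q−2} w returns P, so P² ≤
‖∫_I b|b|^{q−2} w‖²‖ψ‖². The squared norm is a double integral of the Gram kernel ⟨w(t), w(s)⟩,
which the Young–Hölder inequality with g = |b|^q bounds by P^{2−2/q}(∫ K^{q/2})^{2/q}. As w is
bounded and I has finite measure, P is finite and its power can be cancelled. -/
theorem lintegral_norm_inner_rpow_le {q : ℝ} (hq : 2 < q) {w : ℝ → H} (hw : StronglyMeasurable w)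
    {C : ℝ} (hC : ∀ t, ‖w t‖ ≤ C) {K : ℝ → ℝ≥0∞} (hK : Measurable K) {I : Set ℝ}
    (hI : MeasurableSet I) (hIf : volume I ≠ ⊤)
    (hwK : ∀ t ∈ I, ∀ s ∈ I, t ≠ s → ‖(inner ℂ (w t) (w s) : ℂ)‖ₑ ≤ K (t - s)) (ψ : H) :
    ∫⁻ t in I, ‖(inner ℂ (w t) ψ : ℂ)‖ₑ ^ q ≤ ‖ψ‖ₑ ^ q * ∫⁻ t, K t ^ (q / 2) := by
  have hq0 : 0 < q := by linarith
  have hC0 : 0 ≤ C := (norm_nonneg _).trans (hC 0)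
  set b : ℝ → ℂ := fun t => inner ℂ (w t) ψ with hb
  have hbm : StronglyMeasurable b := hw.inner stronglyMeasurable_const
  have hbC : ∀ t, ‖b t‖ ≤ C * ‖ψ‖ := fun t =>
    (norm_inner_le_norm _ _).trans (mul_le_mul_of_nonneg_right (hC t) (norm_nonneg _))
  set P := ∫⁻ t in I, ‖b t‖ₑ ^ q with hP
  have hfin : IsFiniteMeasure (volume.restrict I) := ⟨by
    rw [Measure.restrict_apply_univ]; exact hIf.lt_top⟩
  set c : ℝ → ℂ := fun t => b t * ((‖b t‖ ^ (q - 2) : ℝ) : ℂ) with hc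
  have hcm : StronglyMeasurable c := by
    refine hbm.mul (Measurable.stronglyMeasurable ?_)
    have := hbm.measurable
    fun_prop
  have hcn : ∀ t, ‖c t‖ = ‖b t‖ ^ (q - 1) := fun t => by
    rw [hc]
    simp only
    rw [norm_mul, Complex.norm_real, Real.norm_of_nonneg (by positivity)]
    rcases (norm_nonneg (b t)).eq_or_lt with h | h
    · rw [← h, zero_mul, Real.zero_rpow (by linarith)]
    · rw [show q - 1 = 1 + (q - 2) by ring, Real.rpow_add h, Real.rpow_one]
  have hce : ∀ t, ‖c t‖ₑ = ‖b t‖ₑ ^ (q - 1) := fun t => by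
    rw [← ofReal_norm, hcn, ← ofReal_norm (b t),
      ENNReal.ofReal_rpow_of_nonneg (norm_nonneg _) (by linarith)]
  set u : ℝ → H := fun t => c t • w t with hu
  have hum : StronglyMeasurable u := hcm.smul hw
  have hui : Integrable u (volume.restrict I) := by
    refine Integrable.of_bound hum.aestronglyMeasurable ((C * ‖ψ‖) ^ (q - 1) * C)
      (Filter.Eventually.of_forall fun t => ?_)
    rw [hu, norm_smul, hcn]
    exact mul_le_mul (Real.rpow_le_rpow (norm_nonneg _) (hbC t) (by linarith)) (hC t)
      (norm_nonneg _) (by positivity)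
  have hcu : ∀ t, (inner ℂ (u t) ψ : ℂ) = ((‖b t‖ ^ q : ℝ) : ℂ) := fun t => by
    rw [hu]
    simp only
    rw [inner_smul_left, hc]
    simp only
    rw [map_mul, Complex.conj_ofReal]
    change _ * b t = _
    rcases (norm_nonneg (b t)).eq_or_lt with h | h
    · rw [← h, norm_eq_zero.1 h.symm, Real.zero_rpow (by linarith), Real.zero_rpow hq0.ne']; simp
    · rw [show q = 2 + (q - 2) by ring, Real.rpow_add h]
      push_cast
      rw [show (2 : ℝ) + (q - 2) - 2 = q - 2 by ring, mul_right_comm, mul_comm (starRingEnd ℂ (b t)),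
        Complex.mul_conj, Complex.normSq_eq_norm_sq]
      norm_num
  have hPfin : P ≠ ⊤ := by
    refine ((setLIntegral_mono_ae' (g := fun _ => ENNReal.ofReal (C * ‖ψ‖) ^ q) hI
      (Filter.Eventually.of_forall fun t _ => ?_)).trans_lt ?_).ne
    · refine ENNReal.rpow_le_rpow ?_ hq0.le
      rw [← ofReal_norm]
      exact ENNReal.ofReal_le_ofReal (hbC t)
    · rw [setLIntegral_const]
      exact ENNReal.mul_lt_top (ENNReal.rpow_lt_top_of_nonneg hq0.le ENNReal.ofReal_ne_top) hIf.lt_top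
  have hPu : P ≤ ‖∫ t in I, u t‖ₑ * ‖ψ‖ₑ := by
    have e1 : (inner ℂ (∫ t in I, u t) ψ : ℂ) = ((∫ t in I, ‖b t‖ ^ q : ℝ) : ℂ) := by
      rw [← inner_conj_symm, ← integral_inner hui, ← integral_conj, ← integral_complex_ofReal]
      congr 1
      ext t
      rw [inner_conj_symm, hcu]
    have e2 : P = ‖(inner ℂ (∫ t in I, u t) ψ : ℂ)‖ₑ := by
      rw [e1, ← ofReal_norm, Complex.norm_real, Real.norm_of_nonneg
        (integral_nonneg fun t => by positivity), ofReal_integral_eq_lintegral_ofReal]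
      · refine lintegral_congr fun t => ?_
        rw [← ofReal_norm (b t), ENNReal.ofReal_rpow_of_nonneg (norm_nonneg _) hq0.le]
      · refine Integrable.of_bound (C := (C * ‖ψ‖) ^ q) ?_ (Filter.Eventually.of_forall fun t => ?_)
        · have := hbm.measurable
          exact Measurable.aestronglyMeasurable (by fun_prop)
        · rw [Real.norm_of_nonneg (by positivity)]
          exact Real.rpow_le_rpow (norm_nonneg _) (hbC t) hq0.le
      · exact Filter.Eventually.of_forall fun t => by positivity
    rw [e2]
    rw [← ofReal_norm, ← ofReal_norm, ← ofReal_norm, ← ENNReal.ofReal_mul (norm_nonneg _)]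
    exact ENNReal.ofReal_le_ofReal (norm_inner_le_norm _ _)
  have huu : ‖∫ t in I, u t‖ₑ ^ 2 ≤ P ^ (2 - 2 / q) * (∫⁻ t, K t ^ (q / 2)) ^ (2 / q) := by
    set g : ℝ → ℝ≥0∞ := I.indicator fun t => ‖b t‖ₑ ^ q with hg
    have hgm : Measurable g := (hbm.enorm.pow_const q).indicator hI
    have hgP : ∫⁻ t, g t = P := lintegral_indicator hI _
    have e1 : ‖∫ t in I, u t‖ₑ ^ 2 = ‖(inner ℂ (∫ t in I, u t) (∫ t in I, u t) : ℂ)‖ₑ := by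
      rw [inner_self_eq_norm_sq_to_K, enorm_pow]
      congr 1
      rw [← ofReal_norm, ← ofReal_norm]
      simp
    rw [e1, ← hgP, ← integral_inner hui]
    refine le_trans ((enorm_integral_le_lintegral_enorm _).trans ?_)
      (lintegral_lintegral_mul_kernel_le hq hgm hK)
    rw [← lintegral_indicator hI]
    refine lintegral_mono fun t => ?_
    by_cases ht : t ∈ I
    swap
    · rw [indicator_of_notMem ht]; exact bot_le
    rw [indicator_of_mem ht, ← inner_conj_symm, ← integral_inner hui]
    rw [← ofReal_norm, Complex.norm_conj, ofReal_norm]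
    refine (enorm_integral_le_lintegral_enorm _).trans ?_
    rw [← lintegral_indicator hI]
    -- The Gram kernel is controlled only off the diagonal, which is null.
    have hne : ∀ᵐ s : ℝ, s ≠ t := by
      rw [ae_iff]; simp
    refine lintegral_mono_ae (hne.mono fun s hs => ?_)
    by_cases hsI : s ∈ I
    swap
    · rw [indicator_of_notMem hsI]; exact bot_le
    have hpow : ∀ r, (‖b r‖ₑ ^ q) ^ (1 - 1 / q) = ‖b r‖ₑ ^ (q - 1) := fun r => by
      rw [← ENNReal.rpow_mul]; congr 1; field_simp
    rw [indicator_of_mem hsI, hg, indicator_of_mem ht, indicator_of_mem hsI, hpow, hpow, hu]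
    simp only
    rw [inner_smul_left, inner_smul_right, enorm_mul, enorm_mul, ← hce, ← hce, mul_assoc]
    have : ‖(starRingEnd ℂ) (c t)‖ₑ = ‖c t‖ₑ := by
      rw [← ofReal_norm, Complex.norm_conj, ofReal_norm]
    rw [this]
    gcongr
    exact hwK t ht s hsI hs.symm
  rcases eq_or_ne P 0 with hP0 | hP0
  · rw [hP0]; exact bot_le
  set B := ∫⁻ t, K t ^ (q / 2) with hB
  have h2 : P ^ (2 : ℝ) ≤ P ^ (2 - 2 / q) * (‖ψ‖ₑ ^ 2 * B ^ (2 / q)) := by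
    calc P ^ (2 : ℝ) = P ^ 2 := by norm_cast
      _ ≤ (‖∫ t in I, u t‖ₑ * ‖ψ‖ₑ) ^ 2 := by gcongr
      _ = ‖∫ t in I, u t‖ₑ ^ 2 * ‖ψ‖ₑ ^ 2 := mul_pow _ _ _
      _ ≤ _ := by
        refine (mul_le_mul_left huu _).trans_eq ?_
        ring
  have h3 : P ^ (2 / q) ≤ ‖ψ‖ₑ ^ 2 * B ^ (2 / q) := by
    rw [show (2 : ℝ) = (2 - 2 / q) + 2 / q by ring, ENNReal.rpow_add _ _ hP0 hPfin] at h2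
    rw [show (2 : ℝ) - 2 / q + 2 / q = 2 by ring] at h2
    refine (ENNReal.mul_le_mul_iff_right ?_ ?_).1 h2
    · exact (ENNReal.rpow_pos (pos_iff_ne_zero.2 hP0) hPfin).ne'
    · exact ENNReal.rpow_ne_top_of_nonneg' (pos_iff_ne_zero.2 hP0) hPfin
  have h4 := ENNReal.rpow_le_rpow h3 (show 0 ≤ q / 2 by linarith)
  rw [ENNReal.mul_rpow_of_nonneg _ _ (by linarith), ← ENNReal.rpow_mul, ← ENNReal.rpow_mul,
    ← ENNReal.rpow_natCast, ← ENNReal.rpow_mul, show 2 / q * (q / 2) = 1 by field_simp,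
    ENNReal.rpow_one, ENNReal.rpow_one] at h4
  convert h4 using 3
  push_cast
  ring

/-- The `TT*` argument for a countable family of vectors. -/
theorem lintegral_iSup_norm_inner_rpow_le {q : ℝ} (hq : 2 < q) {v : ℕ → ℝ → H}
    (hv : ∀ n, StronglyMeasurable (v n)) {C : ℕ → ℝ} (hC : ∀ n t, ‖v n t‖ ≤ C n) {K : ℝ → ℝ≥0∞}
    (hK : Measurable K) {I : Set ℝ} (hI : MeasurableSet I)
    (hvK : ∀ n m, ∀ t ∈ I, ∀ s ∈ I, t ≠ s → ‖(inner ℂ (v n t) (v m s) : ℂ)‖ₑ ≤ K (t - s)) (ψ : H) :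
    ∫⁻ t in I, (⨆ n, ‖(inner ℂ (v n t) ψ : ℂ)‖ₑ) ^ q ≤ ‖ψ‖ₑ ^ q * ∫⁻ t, K t ^ (q / 2) := by
  have hq0 : 0 < q := by linarith
  set a : ℕ → ℝ → ℝ := fun n t => ‖(inner ℂ (v n t) ψ : ℂ)‖ with ha
  have ham : ∀ n, Measurable (a n) := fun n =>
    ((hv n).inner stronglyMeasurable_const).norm.measurable
  -- Choosing at each time the largest of the first M + 1 pairings linearizes the supremum. The
  -- selected family obeys the same kernel bound because that bound is uniform in both indices.
  -- Fatou's lemma then lets M and the time window grow.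
  choose k hk hkM hka using fun M => exists_measurable_argmax ham M
  set J : ℕ → Set ℝ := fun M => I ∩ Icc (-M : ℝ) M with hJ
  have hJm : ∀ M, MeasurableSet (J M) := fun M => hI.inter measurableSet_Icc
  have hwm : ∀ M, StronglyMeasurable fun t => v (k M t) t := fun M => by
    have : StronglyMeasurable fun z : ℕ × ℝ => v z.1 z.2 :=
      stronglyMeasurable_uncurry_of_continuous_of_stronglyMeasurable
        (fun _ => continuous_of_discreteTopology) hv
    exact this.comp_measurable ((hk M).prodMk measurable_id)
  have hb : ∀ M, ∫⁻ t in J M, ‖(inner ℂ (v (k M t) t) ψ : ℂ)‖ₑ ^ q ≤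
      ‖ψ‖ₑ ^ q * ∫⁻ t, K t ^ (q / 2) := fun M => by
    refine lintegral_norm_inner_rpow_le hq (hwm M) (C := ∑ n ∈ Finset.range (M + 1), |C n|)
      (fun t => ?_) hK (hJm M) ?_ (fun t ht s hs hts => hvK _ _ t ht.1 s hs.1 hts) ψ
    · refine (hC _ t).trans ((le_abs_self _).trans ?_)
      exact Finset.single_le_sum (f := fun n => |C n|) (fun i _ => abs_nonneg _)
        (Finset.mem_range.2 (Nat.lt_succ_of_le (hkM M t)))
    · exact ((measure_mono inter_subset_right).trans_lt isCompact_Icc.measure_lt_top).ne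
  set F : ℕ → ℝ → ℝ≥0∞ := fun M => (J M).indicator fun t => ‖(inner ℂ (v (k M t) t) ψ : ℂ)‖ₑ ^ q
    with hF
  have hFm : ∀ M, Measurable (F M) := fun M =>
    (((hwm M).inner stronglyMeasurable_const).enorm.pow_const q).indicator (hJm M)
  calc ∫⁻ t in I, (⨆ n, ‖(inner ℂ (v n t) ψ : ℂ)‖ₑ) ^ q
      ≤ ∫⁻ t, Filter.liminf (fun M => F M t) Filter.atTop := by
        rw [← lintegral_indicator hI]
        refine lintegral_mono fun t => ?_
        by_cases ht : t ∈ I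
        swap
        · rw [indicator_of_notMem ht]; exact bot_le
        rw [indicator_of_mem ht]
        have : (⨆ n, ‖(inner ℂ (v n t) ψ : ℂ)‖ₑ) ^ q = ⨆ n, ‖(inner ℂ (v n t) ψ : ℂ)‖ₑ ^ q :=
          (ENNReal.orderIsoRpow q hq0).map_iSup _
        rw [this]
        refine iSup_le fun n => Filter.le_liminf_of_le (by isBoundedDefault) ?_
        obtain ⟨m, hm⟩ := exists_nat_ge |t|
        filter_upwards [Filter.eventually_ge_atTop n, Filter.eventually_ge_atTop m] with M hn hmM
        have hmM' : (m : ℝ) ≤ M := by exact_mod_cast hmM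
        rw [hF]
        simp only
        rw [indicator_of_mem (show t ∈ J M from ⟨ht, abs_le.1 (hm.trans hmM')⟩)]
        refine ENNReal.rpow_le_rpow ?_ hq0.le
        rw [← ofReal_norm, ← ofReal_norm]
        exact ENNReal.ofReal_le_ofReal (hka M t n hn)
    _ ≤ Filter.liminf (fun M => ∫⁻ t, F M t) Filter.atTop := lintegral_liminf_le hFm
    _ ≤ _ := by
        refine Filter.liminf_le_of_le (by isBoundedDefault) fun x hx => ?_
        obtain ⟨M, hM⟩ := hx.exists
        refine hM.trans ?_
        rw [hF, lintegral_indicator (hJm M)]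
        exact hb M

end TTstar

end BOZK

/-! ### The localized flow as one multiplier, and the abstract Strichartz estimate. -/

namespace BOZK
open Set
open scoped NNReal

/-- Multiplication by a symbol on the frequency side, as a linear map. -/
noncomputable def symbolOp (k : ℝ × ℝ → ℂ) (hk : IsBoundedSymbol fun ξ μ => k (ξ, μ)) :
    L2 →ₗ[ℂ] L2 where
  toFun g := (memLp_symbol_mul hk g).toLp
  map_add' f g := by
    refine Lp.ext ?_
    filter_upwards [(memLp_symbol_mul hk (f + g)).coeFn_toLp, (memLp_symbol_mul hk f).coeFn_toLp,
      (memLp_symbol_mul hk g).coeFn_toLp, Lp.coeFn_add (memLp_symbol_mul hk f).toLp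
      (memLp_symbol_mul hk g).toLp, Lp.coeFn_add f g] with z h1 h2 h3 h4 h5
    rw [h1, h4, Pi.add_apply, h2, h3, h5, Pi.add_apply, mul_add]
  map_smul' c g := by
    refine Lp.ext ?_
    filter_upwards [(memLp_symbol_mul hk (c • g)).coeFn_toLp, (memLp_symbol_mul hk g).coeFn_toLp,
      Lp.coeFn_smul c (memLp_symbol_mul hk g).toLp, Lp.coeFn_smul c g] with z h1 h2 h3 h4
    rw [RingHom.id_apply, h1, h3, Pi.smul_apply, h2, h4, Pi.smul_apply, smul_eq_mul, smul_eq_mul,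
      mul_left_comm]

section symbolOp

variable {k k' : ℝ × ℝ → ℂ} {hk : IsBoundedSymbol fun ξ μ => k (ξ, μ)}
  {hk' : IsBoundedSymbol fun ξ μ => k' (ξ, μ)}

theorem symbolOp_coeFn (g : L2) :
    symbolOp k hk g =ᵐ[volume] fun z => k (2 * Real.pi * z 0, 2 * Real.pi * z 1) * g z :=
  (memLp_symbol_mul hk g).coeFn_toLp

theorem fourierMultiplier_eq (g : L2) : fourierMultiplier _ hk g = 𝓕⁻ (symbolOp k hk (𝓕 g)) := rfl

theorem norm_symbolOp_le (h1 : ∀ p, ‖k p‖ ≤ 1) (g : L2) : ‖symbolOp k hk g‖ ≤ ‖g‖ := by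
  refine Lp.norm_le_norm_of_ae_le ?_
  filter_upwards [symbolOp_coeFn (hk := hk) g] with z hz
  rw [hz, norm_mul]
  exact mul_le_of_le_one_left (norm_nonneg _) (h1 _)

theorem symbolOp_symbolOp {l : ℝ × ℝ → ℂ} {hl : IsBoundedSymbol fun ξ μ => l (ξ, μ)}
    (h : ∀ p, k' p * k p = l p) (g : L2) :
    symbolOp k' hk' (symbolOp k hk g) = symbolOp l hl g := by
  refine Lp.ext ?_
  filter_upwards [symbolOp_coeFn (hk := hk') (symbolOp k hk g), symbolOp_coeFn (hk := hk) g,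
    symbolOp_coeFn (hk := hl) g] with z h1 h2 h3
  rw [h1, h2, h3, ← mul_assoc, h]

theorem inner_symbolOp_right (f g : L2) : inner ℂ f (symbolOp k hk g) =
    ∫ z : Plane, (starRingEnd ℂ) (f z) * (k (2 * Real.pi * z 0, 2 * Real.pi * z 1) * g z) := by
  rw [L2.inner_def]
  refine integral_congr_ae ?_
  filter_upwards [symbolOp_coeFn (hk := hk) g] with z hz
  rw [hz, RCLike.inner_apply, mul_comm]

theorem inner_symbolOp_comm (h : ∀ p, k' p = (starRingEnd ℂ) (k p)) (f g : L2) :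
    inner ℂ f (symbolOp k hk g) = inner ℂ (symbolOp k' hk' f) g := by
  rw [inner_symbolOp_right, L2.inner_def]
  refine integral_congr_ae ?_
  filter_upwards [symbolOp_coeFn (hk := hk') f] with z hz
  rw [hz, RCLike.inner_apply, map_mul, h, Complex.conj_conj]
  ring

end symbolOp

section flow

variable {ψ : ℝ → ℝ} {α δ : ℝ}

theorem isBoundedSymbol_flowSymbol (hm : Measurable ψ) (h1 : ∀ ξ, |ψ ξ| ≤ 1) (τ : ℝ) :
    IsBoundedSymbol fun ξ μ => flowSymbol ψ α δ τ (ξ, μ) :=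
  ⟨measurable_flowSymbol hm, 1, fun _ _ => norm_flowSymbol_le h1 _⟩

theorem flowSymbol_neg (τ : ℝ) (p : ℝ × ℝ) :
    flowSymbol ψ α δ (-τ) p = (starRingEnd ℂ) (flowSymbol ψ α δ τ p) := by
  rw [flowSymbol, flowSymbol, map_mul, map_mul, Complex.conj_ofReal, conj_exp_I_mul]
  congr 2
  · by_cases h : p ∈ (critRegion α δ)ᶜ <;> simp [h]
  · push_cast; ring_nf

/-- The indicator is idempotent, so composing two flows adds the times and squares only the smooth
cutoff; hence the squared bump in the kernels. -/
theorem flowSymbol_mul (τ σ : ℝ) (p : ℝ × ℝ) :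
    flowSymbol ψ α δ τ p * flowSymbol ψ α δ σ p = flowSymbol (fun ξ => ψ ξ ^ 2) α δ (τ + σ) p := by
  have : Complex.exp (Complex.I * ((τ + σ) * omega α p.1 p.2 : ℝ)) =
      Complex.exp (Complex.I * (τ * omega α p.1 p.2 : ℝ)) *
        Complex.exp (Complex.I * (σ * omega α p.1 p.2 : ℝ)) := by
    rw [← Complex.exp_add]; push_cast; ring_nf
  rw [flowSymbol, flowSymbol, flowSymbol, this]
  by_cases h : p ∈ (critRegion α δ)ᶜ
  · rw [indicator_of_mem h]; push_cast; ring
  · rw [indicator_of_notMem h]; ring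

/-- The adjoint flow, on the frequency side. -/
noncomputable def dualFlow (hm : Measurable ψ) (h1 : ∀ ξ, |ψ ξ| ≤ 1) (α δ t : ℝ) : L2 →ₗ[ℂ] L2 :=
  (symbolOp (flowSymbol ψ α δ (-t)) (isBoundedSymbol_flowSymbol hm h1 _)).comp
    (Lp.fourierTransformₗᵢ Plane ℂ).toLinearEquiv.toLinearMap

theorem dualFlow_apply (hm : Measurable ψ) (h1 : ∀ ξ, |ψ ξ| ≤ 1) (t : ℝ) (f : L2) :
    dualFlow hm h1 α δ t f =
      symbolOp (flowSymbol ψ α δ (-t)) (isBoundedSymbol_flowSymbol hm h1 _) (𝓕 f) := rfl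

theorem norm_dualFlow_le (hm : Measurable ψ) (h1 : ∀ ξ, |ψ ξ| ≤ 1) (t : ℝ) (f : L2) :
    ‖dualFlow hm h1 α δ t f‖ ≤ ‖f‖ := by
  rw [dualFlow_apply, ← Lp.norm_fourier_eq f]
  exact norm_symbolOp_le (norm_flowSymbol_le h1) _

theorem inner_dualFlow_dualFlow (hm : Measurable ψ) (h1 : ∀ ξ, |ψ ξ| ≤ 1) (t s : ℝ) (f g : L2) :
    inner ℂ (dualFlow hm h1 α δ t f) (dualFlow hm h1 α δ s g) =
      ∫ z : Plane, (starRingEnd ℂ) ((𝓕 f : L2) z) *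
        (flowSymbol (fun ξ => ψ ξ ^ 2) α δ (t - s) (2 * Real.pi * z 0, 2 * Real.pi * z 1) *
          (𝓕 g : L2) z) := by
  have h2 : ∀ ξ, |ψ ξ ^ 2| ≤ 1 := fun ξ => by
    rw [abs_pow]; exact pow_le_one₀ (abs_nonneg _) (h1 ξ)
  rw [dualFlow_apply, dualFlow_apply, ← inner_symbolOp_comm
    (hk := isBoundedSymbol_flowSymbol hm h1 t) (fun p => flowSymbol_neg t p),
    symbolOp_symbolOp (hl := isBoundedSymbol_flowSymbol (hm.pow_const 2) h2 (t - s))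
      (fun p => by rw [flowSymbol_mul, sub_eq_add_neg]), inner_symbolOp_right]

/-- This is the L¹ × L¹ endpoint of the interpolation; the L² × L² endpoint is `norm_dualFlow_le`.
-/
theorem norm_inner_dualFlow_le (hm : Measurable ψ) (h1 : ∀ ξ, |ψ ξ| ≤ 1) {L : ℝ}
    (hsupp : ∀ ξ, ψ ξ ≠ 0 → |ξ| ≤ L) {t s D R₀ : ℝ}
    (hD : ∀ R, R₀ ≤ R → ∀ x y, ‖∫ ξ, kernelFun (fun ξ => ψ ξ ^ 2) α δ R (t - s) x y ξ‖ ≤ D)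
    {f g : L2} (hf : Integrable f) (hg : Integrable g) :
    ‖(inner ℂ (dualFlow hm h1 α δ t f) (dualFlow hm h1 α δ s g) : ℂ)‖ ≤
      D * (∫ x, ‖f x‖) * ∫ x, ‖g x‖ := by
  have h2 : ∀ ξ, |ψ ξ ^ 2| ≤ 1 := fun ξ => by
    rw [abs_pow]; exact pow_le_one₀ (abs_nonneg _) (h1 ξ)
  have ef : (𝓕 f : L2) =ᵐ[volume] 𝓕 (f : Plane → ℂ) := by
    have := fourier_toLp_ae_eq hf (Lp.memLp f)
    rwa [Lp.toLp_coeFn] at this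
  have eg : (𝓕 g : L2) =ᵐ[volume] 𝓕 (g : Plane → ℂ) := by
    have := fourier_toLp_ae_eq hg (Lp.memLp g)
    rwa [Lp.toLp_coeFn] at this
  have key := norm_integral_flowSymbol_le (hm.pow_const 2) h2
    (fun ξ h => hsupp ξ fun h0 => h (by simp [h0])) hD hf hg
    ((Lp.memLp (𝓕 f)).ae_eq ef) ((Lp.memLp (𝓕 g)).ae_eq eg)
  rw [inner_dualFlow_dualFlow]
  refine le_of_eq_of_le ?_ key
  congr 1
  refine integral_congr_ae ?_
  filter_upwards [ef, eg] with z h3 h4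
  rw [h3, h4]

/-- The symbol is pointwise continuous in time and the squared difference is dominated by 4|𝓕 f|².
Continuity supplies the strong measurability required by the TT* argument. -/
theorem continuous_dualFlow (hm : Measurable ψ) (h1 : ∀ ξ, |ψ ξ| ≤ 1) (f : L2) :
    Continuous fun t => dualFlow hm h1 α δ t f := by
  refine continuous_iff_continuousAt.2 fun s => ?_
  set G : ℝ → Plane → ℝ := fun t z =>
    ‖(flowSymbol ψ α δ (-t) (2 * Real.pi * z 0, 2 * Real.pi * z 1) -
      flowSymbol ψ α δ (-s) (2 * Real.pi * z 0, 2 * Real.pi * z 1)) * (𝓕 f : L2) z‖ ^ 2 with hG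
  have e : ∀ t, ‖dualFlow hm h1 α δ t f - dualFlow hm h1 α δ s f‖ ^ 2 = ∫ z, G t z := fun t => by
    rw [norm_sq_eq_integral]
    refine integral_congr_ae ?_
    filter_upwards [Lp.coeFn_sub (dualFlow hm h1 α δ t f) (dualFlow hm h1 α δ s f),
      symbolOp_coeFn (hk := isBoundedSymbol_flowSymbol (α := α) (δ := δ) hm h1 (-t)) (𝓕 f),
      symbolOp_coeFn (hk := isBoundedSymbol_flowSymbol (α := α) (δ := δ) hm h1 (-s)) (𝓕 f)]
      with z h2 h3 h4
    rw [h2, Pi.sub_apply, dualFlow_apply, dualFlow_apply, h3, h4, hG]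
    simp only
    rw [sub_mul]
  have hmz : Measurable fun z : Plane => ((2 * Real.pi * z 0, 2 * Real.pi * z 1) : ℝ × ℝ) := by
    fun_prop
  have hf2 : Integrable fun z => ‖(𝓕 f : L2) z‖ ^ 2 := (Lp.memLp (𝓕 f)).norm.integrable_sq
  have hcont : ContinuousAt (fun t => ∫ z, G t z) s := by
    refine continuousAt_of_dominated (bound := fun z => 4 * ‖(𝓕 f : L2) z‖ ^ 2)
      (Filter.Eventually.of_forall fun t => ?_)
      (Filter.Eventually.of_forall fun t => Filter.Eventually.of_forall fun z => ?_)
      (hf2.const_mul 4) (Filter.Eventually.of_forall fun z => ?_)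
    · refine AEStronglyMeasurable.pow (AEStronglyMeasurable.norm (AEStronglyMeasurable.mul ?_
        (Lp.aestronglyMeasurable _))) 2
      exact (((measurable_flowSymbol hm).comp hmz).sub
        ((measurable_flowSymbol hm).comp hmz)).aestronglyMeasurable
    · rw [hG]
      simp only
      rw [norm_pow, norm_norm, norm_mul, mul_pow]
      refine mul_le_mul_of_nonneg_right ?_ (by positivity)
      have := norm_sub_le (flowSymbol ψ α δ (-t) (2 * Real.pi * z 0, 2 * Real.pi * z 1))
        (flowSymbol ψ α δ (-s) (2 * Real.pi * z 0, 2 * Real.pi * z 1))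
      have h3 := norm_flowSymbol_le (α := α) (δ := δ) (τ := -t) h1
        (2 * Real.pi * z 0, 2 * Real.pi * z 1)
      have h4 := norm_flowSymbol_le (α := α) (δ := δ) (τ := -s) h1
        (2 * Real.pi * z 0, 2 * Real.pi * z 1)
      calc _ ≤ (2 : ℝ) ^ 2 := pow_le_pow_left₀ (norm_nonneg _) (by linarith) 2
        _ = 4 := by norm_num
    · refine Continuous.continuousAt ?_
      simp only [hG, flowSymbol]
      fun_prop
  have h0 : Filter.Tendsto (fun t => ‖dualFlow hm h1 α δ t f - dualFlow hm h1 α δ s f‖ ^ 2)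
      (nhds s) (nhds 0) := by
    simp only [e]
    have := hcont.tendsto
    rwa [← e s, sub_self, norm_zero, zero_pow two_ne_zero] at this
  refine tendsto_iff_norm_sub_tendsto_zero.2 ?_
  have := h0.sqrt
  simpa [Real.sqrt_sq] using this

end flow

section localized

variable {χ : ℝ → ℝ} {α δ N : ℝ}

theorem measurable_lpBump (hχ : IsLPCutoff χ) (N : ℝ) : Measurable (lpBump χ N) := by
  have hc : Measurable χ := hχ.smooth.continuous.measurable
  unfold lpBump
  split_ifs <;> fun_prop

theorem abs_lpBump_le (hχ : IsLPCutoff χ) (N ξ : ℝ) : |lpBump χ N ξ| ≤ 1 := by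
  rw [abs_le]
  unfold lpBump
  split_ifs
  · constructor <;> linarith [hχ.nonneg ξ, hχ.le_one ξ]
  · constructor <;> linarith [hχ.nonneg (ξ / N), hχ.le_one (ξ / N),
      hχ.nonneg (2 * (ξ / N)), hχ.le_one (2 * (ξ / N))]

theorem localizedFlow_eq (hχ : IsLPCutoff χ) (φ : L2) (t : ℝ) :
    localizedFlow hχ α δ N φ t = 𝓕⁻ (symbolOp (flowSymbol (lpBump χ N) α δ t)
      (isBoundedSymbol_flowSymbol (measurable_lpBump hχ N) (abs_lpBump_le hχ N) t) (𝓕 φ)) := by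
  rw [localizedFlow, projX, projSet, freeGroup,
    fourierMultiplier_eq (k := fun p => (lpBump χ N p.1 : ℂ)),
    fourierMultiplier_eq (k := fun p => (critRegion α δ)ᶜ.indicator (fun _ => (1 : ℂ)) p),
    fourierMultiplier_eq (k := fun p => Complex.exp (Complex.I * (t * omega α p.1 p.2 : ℝ))),
    FourierTransform.fourier_fourierInv_eq, FourierTransform.fourier_fourierInv_eq]
  congr 1
  refine Lp.ext ?_
  filter_upwards [symbolOp_coeFn (k := fun p => (lpBump χ N p.1 : ℂ)) (hk := isBoundedSymbol_lpBump hχ N)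
      (symbolOp (fun p => (critRegion α δ)ᶜ.indicator (fun _ => (1 : ℂ)) p)
        (isBoundedSymbol_indicator (measurableSet_critRegion α δ).compl)
        (symbolOp (fun p => Complex.exp (Complex.I * (t * omega α p.1 p.2 : ℝ)))
          (isBoundedSymbol_exp α t) (𝓕 φ))),
    symbolOp_coeFn (k := fun p => (critRegion α δ)ᶜ.indicator (fun _ => (1 : ℂ)) p)
      (hk := isBoundedSymbol_indicator (measurableSet_critRegion α δ).compl)
        (symbolOp (fun p => Complex.exp (Complex.I * (t * omega α p.1 p.2 : ℝ)))
          (isBoundedSymbol_exp α t) (𝓕 φ)),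
    symbolOp_coeFn (k := fun p => Complex.exp (Complex.I * (t * omega α p.1 p.2 : ℝ)))
      (hk := isBoundedSymbol_exp α t) (𝓕 φ),
    symbolOp_coeFn (hk := isBoundedSymbol_flowSymbol (α := α) (δ := δ) (measurable_lpBump hχ N)
      (abs_lpBump_le hχ N) t) (𝓕 φ)] with z h1 h2 h3 h4
  rw [h4, flowSymbol]
  refine h1.trans ?_
  rw [h2, h3]
  simp only
  ring

theorem norm_localizedFlow_le (hχ : IsLPCutoff χ) (φ : L2) (t : ℝ) :
    ‖localizedFlow hχ α δ N φ t‖ ≤ ‖φ‖ := by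
  rw [localizedFlow_eq, ← Lp.norm_fourier_eq, FourierTransform.fourier_fourierInv_eq,
    ← Lp.norm_fourier_eq φ]
  exact norm_symbolOp_le (norm_flowSymbol_le (abs_lpBump_le hχ N)) _

theorem inner_localizedFlow (hχ : IsLPCutoff χ) (φ d : L2) (t : ℝ) :
    (inner ℂ d (localizedFlow hχ α δ N φ t) : ℂ) = inner ℂ
      (dualFlow (measurable_lpBump hχ N) (abs_lpBump_le hχ N) α δ t d) (𝓕 φ) := by
  rw [localizedFlow_eq, ← Lp.inner_fourier_eq, FourierTransform.fourier_fourierInv_eq,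
    dualFlow_apply]
  exact inner_symbolOp_comm (fun p => flowSymbol_neg t p) _ _

/-- The Strichartz estimate resulting from a dispersive estimate with time decay `D`. -/
theorem mixedNorm_localizedFlow_le (hχ : IsLPCutoff χ) {L : ℝ}
    (hsupp : ∀ ξ, lpBump χ N ξ ≠ 0 → |ξ| ≤ L) {θ q : ℝ} (hθ : θ ∈ Ioo (0 : ℝ) 1) (hq : 2 < q)
    {D : ℝ → ℝ} (hDm : Measurable D) (hD0 : ∀ τ, 0 ≤ D τ) {R₀ : ℝ} {I S : Set ℝ}
    (hI : MeasurableSet I) (hS : MeasurableSet S) (hIS : ∀ t ∈ I, ∀ s ∈ I, t - s ∈ S)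
    (hD : ∀ R, R₀ ≤ R → ∀ τ ≠ 0, ∀ x y,
      ‖∫ ξ, kernelFun (fun ξ => lpBump χ N ξ ^ 2) α δ R τ x y ξ‖ ≤ D τ) (φ : L2) :
    mixedNorm (ENNReal.ofReal q) (ENNReal.ofReal (2 / (1 - θ))) I (localizedFlow hχ α δ N φ) ≤
      ‖φ‖ₑ * (∫⁻ τ in S, ENNReal.ofReal (D τ ^ (θ * (q / 2)))) ^ (1 / q) := by
  have hq0 : 0 < q := by linarith
  have hθ' : 0 < 1 - θ := by linarith [hθ.2]
  have hp : 1 < 2 / (1 - θ) := by rw [lt_div_iff₀ hθ']; linarith [hθ.1]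
  -- The dual exponent of p is exactly the exponent of the interpolated test functions.
  have hpp : 2 / (1 - θ) / (2 / (1 - θ) - 1) = 2 / (1 + θ) := by
    have : 2 / (1 - θ) - 1 = (1 + θ) / (1 - θ) := by field_simp; ring
    rw [this]
    have : 0 < 1 + θ := by linarith [hθ.1]
    field_simp
  obtain ⟨d, hd, hdp⟩ := exists_seq_isTest hp
  rw [hpp] at hd
  set v : ℕ → ℝ → L2 := fun n t =>
    dualFlow (measurable_lpBump hχ N) (abs_lpBump_le hχ N) α δ t (d n) with hv
  -- As S contains all differences of times in I, the kernel may be cut off outside S; this is what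
  -- allows a decay that is only locally integrable.
  set K : ℝ → ℝ≥0∞ := S.indicator fun τ => ENNReal.ofReal (D τ ^ θ) with hK
  have hKm : Measurable K := Measurable.indicator (by fun_prop) hS
  have key := lintegral_iSup_norm_inner_rpow_le hq (v := v)
    (fun n => (continuous_dualFlow _ _ (d n)).stronglyMeasurable) (C := fun n => ‖d n‖)
    (fun n t => norm_dualFlow_le _ _ t (d n)) hKm hI (fun n m t ht s hs hts => by
      rw [hK, indicator_of_mem (hIS t ht s hs), ← ofReal_norm]
      refine ENNReal.ofReal_le_ofReal ?_
      exact norm_inner_le_rpow_of_isTest (norm_dualFlow_le _ _ t) (norm_dualFlow_le _ _ s)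
        (hD0 _) hθ (fun f g hf hg => norm_inner_dualFlow_le _ _ hsupp
          (fun R hR x y => hD R hR (t - s) (sub_ne_zero.2 hts) x y) hf hg) (hd n) (hd m)) (𝓕 φ)
  have hKq : ∫⁻ τ, K τ ^ (q / 2) = ∫⁻ τ in S, ENNReal.ofReal (D τ ^ (θ * (q / 2))) := by
    rw [← lintegral_indicator hS]
    refine lintegral_congr fun τ => ?_
    rw [hK]
    by_cases h : τ ∈ S
    · rw [indicator_of_mem h, indicator_of_mem h, ENNReal.ofReal_rpow_of_nonneg
        (Real.rpow_nonneg (hD0 τ) _) (by positivity), ← Real.rpow_mul (hD0 τ)]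
    · rw [indicator_of_notMem h, indicator_of_notMem h, ENNReal.zero_rpow_of_pos (by positivity)]
  have hφ : ‖(𝓕 φ : L2)‖ₑ = ‖φ‖ₑ := by
    rw [← ofReal_norm, Lp.norm_fourier_eq, ofReal_norm]
  rw [hKq, hφ] at key
  rw [mixedNorm, eLpNorm_eq_lintegral_rpow_enorm_toReal (by simpa using hq0) ENNReal.ofReal_ne_top,
    ENNReal.toReal_ofReal hq0.le]
  calc _ ≤ (‖φ‖ₑ ^ q * ∫⁻ τ in S, ENNReal.ofReal (D τ ^ (θ * (q / 2)))) ^ (1 / q) := by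
        refine ENNReal.rpow_le_rpow (le_trans (lintegral_mono fun t => ?_) key) (by positivity)
        refine ENNReal.rpow_le_rpow ?_ hq0.le
        rw [enorm_eq_self]
        refine (hdp _).trans_eq ?_
        simp only [inner_localizedFlow, hv]
    _ = _ := by
        rw [ENNReal.mul_rpow_of_nonneg _ _ (by positivity), ← ENNReal.rpow_mul,
          mul_one_div_cancel hq0.ne', ENNReal.rpow_one]

end localized

end BOZK

/-! ### Integrability of the decay, choice of exponents, and the two estimates. -/

namespace BOZK
open Set
open scoped NNReal

theorem integrable_comp_abs {g : ℝ → ℝ} (hg : IntegrableOn g (Ioi 0)) :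
    Integrable fun t => g |t| := by
  have h1 : IntegrableOn (fun t => g |t|) (Ioi 0) :=
    hg.congr_fun (fun t ht => by simp only [abs_of_pos (mem_Ioi.1 ht)]) measurableSet_Ioi
  have h2 : IntegrableOn (fun t => g |t|) (Iio 0) := by
    have := (Measure.measurePreserving_neg (volume : Measure ℝ)).integrableOn_comp_preimage
      (Homeomorph.neg ℝ).measurableEmbedding (f := fun t => g |t|) (s := Ioi 0)
    simp only [Function.comp_def, abs_neg] at this
    have e : (Neg.neg ⁻¹' Ioi (0 : ℝ)) = Iio 0 := by ext; simp
    rw [e] at this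
    exact this.2 h1
  have h3 : IntegrableOn (fun t => g |t|) (Iic 0) := by
    rwa [integrableOn_Iic_iff_integrableOn_Iio]
  rw [← integrableOn_univ, ← Iic_union_Ioi (a := (0 : ℝ))]
  exact h3.union h1

/-- The decay of the unit-scale kernel. -/
noncomputable def kernelDecay (t : ℝ) : ℝ := min |t|⁻¹ (√|t|)⁻¹

theorem kernelDecay_nonneg (t : ℝ) : 0 ≤ kernelDecay t := le_min (by positivity) (by positivity)

theorem measurable_kernelDecay : Measurable kernelDecay := by unfold kernelDecay; fun_prop

theorem inv_sqrt_rpow {s : ℝ} (hs : 0 ≤ s) (b : ℝ) : (√s)⁻¹ ^ b = s ^ (-(b / 2)) := by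
  rw [Real.inv_rpow (Real.sqrt_nonneg _), Real.sqrt_eq_rpow, ← Real.rpow_mul hs, ← Real.rpow_neg hs]
  congr 1; ring

/-- Near 0 the function is |t|^{−b/2}, integrable as b < 2; at infinity it is |t|^{−b}, integrable
as b > 1. Neither decay rate suffices alone. -/
theorem integrable_kernelDecay_rpow {b : ℝ} (hb : b ∈ Ioo (1 : ℝ) 2) :
    Integrable fun t => kernelDecay t ^ b := by
  have hb0 : 0 ≤ b := by linarith [hb.1]
  have : (fun t => kernelDecay t ^ b) = fun t => kernelDecay |t| ^ b := by
    ext t; rw [kernelDecay, kernelDecay, abs_abs]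
  rw [this]
  refine integrable_comp_abs (g := fun t => kernelDecay t ^ b) ?_
  rw [← Ioc_union_Ioi_eq_Ioi zero_le_one]
  have hm : Measurable fun t => kernelDecay t ^ b := measurable_kernelDecay.pow_const b
  refine IntegrableOn.union ?_ ?_
  · have h := (intervalIntegral.intervalIntegrable_rpow' (a := 0) (b := 1) (r := -(b / 2))
      (by linarith [hb.2])).1
    refine Integrable.mono' h hm.aestronglyMeasurable ?_
    filter_upwards [ae_restrict_mem measurableSet_Ioc] with t ht
    rw [Real.norm_of_nonneg (Real.rpow_nonneg (kernelDecay_nonneg t) _), ← inv_sqrt_rpow ht.1.le]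
    refine Real.rpow_le_rpow (kernelDecay_nonneg t) ((min_le_right _ _).trans_eq ?_) hb0
    rw [abs_of_pos ht.1]
  · have h := integrableOn_Ioi_rpow_of_lt (a := -b) (c := 1) (by linarith [hb.1]) one_pos
    refine Integrable.mono' h hm.aestronglyMeasurable ?_
    filter_upwards [ae_restrict_mem measurableSet_Ioi] with t ht
    have ht0 : (0 : ℝ) < t := one_pos.trans ht
    rw [Real.norm_of_nonneg (Real.rpow_nonneg (kernelDecay_nonneg t) _), Real.rpow_neg ht0.le,
      ← Real.inv_rpow ht0.le]
    refine Real.rpow_le_rpow (kernelDecay_nonneg t) ((min_le_left _ _).trans_eq ?_) hb0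
    rw [abs_of_pos ht0]

theorem integrableOn_inv_sqrt_abs_rpow {b : ℝ} (hb : b < 2) (S : ℝ) :
    IntegrableOn (fun t => (√|t|)⁻¹ ^ b) (Icc (-S) S) := by
  have h : Integrable fun t => (Ioc (0 : ℝ) (|S| + 1)).indicator (fun s => s ^ (-(b / 2))) |t| := by
    refine integrable_comp_abs ?_
    refine Integrable.integrableOn ((integrable_indicator_iff measurableSet_Ioc).2 ?_)
    have := (intervalIntegral.intervalIntegrable_rpow' (a := 0) (b := |S| + 1) (r := -(b / 2))
      (by linarith)).1
    exact this
  refine Integrable.congr h.integrableOn ?_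
  have hne : ∀ᵐ t : ℝ ∂(volume.restrict (Icc (-S) S)), t ≠ 0 :=
    ae_restrict_of_ae (by rw [ae_iff]; simp)
  filter_upwards [ae_restrict_mem measurableSet_Icc, hne] with t ht h0
  have : |t| ∈ Ioc (0 : ℝ) (|S| + 1) :=
    ⟨abs_pos.2 h0, by linarith [abs_le.2 ht, le_abs_self S]⟩
  rw [indicator_of_mem this, inv_sqrt_rpow (abs_nonneg t)]

theorem lpBump_ne_one_sq {N : ℝ} (hN : N ≠ 1) (χ : ℝ → ℝ) (ξ : ℝ) :
    lpBump χ N ξ ^ 2 = (fun η => (χ η - χ (2 * η)) ^ 2) (ξ / N) := by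
  simp only [lpBump, if_neg hN]

theorem annulus_of_bump_ne_zero {χ : ℝ → ℝ} (hχ : IsLPCutoff χ) {ξ : ℝ} (h : χ ξ - χ (2 * ξ) ≠ 0) :
    1 / 2 < |ξ| ∧ |ξ| ≤ 2 := by
  have h2 : |2 * ξ| = 2 * |ξ| := by rw [abs_mul, abs_two]
  constructor
  · by_contra! hc
    exact h (by rw [hχ.eq_one ξ (by linarith), hχ.eq_one (2 * ξ) (by rw [h2]; linarith), sub_self])
  · by_contra! hc
    exact h (by rw [hχ.eq_zero ξ (by linarith), hχ.eq_zero (2 * ξ) (by rw [h2]; linarith), sub_self])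

section estimates

variable {α δ : ℝ} {χ : ℝ → ℝ}

/-- The dispersive estimate at frequency `N`. -/
theorem exists_norm_integral_kernelFun_lpBump_le (hα : α ∈ Icc (1 : ℝ) 2) (hδ : δ ∈ Ioo (0 : ℝ) 1)
    (hχ : IsLPCutoff χ) : ∃ C, 0 < C ∧ ∀ N : ℝ, 1 < N → ∃ R₀, ∀ R, R₀ ≤ R → ∀ τ ≠ 0, ∀ x y,
      ‖∫ ξ, kernelFun (fun ξ => lpBump χ N ξ ^ 2) α δ R τ x y ξ‖ ≤
        C * N ^ (1 + α / 2) * kernelDecay (N ^ (α + 1) * τ) := by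
  set Ψ : ℝ → ℝ := fun η => (χ η - χ (2 * η)) ^ 2 with hΨ
  have hΨs : ∀ ξ, Ψ ξ ≠ 0 → 1 / 2 < |ξ| ∧ |ξ| ≤ 2 := fun ξ h =>
    annulus_of_bump_ne_zero hχ fun h0 => h (by simp [hΨ, h0])
  have hΨd : ContDiff ℝ 1 Ψ := by
    have : ContDiff ℝ 1 χ := hχ.smooth.of_le (by exact_mod_cast le_top)
    fun_prop
  have hΨ1 : ∀ ξ, |Ψ ξ| ≤ 1 := fun ξ => by
    rw [abs_pow]
    refine pow_le_one₀ (abs_nonneg _) (abs_le.2 ⟨?_, ?_⟩) <;>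
      linarith [hχ.nonneg ξ, hχ.le_one ξ, hχ.nonneg (2 * ξ), hχ.le_one (2 * ξ)]
  obtain ⟨C, hC0, hC⟩ := norm_integral_kernelFun_le hα hδ hΨd hΨs
  -- C serves the |τ|⁻¹ decay on the annulus, 500 the |τ|^{−1/2} decay.
  refine ⟨max C 500, by positivity, fun N hN => ?_⟩
  have hN0 : 0 < N := by linarith
  -- Chosen so that the rescaled truncation R/N^{α/2} still contains the critical region over |ξ| ≤
  -- 2.
  refine ⟨outerRadius α δ * 2 ^ (α / 2) * N ^ (α / 2), fun R hR τ hτ x y => ?_⟩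
  have hNα : 0 < N ^ (α / 2) := Real.rpow_pos_of_pos hN0 _
  have hR' : outerRadius α δ * 2 ^ (α / 2) ≤ R / N ^ (α / 2) := by rwa [le_div_iff₀ hNα]
  have hτ' : N ^ (α + 1) * τ ≠ 0 := mul_ne_zero (Real.rpow_pos_of_pos hN0 _).ne' hτ
  have e : (fun ξ => lpBump χ N ξ ^ 2) = fun ξ => Ψ (ξ / N) := by
    ext ξ; exact lpBump_ne_one_sq hN.ne' χ ξ
  rw [e, integral_kernelFun_scale hN0, norm_mul, Complex.norm_real,
    Real.norm_of_nonneg (Real.rpow_nonneg hN0.le _), mul_comm (max C 500), mul_assoc]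
  refine mul_le_mul_of_nonneg_left ?_ (Real.rpow_nonneg hN0.le _)
  rw [kernelDecay, mul_min_of_nonneg _ _ (by positivity)]
  refine le_min ?_ ?_
  · refine (hC _ _ _ _ hR' hτ').trans ?_
    rw [div_eq_mul_inv]
    exact mul_le_mul_of_nonneg_right (le_max_left _ _) (by positivity)
  · refine (norm_integral_kernelFun_le_sqrt hα hδ hΨ1 (fun ξ h => (hΨs ξ h).2) hR' hτ' _ _).trans ?_
    rw [div_eq_mul_inv]
    exact mul_le_mul_of_nonneg_right (le_max_right _ _) (by positivity)

theorem lintegral_kernelDecay_scale {b : ℝ} (hb : b ∈ Ioo (1 : ℝ) 2) {a s : ℝ} (ha : 0 ≤ a)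
    (hs : 0 < s) : ∫⁻ τ, ENNReal.ofReal ((a * kernelDecay (s * τ)) ^ b) =
      ENNReal.ofReal (a ^ b * (s⁻¹ * ∫ t, kernelDecay t ^ b)) := by
  have hi := integrable_kernelDecay_rpow hb
  have e : ∀ τ, (a * kernelDecay (s * τ)) ^ b = a ^ b * kernelDecay (s * τ) ^ b := fun τ =>
    Real.mul_rpow ha (kernelDecay_nonneg _)
  simp only [e]
  rw [← ofReal_integral_eq_lintegral_ofReal ((hi.comp_mul_left' hs.ne').const_mul _)
    (Filter.Eventually.of_forall fun τ => mul_nonneg (Real.rpow_nonneg ha _)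
      (Real.rpow_nonneg (kernelDecay_nonneg _) _)), MeasureTheory.integral_const_mul,
    Measure.integral_comp_mul_left (fun t => kernelDecay t ^ b) s, abs_of_pos (inv_pos.2 hs),
    smul_eq_mul]

theorem mixedNorm_top_localizedFlow_le (hχ : IsLPCutoff χ) (N : ℝ) (I : Set ℝ) (φ : L2) :
    mixedNorm ⊤ 2 I (localizedFlow hχ α δ N φ) ≤ ‖φ‖ₑ := by
  rw [mixedNorm, eLpNorm_exponent_top]
  refine eLpNormEssSup_le_of_ae_enorm_bound (Filter.Eventually.of_forall fun t => ?_)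
  rw [enorm_eq_self, ← Lp.enorm_def, ← ofReal_norm, ← ofReal_norm]
  exact ENNReal.ofReal_le_ofReal (norm_localizedFlow_le hχ φ t)

theorem exists_mixedNorm_localizedFlow_le (hα : α ∈ Icc (1 : ℝ) 2) (hδ : δ ∈ Ioo (0 : ℝ) 1)
    (hχ : IsLPCutoff χ) {θ ε : ℝ} (hθ : θ ∈ Ioo (0 : ℝ) 1) (hε : ε ∈ Ioo (0 : ℝ) (1 / 4)) :
    ∃ C : ℝ, 0 < C ∧ ∀ N : ℝ, 1 < N → ∀ φ : L2,
      mixedNorm (ENNReal.ofReal (2 / (θ * (1 - ε)))) (ENNReal.ofReal (2 / (1 - θ))) univ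
        (localizedFlow hχ α δ N φ) ≤
        ENNReal.ofReal (C * N ^ (θ * (ε * (α + 1) - α / 4)) * ‖φ‖) := by
  obtain ⟨C, hC0, hC⟩ := exists_norm_integral_kernelFun_lpBump_le hα hδ hχ
  have hε1 : 0 < 1 - ε := by linarith [hε.2]
  have hθ0 := hθ.1
  -- This is θq/2, the power of the kernel bound that must be integrable in time.
  set b : ℝ := 1 / (1 - ε) with hb
  have hbI : b ∈ Ioo (1 : ℝ) 2 := by
    constructor
    · rw [hb, lt_div_iff₀ hε1]; linarith [hε.1]
    · rw [hb, div_lt_iff₀ hε1]; linarith [hε.2]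
  set q : ℝ := 2 / (θ * (1 - ε)) with hq
  have hq2 : 2 < q := by
    rw [hq, lt_div_iff₀ (by positivity)]
    nlinarith [hε.1, hθ.2]
  have hq0 : 0 < q := by linarith
  have hqb : θ * (q / 2) = b := by rw [hq, hb]; field_simp
  set J := ∫ t, kernelDecay t ^ b with hJ
  have hJ0 : 0 ≤ J := integral_nonneg fun t => Real.rpow_nonneg (kernelDecay_nonneg t) _
  refine ⟨C ^ (b * (1 / q)) * J ^ (1 / q) + 1, by positivity, fun N hN φ => ?_⟩
  have hN0 : 0 < N := by linarith
  obtain ⟨R₀, hR₀⟩ := hC N hN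
  have hsupp : ∀ ξ, lpBump χ N ξ ≠ 0 → |ξ| ≤ 2 * N := fun ξ h => by
    rw [lpBump, if_neg hN.ne'] at h
    have := (annulus_of_bump_ne_zero hχ h).2
    rwa [abs_div, abs_of_pos hN0, div_le_iff₀ hN0] at this
  have hNp : 0 ≤ C * N ^ (1 + α / 2) := mul_nonneg hC0.le (Real.rpow_nonneg hN0.le _)
  have key := mixedNorm_localizedFlow_le (α := α) (δ := δ) hχ hsupp hθ hq2
    (D := fun τ => C * N ^ (1 + α / 2) * kernelDecay (N ^ (α + 1) * τ))
    (by have := measurable_kernelDecay; fun_prop) (fun τ => mul_nonneg hNp (kernelDecay_nonneg _))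
    (I := univ) (S := univ) MeasurableSet.univ MeasurableSet.univ (fun _ _ _ _ => mem_univ _) hR₀ φ
  rw [hqb, Measure.restrict_univ, lintegral_kernelDecay_scale hbI hNp
    (Real.rpow_pos_of_pos hN0 _), ← hJ] at key
  refine key.trans ?_
  have hN1 : 0 ≤ (C * N ^ (1 + α / 2)) ^ b * ((N ^ (α + 1))⁻¹ * J) :=
    mul_nonneg (Real.rpow_nonneg hNp _) (mul_nonneg (inv_nonneg.2 (Real.rpow_nonneg hN0.le _)) hJ0)
  rw [ENNReal.ofReal_rpow_of_nonneg hN1 (by positivity), ← ofReal_norm, mul_comm,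
    ← ENNReal.ofReal_mul (Real.rpow_nonneg hN1 _)]
  refine ENNReal.ofReal_le_ofReal (mul_le_mul_of_nonneg_right ?_ (norm_nonneg _))
  -- With b/q = θ/2 and 1/q = θ(1 − ε)/2, scaling yields the exponent θ(ε(α+1)/2 − α/4). This is
  -- better than required, and is weakened using N > 1.
  have e : ((C * N ^ (1 + α / 2)) ^ b * ((N ^ (α + 1))⁻¹ * J)) ^ (1 / q) =
      C ^ (b * (1 / q)) * J ^ (1 / q) * N ^ (θ * (ε * (α + 1) / 2 - α / 4)) := by
    rw [Real.mul_rpow hC0.le (Real.rpow_nonneg hN0.le _), ← Real.rpow_neg hN0.le,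
      ← Real.rpow_mul hN0.le, Real.mul_rpow (by positivity) (by positivity),
      Real.mul_rpow (by positivity) (by positivity), Real.mul_rpow (by positivity) (by positivity),
      ← Real.rpow_mul hC0.le, ← Real.rpow_mul hN0.le, ← Real.rpow_mul hN0.le]
    have e2 : θ * (ε * (α + 1) / 2 - α / 4) = (1 + α / 2) * b * (1 / q) + -(α + 1) * (1 / q) := by
      rw [hb, hq]; field_simp; ring
    rw [e2, Real.rpow_add hN0]
    ring
  rw [e]
  refine mul_le_mul (by linarith) (Real.rpow_le_rpow_of_exponent_le hN.le ?_) (by positivity)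
    (by positivity)
  have : 0 ≤ ε * (α + 1) := mul_nonneg hε.1.le (by linarith [hα.1])
  gcongr
  linarith

/-- The bump at N = 1 does not vanish near ξ = 0, so only the |τ|^{−1/2} decay is used. Time
differences stay in [−2T, 2T], where |τ|^{−b/2} is integrable. -/
theorem exists_mixedNorm_localizedFlow_one_le (hα : α ∈ Icc (1 : ℝ) 2) (hδ : δ ∈ Ioo (0 : ℝ) 1)
    (hχ : IsLPCutoff χ) {θ ε : ℝ} (hθ : θ ∈ Ioo (0 : ℝ) 1) (hε : ε ∈ Ioo (0 : ℝ) (1 / 4)) (T : ℝ) :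
    ∃ C : ℝ, 0 < C ∧ ∀ φ : L2,
      mixedNorm (ENNReal.ofReal (2 / (θ * (1 - ε)))) (ENNReal.ofReal (2 / (1 - θ))) (Icc (-T) T)
        (localizedFlow hχ α δ 1 φ) ≤ ENNReal.ofReal (C * ‖φ‖) := by
  have hε1 : 0 < 1 - ε := by linarith [hε.2]
  have hθ0 := hθ.1
  set b : ℝ := 1 / (1 - ε) with hb
  have hb2 : b < 2 := by rw [hb, div_lt_iff₀ hε1]; linarith [hε.2]
  set q : ℝ := 2 / (θ * (1 - ε)) with hq
  have hq2 : 2 < q := by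
    rw [hq, lt_div_iff₀ (by positivity)]
    nlinarith [hε.1, hθ.2]
  have hqb : θ * (q / 2) = b := by rw [hq, hb]; field_simp
  have hsupp : ∀ ξ, lpBump χ 1 ξ ≠ 0 → |ξ| ≤ 2 := fun ξ h => by
    by_contra! hc
    exact h (by rw [lpBump, if_pos rfl]; exact hχ.eq_zero ξ (by linarith))
  have h1 : ∀ ξ, |lpBump χ 1 ξ ^ 2| ≤ 1 := fun ξ => by
    rw [abs_pow]; exact pow_le_one₀ (abs_nonneg _) (abs_lpBump_le hχ 1 ξ)
  set X := ∫⁻ τ in Icc (-(2 * T)) (2 * T), ENNReal.ofReal ((500 / √|τ|) ^ b) with hX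
  have hXfin : X ≠ ⊤ := by
    have e : ∀ τ : ℝ, (500 / √|τ|) ^ b = 500 ^ b * (√|τ|)⁻¹ ^ b := fun τ => by
      rw [div_eq_mul_inv, Real.mul_rpow (by norm_num) (by positivity)]
    rw [hX]
    simp only [e]
    exact ((integrableOn_inv_sqrt_abs_rpow hb2 (2 * T)).const_mul (500 ^ b)).lintegral_lt_top.ne
  have hXq : X ^ (1 / q) ≠ ⊤ := ENNReal.rpow_ne_top_of_nonneg (by positivity) hXfin
  refine ⟨(X ^ (1 / q)).toReal + 1, by positivity, fun φ => ?_⟩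
  have key := mixedNorm_localizedFlow_le (α := α) (δ := δ) hχ hsupp hθ hq2
    (D := fun τ => 500 / √|τ|) (by fun_prop) (fun τ => by positivity)
    (I := Icc (-T) T) (S := Icc (-(2 * T)) (2 * T)) measurableSet_Icc measurableSet_Icc
    (fun t ht s hs => ⟨by linarith [ht.1, hs.2], by linarith [ht.2, hs.1]⟩)
    (fun R hR τ hτ x y => norm_integral_kernelFun_le_sqrt hα hδ h1
      (fun ξ h => hsupp ξ fun h0 => h (by simp [h0])) hR hτ x y) φ
  rw [hqb] at key
  refine key.trans ?_
  set Y := X ^ (1 / q)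
  rw [← ofReal_norm, mul_comm]
  nth_rewrite 1 [← ENNReal.ofReal_toReal hXq]
  rw [← ENNReal.ofReal_mul ENNReal.toReal_nonneg]
  exact ENNReal.ofReal_le_ofReal (mul_le_mul_of_nonneg_right (by linarith) (norm_nonneg _))

end estimates

end BOZK

theorem proposition3p1 :
    ∃ ε₀ : ℝ, 0 < ε₀ ∧
      ∀ α ∈ Set.Icc (1 : ℝ) 2, ∀ δ ∈ Set.Ioo (0 : ℝ) 1,
      ∀ (χ : ℝ → ℝ) (hχ : BOZK.IsLPCutoff χ),
      ∀ θ ∈ Set.Ico (0 : ℝ) 1, ∀ ε ∈ Set.Ioo (0 : ℝ) ε₀,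
      ∀ p q : ENNReal,
        p⁻¹ = ENNReal.ofReal ((1 - θ) / 2) →
        q⁻¹ = ENNReal.ofReal (θ * ((1 - ε) / 2)) →
        (∃ C : ℝ, 0 < C ∧ ∀ N ∈ BOZK.dyadic, N ≠ 1 → ∀ φ : BOZK.L2,
          BOZK.mixedNorm q p Set.univ (BOZK.localizedFlow hχ α δ N φ) ≤
            ENNReal.ofReal (C * N ^ (θ * (ε * (α + 1) - α / 4)) * ‖φ‖)) ∧
        (∀ T : ℝ, 0 < T → ∃ C : ℝ, 0 < C ∧ ∀ φ : BOZK.L2,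
          BOZK.mixedNorm q p (Set.Icc (-T) T) (BOZK.localizedFlow hχ α δ 1 φ) ≤
            ENNReal.ofReal (C * ‖φ‖)) := by
  -- Any positive threshold up to 1/2 would do: its essential role is to ensure b = 1/(1 − ε) < 2.
  refine ⟨1 / 4, by norm_num, fun α hα δ hδ χ hχ θ hθ ε hε p q hp hq => ?_⟩
  have hp' : p = ENNReal.ofReal (2 / (1 - θ)) := by
    rw [← inv_inv p, hp, ← ENNReal.ofReal_inv_of_pos (by linarith [hθ.2]), inv_div]
  -- For θ = 0 the exponents are q = ∞ and p = 2, and the claim is the L² bound for the flow at each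
  -- time.
  rcases hθ.1.eq_or_lt with h0 | h0
  · subst h0
    have hp2 : p = 2 := by rw [hp']; norm_num
    have hq2 : q = ⊤ := by simpa using hq
    subst hp2 hq2
    refine ⟨⟨1, one_pos, fun N _ _ φ => ?_⟩, fun T _ => ⟨1, one_pos, fun φ => ?_⟩⟩
    · rw [zero_mul, Real.rpow_zero, one_mul, one_mul, ofReal_norm]
      exact BOZK.mixedNorm_top_localizedFlow_le hχ N _ φ
    · rw [one_mul, ofReal_norm]
      exact BOZK.mixedNorm_top_localizedFlow_le hχ 1 _ φ
  have hθ' : θ ∈ Set.Ioo (0 : ℝ) 1 := ⟨h0, hθ.2⟩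
  have hε1 : 0 < 1 - ε := by linarith [hε.2]
  have hq' : q = ENNReal.ofReal (2 / (θ * (1 - ε))) := by
    rw [← inv_inv q, hq, ← ENNReal.ofReal_inv_of_pos (by positivity)]
    congr 1
    field_simp
  subst hp' hq'
  refine ⟨?_, fun T _ => BOZK.exists_mixedNorm_localizedFlow_one_le hα hδ hχ hθ' hε T⟩
  obtain ⟨C, hC0, hC⟩ := BOZK.exists_mixedNorm_localizedFlow_le hα hδ hχ hθ' hε
  refine ⟨C, hC0, fun N hN hN1 φ => hC N ?_ φ⟩
  obtain ⟨l, rfl⟩ := hN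
  exact lt_of_le_of_ne (one_le_pow₀ one_le_two) hN1.symm
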